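/- **Setting.** Let $\mathcal J$ be a countable set (of sorts), let $\mathcal J^{<\mathbb N}$ be the set of non-empty finite tuples from $\mathcal J$, and fix a function $J^*_\subset:\mathbb N_{>0}\times\mathcal J^{<\mathbb N}\to\mathcal J^{<\mathbb N}$. For a tuple $J$ let $\Vert J\Vert$ be its set of entries and $\sqrt J=\{J':\Vert J\Vert\subset\Vert J'\Vert\}$. *Sorting data* on a profinite group $G$ assign to each open normal subgroup $N$ a non-empty set $F(N)\subset\mathcal J^{<\mathbb N}$ such that $F(G)=\mathcal J^{<\mathbb N}$; $J\in F(N)\Leftrightarrow\sqrt J\subset F(N)$; $F(N)$ is closed under permuting the entries of tuples; if $N_1\subset N_2$, $[G:N_1]\le k$ and $J\in F(N_1)$, then $J^*_\subset(k,J)\in F(N_2)$; if $J_i\in F(N_i)$ for $i=1,2$, then $J_1{}^\frown J_2\in F(N_1\cap N_2)$; and $F(N_1)=F(N_2)$ if $N_1,N_2$ are conjugate in $G$. Let $\mathcal L$ be the many-sorted first-order language with a sort $m(k,J)$ for each $(k,J)\in\mathbb N_{>0}\times\mathcal J^{<\mathbb N}$ (distinct sorts being disjoint), binary relations $\le$ and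 $C$ between any two sorts, and a ternary relation $P$ on each sort. The $\mathcal L$-structure $S(G,F)$ has as elements of sort $m(k,J)$ the cosets $gN$ with $N$ open normal, $[G:N]\le k$, $J\in F(N)$; $gN\le g'N'$ means $N\subset N'$; $C(gN,g'N')$ means $gN\subset g'N'$; and $P(g_1N,g_2N,g_3N)$ means $g_1g_2N=g_3N$. A *sorted complete system* is an $\mathcal L$-structure isomorphic to some $S(G,F)$. Write $a\sim b$ if $a\le b\le a$. A *subsystem* of a sorted complete system $S$ is a substructure that is itself a sorted complete system; $S_X$ is the smallest subsystem containing $X\subset S$, and a subsystem is *finitely generated* if it is $S_X$ with $X$ finite. A set $X\subset S$ is a *presystem* if (locally full) whenever $x\in X$ has sort $m(k,J)$, $y$ has sort $m(k,J)$ and $x\sim y$, then $y\in X$, and (relatively dense) for every $s\in S_X$ there is $x\in X$ with $x\le s$. Let $\operatorname{coFSIm}(S)$ be the set of isomorphism classes of finitely generated subsystems of $S$. $S$ has *co-SEP* if for all finitely generated subsystems $S_1,S_2$ of $S$ and all embeddings $\Pi:S_2\to S_1$ and $\Phi:S_2\to S$ there is an embedding $\Psi:S_1\to S$ with $\Psi\circ\Pi=\Phi$.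 Let $SCS_{SEP}$ be the set of all $\mathcal L$-sentences true in every sorted complete system having co-SEP. **Theorem.** Let $S$ be a sorted complete system having co-SEP. 1. The models of $SCS_{SEP}$ are exactly the sorted complete systems having co-SEP. 2. For every finitely generated sorted complete system $A$, each of the two properties of a sorted complete system $M$, * there is a finite presystem $X$ of $M$ with $S_X\cong A$; * for every finite presystem $Y$ of $M$, $S_Y\not\cong A$ (where $S_X$, $S_Y$ are formed in $M$), is expressed, over all sorted complete systems $M$, by an $\mathcal L$-sentence. 3. $\operatorname{Th}(S)$ is axiomatized by $SCS_{SEP}$ together with the following axioms: for every $S_1\in\operatorname{coFSIm}(S)$, "there is a finite presystem $X$ with $S_X\cong S_1$", and for every finitely generated sorted complete system $S_2$ whose isomorphism class is not in $\operatorname{coFSIm}(S)$, "for every finite presystem $Y$, $S_Y\not\cong S_2$". That is, an $\mathcal L$-structure is a model of $\operatorname{Th}(S)$ if and only if it is a model of all these axioms. -/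

import Mathlib

universe u v w w'

namespace SortedSystem

/-! ### Sorts and sorted profinite groups -/

/-- Non-empty finite tuples of elements of `J`. -/
def Tup (J : Type u) : Type u := {l : List J // l ≠ []}

/-- The set of entries of a tuple. -/
def Tup.support {J : Type u} (T : Tup J) : Set J := {j | j ∈ T.1}

/-- Concatenation of tuples. -/
def Tup.append {J : Type u} (T T' : Tup J) : Tup J :=
  ⟨T.1 ++ T'.1, fun h => T.2 (List.append_eq_nil_iff.1 h).1⟩

/-- The tuples in which every entry of `T` occurs. -/
def Tup.root {J : Type u} (T : Tup J) : Set (Tup J) := {T' | T.support ⊆ T'.support}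

/-- The sorts `(k, T)` of the language: a positive integer and a non-empty tuple. -/
abbrev Srt (J : Type u) : Type u := ℕ+ × Tup J

/-- Sorting data on a profinite group `G`, with respect to the set of sorts `J` and the fixed
function `Jsub` (the second fixed function is concatenation of tuples). -/
structure SortingData {J : Type u} (Jsub : ℕ+ → Tup J → Tup J) (G : ProfiniteGrp.{w}) where
  F : OpenNormalSubgroup G → Set (Tup J)
  nonempty : ∀ N, (F N).Nonempty
  whole : ∀ N : OpenNormalSubgroup G, N.toSubgroup = ⊤ → F N = Set.univ
  root : ∀ N T, T ∈ F N ↔ T.root ⊆ F N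
  perm : ∀ N (T T' : Tup J), T.1.Perm T'.1 → (T ∈ F N ↔ T' ∈ F N)
  up : ∀ (N₁ N₂ : OpenNormalSubgroup G) (k : ℕ+) (T : Tup J), N₁ ≤ N₂ →
    N₁.toSubgroup.index ≤ k → T ∈ F N₁ → Jsub k T ∈ F N₂
  inter : ∀ (N₁ N₂ : OpenNormalSubgroup G) (T₁ T₂ : Tup J),
    T₁ ∈ F N₁ → T₂ ∈ F N₂ → T₁.append T₂ ∈ F (N₁ ⊓ N₂)
  conj : ∀ (N₁ N₂ : OpenNormalSubgroup G) (g : G),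
    (∀ x : G, x ∈ N₂ ↔ g * x * g⁻¹ ∈ N₁) → F N₁ = F N₂

/-! ### Structures for the many-sorted language -/

/-- Structures for the many-sorted relational language with sorts `(k, T)`, binary relations
`≤` and `C` between any two sorts, and a ternary relation `P` on each sort. -/
structure Str (J : Type u) where
  carrier : Srt J → Type w
  le : ∀ {s t : Srt J}, carrier s → carrier t → Prop
  C : ∀ {s t : Srt J}, carrier s → carrier t → Prop
  P : ∀ {s : Srt J}, carrier s → carrier s → carrier s → Prop

/-- The elements of a structure, of all sorts (the sorts are disjoint). -/
abbrev Str.Elt {J : Type u} (M : Str.{u, w} J) : Type (max u w) := Σ s : Srt J, M.carrier s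

/-- The substructure on a set of elements (the language is relational). -/
def Str.restrict {J : Type u} (M : Str.{u, w} J) (X : Set M.Elt) : Str.{u, w} J where
  carrier s := {a : M.carrier s // (⟨s, a⟩ : M.Elt) ∈ X}
  le a b := M.le a.1 b.1
  C a b := M.C a.1 b.1
  P a b c := M.P a.1 b.1 c.1

/-- Embeddings of structures. -/
structure Emb {J : Type u} (M : Str.{u, w} J) (N : Str.{u, w'} J) where
  toFun : ∀ s : Srt J, M.carrier s → N.carrier s
  inj : ∀ s, Function.Injective (toFun s)
  map_le : ∀ {s t : Srt J} (a : M.carrier s) (b : M.carrier t),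
    N.le (toFun s a) (toFun t b) ↔ M.le a b
  map_C : ∀ {s t : Srt J} (a : M.carrier s) (b : M.carrier t),
    N.C (toFun s a) (toFun t b) ↔ M.C a b
  map_P : ∀ {s : Srt J} (a b c : M.carrier s),
    N.P (toFun s a) (toFun s b) (toFun s c) ↔ M.P a b c

/-- Two structures are isomorphic: there is a surjective embedding. -/
def Iso {J : Type u} (M : Str.{u, w} J) (N : Str.{u, w'} J) : Prop :=
  ∃ f : Emb M N, ∀ s, Function.Surjective (f.toFun s)

/-! ### Sorted complete systems -/

/-- The sorted complete system of a sorted profinite group: the elements of sort `(k, T)` are the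
cosets of the open normal subgroups `N` with `[G : N] ≤ k` and `T ∈ F N`; the relation `a ≤ b` is
inclusion of the subgroups, `C a b` is inclusion of the cosets, and `P` is the graph of the
multiplication of `G ⧸ N`. -/
def systemOf {J : Type u} {Jsub : ℕ+ → Tup J → Tup J} (G : ProfiniteGrp.{w})
    (D : SortingData Jsub G) : Str.{u, w} J where
  carrier s := Σ N : {N : OpenNormalSubgroup G // N.toSubgroup.index ≤ s.1 ∧ s.2 ∈ D.F N},
    G ⧸ N.1.toSubgroup
  le a b := a.1.1 ≤ b.1.1
  C a b := ∀ g : G, (QuotientGroup.mk g : G ⧸ a.1.1.toSubgroup) = a.2 →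
    (QuotientGroup.mk g : G ⧸ b.1.1.toSubgroup) = b.2
  P a b c := ∃ (N : _) (x y : G ⧸ N.1.toSubgroup), a = ⟨N, x⟩ ∧ b = ⟨N, y⟩ ∧ c = ⟨N, x * y⟩

/-- `M` is a sorted complete system: it is isomorphic to the system of some sorted profinite
group. -/
def IsSCS {J : Type u} (Jsub : ℕ+ → Tup J → Tup J) (M : Str.{u, w} J) : Prop :=
  ∃ (G : ProfiniteGrp.{w}) (D : SortingData Jsub G), Iso (systemOf G D) M

/-- The set `A` carries a subsystem of `M`: a substructure that is a sorted complete system. -/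
def IsSubsystem {J : Type u} (Jsub : ℕ+ → Tup J → Tup J) (M : Str.{u, w} J)
    (A : Set M.Elt) : Prop :=
  IsSCS Jsub (M.restrict A)

/-- The smallest subsystem that contains `X`. -/
def generated {J : Type u} (Jsub : ℕ+ → Tup J → Tup J) (M : Str.{u, w} J)
    (X : Set M.Elt) : Set M.Elt :=
  ⋂₀ {A | IsSubsystem Jsub M A ∧ X ⊆ A}

/-- Finitely generated subsystems of `M`. -/
def IsFGSubsystem {J : Type u} (Jsub : ℕ+ → Tup J → Tup J) (M : Str.{u, w} J)
    (A : Set M.Elt) : Prop :=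
  IsSubsystem Jsub M A ∧ ∃ X : Set M.Elt, X.Finite ∧ generated Jsub M X = A

/-- `M` is a finitely generated sorted complete system. -/
def IsFGSystem {J : Type u} (Jsub : ℕ+ → Tup J → Tup J) (M : Str.{u, w} J) : Prop :=
  IsSCS Jsub M ∧ ∃ X : Set M.Elt, X.Finite ∧ generated Jsub M X = Set.univ

/-- The isomorphism class of `A` belongs to `coFSIm(M)`: `A` is isomorphic to a finitely generated
subsystem of `M`. -/
def InCoFSIm {J : Type u} (Jsub : ℕ+ → Tup J → Tup J) (M A : Str.{u, w} J) : Prop :=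
  ∃ B : Set M.Elt, IsFGSubsystem Jsub M B ∧ Iso (M.restrict B) A

/-- `X` is locally full: together with an element of `M(k, T)` it contains all the elements of
`M(k, T)` which are `∼`-equivalent to it. -/
def LocallyFull {J : Type u} (M : Str.{u, w} J) (X : Set M.Elt) : Prop :=
  ∀ (s : Srt J) (a b : M.carrier s), (⟨s, a⟩ : M.Elt) ∈ X → M.le a b → M.le b a →
    (⟨s, b⟩ : M.Elt) ∈ X

/-- `X` is relatively dense: every element of the subsystem generated by `X` lies above an element
of `X`. -/
def RelativelyDense {J : Type u} (Jsub : ℕ+ → Tup J → Tup J) (M : Str.{u, w} J)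
    (X : Set M.Elt) : Prop :=
  ∀ p ∈ generated Jsub M X, ∃ q ∈ X, M.le q.2 p.2

/-- Presystems. -/
def IsPresystem {J : Type u} (Jsub : ℕ+ → Tup J → Tup J) (M : Str.{u, w} J)
    (X : Set M.Elt) : Prop :=
  LocallyFull M X ∧ RelativelyDense Jsub M X

/-- The co-sorted embedding property. -/
def CoSEP {J : Type u} (Jsub : ℕ+ → Tup J → Tup J) (M : Str.{u, w} J) : Prop :=
  ∀ A B : Set M.Elt, IsFGSubsystem Jsub M A → IsFGSubsystem Jsub M B →
    ∀ (p : Emb (M.restrict B) (M.restrict A)) (f : Emb (M.restrict B) M),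
      ∃ g : Emb (M.restrict A) M, ∀ (s : Srt J) (b : (M.restrict B).carrier s),
        g.toFun s (p.toFun s b) = f.toFun s b

/-! ### Many-sorted first-order logic -/

/-- Variables of sort `s` in the context `Γ` (a finite list of sorts). -/
inductive Var {J : Type u} : List (Srt J) → Srt J → Type u
  | zero {Γ : List (Srt J)} {s : Srt J} : Var (s :: Γ) s
  | succ {Γ : List (Srt J)} {s t : Srt J} : Var Γ s → Var (t :: Γ) s

/-- First-order formulas with free variables in the context `Γ`. -/
inductive Fml (J : Type u) : List (Srt J) → Type u
  | falsum {Γ : List (Srt J)} : Fml J Γ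
  | eq {Γ : List (Srt J)} {s : Srt J} : Var Γ s → Var Γ s → Fml J Γ
  | le {Γ : List (Srt J)} {s t : Srt J} : Var Γ s → Var Γ t → Fml J Γ
  | C {Γ : List (Srt J)} {s t : Srt J} : Var Γ s → Var Γ t → Fml J Γ
  | P {Γ : List (Srt J)} {s : Srt J} : Var Γ s → Var Γ s → Var Γ s → Fml J Γ
  | imp {Γ : List (Srt J)} : Fml J Γ → Fml J Γ → Fml J Γ
  | all {Γ : List (Srt J)} (s : Srt J) : Fml J (s :: Γ) → Fml J Γ

/-- Assignments of values to the variables of a context. -/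
def Env {J : Type u} (M : Str.{u, w} J) (Γ : List (Srt J)) : Type (max u w) :=
  ∀ s : Srt J, Var Γ s → M.carrier s

/-- The assignment for the empty context. -/
def Env.nil {J : Type u} {M : Str.{u, w} J} : Env M [] := fun _ x => nomatch x

/-- Extension of an assignment by a value for one new variable. -/
def Env.cons {J : Type u} {M : Str.{u, w} J} {Γ : List (Srt J)} {t : Srt J} (a : M.carrier t)
    (e : Env M Γ) : Env M (t :: Γ)
  | _, Var.zero => a
  | _, Var.succ x => e _ x

/-- Satisfaction of a formula under an assignment. -/
def Sat {J : Type u} (M : Str.{u, w} J) : {Γ : List (Srt J)} → Fml J Γ → Env M Γ → Prop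
  | _, .falsum, _ => False
  | _, .eq x y, e => e _ x = e _ y
  | _, .le x y, e => M.le (e _ x) (e _ y)
  | _, .C x y, e => M.C (e _ x) (e _ y)
  | _, .P x y z, e => M.P (e _ x) (e _ y) (e _ z)
  | _, .imp φ ψ, e => Sat M φ e → Sat M ψ e
  | _, .all s φ, e => ∀ a : M.carrier s, Sat M φ (Env.cons a e)

/-- Sentences are formulas without free variables. -/
abbrev Sentence (J : Type u) : Type u := Fml J []

/-- `M` satisfies the sentence `φ`. -/
def Models {J : Type u} (M : Str.{u, w} J) (φ : Sentence J) : Prop := Sat M φ Env.nil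

/-- `M` is a model of the set of sentences `T`. -/
def IsModel {J : Type u} (M : Str.{u, w} J) (T : Set (Sentence J)) : Prop := ∀ φ ∈ T, Models M φ

/-- The complete theory of `M`. -/
def Th {J : Type u} (M : Str.{u, w} J) : Set (Sentence J) := {φ | Models M φ}

/-- The theory `T'` is axiomatized by `T`: the two have the same models. -/
def IsAxiomatizedBy {J : Type u} (T' T : Set (Sentence J)) : Prop :=
  ∀ M : Str.{u, w} J, IsModel M T' ↔ IsModel M T

/-- The sentence `φ` expresses the property `Q` of sorted complete systems. -/
def Expresses {J : Type u} (Jsub : ℕ+ → Tup J → Tup J) (φ : Sentence J)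
    (Q : Str.{u, w} J → Prop) : Prop :=
  ∀ M : Str.{u, w} J, IsSCS Jsub M → (Models M φ ↔ Q M)

/-- The theory of sorted complete systems having the co-sorted embedding property. -/
def SCSSEP {J : Type u} (Jsub : ℕ+ → Tup J → Tup J) : Set (Sentence J) :=
  {φ | ∀ M : Str.{u, w} J, IsSCS Jsub M → CoSEP Jsub M → Models M φ}

/-- There is a finite presystem `X` of `M` such that the subsystem generated by `X` is isomorphic
to `A`. -/
def Occurs {J : Type u} (Jsub : ℕ+ → Tup J → Tup J) (A M : Str.{u, w} J) : Prop :=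
  ∃ X : Set M.Elt, X.Finite ∧ IsPresystem Jsub M X ∧ Iso (M.restrict (generated Jsub M X)) A

/-- For every finite presystem `Y` of `M`, the subsystem generated by `Y` is not isomorphic
to `A`. -/
def Omitted {J : Type u} (Jsub : ℕ+ → Tup J → Tup J) (A M : Str.{u, w} J) : Prop :=
  ∀ Y : Set M.Elt, Y.Finite → IsPresystem Jsub M Y → ¬ Iso (M.restrict (generated Jsub M Y)) A

/-- The axioms saying of the members of `coFSIm(S)` that they occur. -/
def OccurrenceAxioms {J : Type u} (Jsub : ℕ+ → Tup J → Tup J) (S : Str.{u, w} J) :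
    Set (Sentence J) :=
  {φ | ∃ A : Str.{u, w} J, IsFGSystem Jsub A ∧ InCoFSIm Jsub S A ∧
    Expresses Jsub φ (Occurs Jsub A)}

/-- The axioms saying of the finitely generated systems outside `coFSIm(S)` that they do not
occur. -/
def OmissionAxioms {J : Type u} (Jsub : ℕ+ → Tup J → Tup J) (S : Str.{u, w} J) :
    Set (Sentence J) :=
  {φ | ∃ A : Str.{u, w} J, IsFGSystem Jsub A ∧ ¬ InCoFSIm Jsub S A ∧
    Expresses Jsub φ (Omitted Jsub A)}

end SortedSystem

-- The proof has three ingredients.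
--
-- The first is that sorted complete systems form an elementary class, axiomatized by `Ax`. Every
-- system of cosets satisfies `Ax` (`Rep.ax`). Conversely, in a model of `Ax` the elements of one
-- sort equivalent to `a` form a finite group `Cls a`, a relation `a ≤ b` induces a surjection `Cls
-- a → Cls b`, and any two elements have a meet. The inverse limit of these groups is a profinite
-- group whose open normal subgroups are exactly the kernels of its projections to the `Cls a`. The
-- sorting data are read off from the sorts in which a kernel is represented, and the given
-- structure is recovered as the coset system (`Ax.isSCS`).
--
-- The second is that a finitely generated subsystem is controlled by a finite configuration.
-- Subsystems are the sets satisfying the closure conditions `Closed`, and a finitely generated one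
-- is generated by a frame: a finite locally full set with a least element `a₀`. Whatever lies above
-- `a₀` is described by cosets in the finite group `Cls a₀`. An isomorphism of two such groups
-- therefore induces a correspondence `Corr` preserving all relations, and the elements that have a
-- partner form a closed set. So a partial isomorphism of frames extends to the whole generated
-- subsystem (`PartialIso.exists_emb`). For finitely generated `A`, occurring in `M` and belonging
-- to `coFSIm(M)` both mean that `A` embeds in `M`, and this only requires a locally full tuple of
-- `M` with a prescribed finite diagram. In the same way co-SEP is equivalent to a scheme of
-- sentences, `TupleExtension`. This gives the first two assertions.
--
-- The third is a back-and-forth argument. If `M` and `S` have co-SEP and the same finitely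
-- generated subsystems up to isomorphism, then the embeddings of finitely generated subsystems of
-- `M` into `S` can be extended by any further element on either side, so `M` and `S` are
-- elementarily equivalent (`models_iff`). The occurrence and omission axioms say precisely that `M`
-- and `S` have the same finitely generated subsystems.

universe w''

namespace SortedSystem

/-! ### Definability -/

/-- A family of parameter spaces, together with a reading of the parameters as assignments. -/
structure Ctx {J : Type u} (E : Str.{u, w} J → Type (max u w)) where
  sorts : List (Srt J)
  val : ∀ M : Str.{u, w} J, E M → Env M sorts

section

variable {J : Type u} {E : Str.{u, w} J → Type (max u w)}

/-- The term `t` is a variable of the context. -/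
def Reads (c : Ctx E) {s : Srt J} (t : ∀ M : Str.{u, w} J, E M → M.carrier s) : Prop :=
  ∃ x : Var c.sorts s, ∀ M p, c.val M p s x = t M p

/-- The property `Q` is first-order definable, uniformly in all structures. -/
def Definable (c : Ctx E) (Q : ∀ M : Str.{u, w} J, E M → Prop) : Prop :=
  ∃ φ : Fml J c.sorts, ∀ M p, Sat M φ (c.val M p) ↔ Q M p

/-- Extension of a context by one variable. -/
def Ctx.ext (c : Ctx E) (s : Srt J) : Ctx (fun M => E M × M.carrier s) where
  sorts := s :: c.sorts
  val M p := Env.cons p.2 (c.val M p.1)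

theorem Reads.last {c : Ctx E} {s : Srt J} : Reads (c.ext s) (fun _ p => p.2) :=
  ⟨.zero, fun _ _ => rfl⟩

theorem Reads.wk {c : Ctx E} {s r : Srt J} {t : ∀ M : Str.{u, w} J, E M → M.carrier s}
    (h : Reads c t) : Reads (c.ext r) (fun M p => t M p.1) := by
  obtain ⟨x, hx⟩ := h
  exact ⟨.succ x, fun M p => hx M p.1⟩

namespace Definable

variable {c : Ctx E} {Q R : ∀ M : Str.{u, w} J, E M → Prop}

/-- This and the following closure properties let a definability proof copy the shape of the
property itself, so that no formula is ever written down. -/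
theorem congr (h : Definable c Q) (hQ : ∀ M p, R M p ↔ Q M p) : Definable c R := by
  obtain ⟨φ, hφ⟩ := h
  exact ⟨φ, fun M p => (hφ M p).trans (hQ M p).symm⟩

theorem imp (hQ : Definable c Q) (hR : Definable c R) :
    Definable c (fun M p => Q M p → R M p) := by
  obtain ⟨φ, hφ⟩ := hQ
  obtain ⟨ψ, hψ⟩ := hR
  exact ⟨.imp φ ψ, fun M p => imp_congr (hφ M p) (hψ M p)⟩

/-- A condition independent of the structure is replaced by its truth value. It absorbs side
conditions such as `i ∈ I` and the diagram of a fixed finite tuple. -/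
theorem const (q : Prop) : Definable c (fun _ _ => q) := by
  by_cases hq : q
  · exact ⟨.imp .falsum .falsum, fun M p => by simp [Sat, hq]⟩
  · exact ⟨.falsum, fun M p => by simp [Sat, hq]⟩

theorem not (hQ : Definable c Q) : Definable c (fun M p => ¬ Q M p) :=
  hQ.imp (const False)

theorem and (hQ : Definable c Q) (hR : Definable c R) :
    Definable c (fun M p => Q M p ∧ R M p) :=
  (hQ.imp hR.not).not.congr fun _ _ => by tauto

theorem iff (hQ : Definable c Q) (hR : Definable c R) :
    Definable c (fun M p => Q M p ↔ R M p) :=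
  ((hQ.imp hR).and (hR.imp hQ)).congr fun _ _ => by tauto

theorem forall_finite {ι : Type*} [Finite ι] {Q : ι → ∀ M : Str.{u, w} J, E M → Prop}
    (h : ∀ i, Definable c (Q i)) : Definable c (fun M p => ∀ i, Q i M p) := by
  classical
  have := Fintype.ofFinite ι
  have key : ∀ S : Finset ι, Definable c (fun M p => ∀ i ∈ S, Q i M p) := by
    intro S
    induction S using Finset.induction_on with
    | empty => exact (const True).congr fun _ _ => by simp
    | insert a S _ ih => exact ((h a).and ih).congr fun _ _ => by simp
  exact (key Finset.univ).congr fun _ _ => by simp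

theorem exists_finite {ι : Type*} [Finite ι] {Q : ι → ∀ M : Str.{u, w} J, E M → Prop}
    (h : ∀ i, Definable c (Q i)) : Definable c (fun M p => ∃ i, Q i M p) :=
  (forall_finite fun i => (h i).not).not.congr fun _ _ => by simp

theorem all {s : Srt J} {Q : ∀ M : Str.{u, w} J, E M → M.carrier s → Prop}
    (h : Definable (c.ext s) (fun M p => Q M p.1 p.2)) :
    Definable c (fun M p => ∀ a, Q M p a) := by
  obtain ⟨φ, hφ⟩ := h
  exact ⟨.all s φ, fun M p => forall_congr' fun a => hφ M (p, a)⟩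

theorem ex {s : Srt J} {Q : ∀ M : Str.{u, w} J, E M → M.carrier s → Prop}
    (h : Definable (c.ext s) (fun M p => Q M p.1 p.2)) :
    Definable c (fun M p => ∃ a, Q M p a) :=
  (all (Q := fun M p a => ¬ Q M p a) h.not).not.congr fun _ _ => by simp

variable {s t r : Srt J} {a : ∀ M : Str.{u, w} J, E M → M.carrier s}
  {b : ∀ M : Str.{u, w} J, E M → M.carrier t}
  {a' a'' : ∀ M : Str.{u, w} J, E M → M.carrier s}

theorem le (ha : Reads c a) (hb : Reads c b) : Definable c (fun M p => M.le (a M p) (b M p)) := by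
  obtain ⟨x, hx⟩ := ha
  obtain ⟨y, hy⟩ := hb
  exact ⟨.le x y, fun M p => by simp only [Sat, hx, hy]⟩

theorem C (ha : Reads c a) (hb : Reads c b) : Definable c (fun M p => M.C (a M p) (b M p)) := by
  obtain ⟨x, hx⟩ := ha
  obtain ⟨y, hy⟩ := hb
  exact ⟨.C x y, fun M p => by simp only [Sat, hx, hy]⟩

theorem P (ha : Reads c a) (ha' : Reads c a') (ha'' : Reads c a'') :
    Definable c (fun M p => M.P (a M p) (a' M p) (a'' M p)) := by
  obtain ⟨x, hx⟩ := ha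
  obtain ⟨y, hy⟩ := ha'
  obtain ⟨z, hz⟩ := ha''
  exact ⟨.P x y z, fun M p => by simp only [Sat, hx, hy, hz]⟩

theorem eq (ha : Reads c a) (ha' : Reads c a') : Definable c (fun M p => a M p = a' M p) := by
  obtain ⟨x, hx⟩ := ha
  obtain ⟨y, hy⟩ := ha'
  exact ⟨.eq x y, fun M p => by simp only [Sat, hx, hy]⟩

/-- Sorts are known in advance, so an equation between elements of different sorts is simply false.
-/
theorem elt_eq (ha : Reads c a) (hb : Reads c b) :
    Definable c (fun M p => (⟨s, a M p⟩ : M.Elt) = ⟨t, b M p⟩) := by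
  by_cases h : s = t
  · subst h
    exact (eq ha hb).congr fun _ _ => by simp
  · exact (const False).congr fun _ _ => by simp [h]

end Definable

/-- Variables are added one at a time, which naturally yields nested pairs of parameters; the lemma
repackages them as one tuple. Only the three properties of the resulting context listed here are
used later. Since each new variable changes the parameter space, the induction generalizes over `E`.
-/
theorem Ctx.exists_block {n : ℕ} (c : Ctx E) (σ : Fin n → Srt J) :
    ∃ c' : Ctx (fun M => E M × ∀ i, M.carrier (σ i)),
      (∀ s (t : ∀ M : Str.{u, w} J, E M → M.carrier s), Reads c t →
        Reads c' (fun M p => t M p.1)) ∧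
      (∀ i, Reads c' (fun _ p => p.2 i)) ∧
      ∀ Q, Definable c' Q → Definable c (fun M p => ∀ y, Q M (p, y)) := by
  induction n generalizing E with
  | zero =>
    refine ⟨⟨c.sorts, fun M p => c.val M p.1⟩, fun s t ⟨x, hx⟩ => ⟨x, fun M p => hx M p.1⟩,
      fun i => i.elim0, fun Q ⟨φ, hφ⟩ => ⟨φ, fun M p => ?_⟩⟩
    exact ⟨fun h y => by
      rw [Subsingleton.elim y fun i => i.elim0]
      exact (hφ M (p, _)).1 h, fun h => (hφ M (p, fun i => i.elim0)).2 (h _)⟩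
  | succ n ih =>
    obtain ⟨c₁, h₁, h₂, h₃⟩ := ih (c.ext (σ 0)) (fun i => σ i.succ)
    refine ⟨⟨c₁.sorts, fun M p => c₁.val M ((p.1, p.2 0), fun i => p.2 i.succ)⟩,
      fun s t ht => ?_, fun i => ?_, fun Q ⟨φ, hφ⟩ => ?_⟩
    · obtain ⟨x, hx⟩ := h₁ _ _ (ht.wk (r := σ 0))
      exact ⟨x, fun M p => hx M _⟩
    · induction i using Fin.cases with
      | zero =>
        obtain ⟨x, hx⟩ := h₁ _ _ (Reads.last (c := c) (s := σ 0))
        exact ⟨x, fun M p => hx M _⟩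
      | succ i =>
        obtain ⟨x, hx⟩ := h₂ i
        exact ⟨x, fun M p => hx M _⟩
    · have h := h₃ (fun M p => Q M (p.1.1, Fin.cons p.1.2 p.2)) ⟨φ, fun M p => hφ M (p.1.1, Fin.cons p.1.2 p.2)⟩
      refine (Definable.all
        (Q := fun M p a => ∀ y : ∀ i : Fin n, M.carrier (σ i.succ), Q M (p, Fin.cons a y))
        h).congr fun M p => ?_
      exact ⟨fun H a y => H _, fun H y => by
        have := H (y 0) (fun i => y i.succ)
        rwa [show Fin.cons (y 0) (fun i => y i.succ) = y from Fin.cons_self_tail y] at this⟩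

/-- Extension of a context by finitely many variables. -/
noncomputable def Ctx.block {n : ℕ} (c : Ctx E) (σ : Fin n → Srt J) :
    Ctx (fun M => E M × ∀ i, M.carrier (σ i)) :=
  (c.exists_block σ).choose

theorem Reads.wkBlock {n : ℕ} {c : Ctx E} {σ : Fin n → Srt J} {s : Srt J}
    {t : ∀ M : Str.{u, w} J, E M → M.carrier s} (h : Reads c t) :
    Reads (c.block σ) (fun M p => t M p.1) :=
  (c.exists_block σ).choose_spec.1 s t h

theorem Reads.block {n : ℕ} {c : Ctx E} {σ : Fin n → Srt J} (i : Fin n) :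
    Reads (c.block σ) (fun _ p => p.2 i) :=
  (c.exists_block σ).choose_spec.2.1 i

theorem Definable.allBlock {n : ℕ} {c : Ctx E} {σ : Fin n → Srt J}
    {Q : ∀ M : Str.{u, w} J, E M → (∀ i, M.carrier (σ i)) → Prop}
    (h : Definable (c.block σ) (fun M p => Q M p.1 p.2)) :
    Definable c (fun M p => ∀ y, Q M p y) :=
  (c.exists_block σ).choose_spec.2.2 _ h

theorem Definable.exBlock {n : ℕ} {c : Ctx E} {σ : Fin n → Srt J}
    {Q : ∀ M : Str.{u, w} J, E M → (∀ i, M.carrier (σ i)) → Prop}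
    (h : Definable (c.block σ) (fun M p => Q M p.1 p.2)) :
    Definable c (fun M p => ∃ y, Q M p y) :=
  (allBlock (Q := fun M p a => ¬ Q M p a) h.not).not.congr fun _ _ => by simp

end

/-- The empty context. -/
def Ctx.nil {J : Type u} : Ctx (fun _ : Str.{u, w} J => PUnit.{max u w + 1}) where
  sorts := []
  val _ _ := Env.nil

/-- The property `Q` of structures is expressed by a sentence. -/
def FirstOrder {J : Type u} (Q : Str.{u, w} J → Prop) : Prop :=
  Definable (Ctx.nil : Ctx (fun _ : Str.{u, w} J => PUnit.{max u w + 1})) (fun M _ => Q M)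

theorem FirstOrder.exists_sentence {J : Type u} {Q : Str.{u, w} J → Prop} (h : FirstOrder Q) :
    ∃ φ : Sentence J, ∀ M : Str.{u, w} J, Models M φ ↔ Q M := by
  obtain ⟨φ, hφ⟩ := h
  exact ⟨φ, fun M => hφ M ⟨⟩⟩

/-! ### First-order axioms for sorted complete systems -/

/-- The equivalence relation `∼`. -/
def Str.Sim {J : Type u} (M : Str.{u, w} J) {s t : Srt J} (a : M.carrier s) (b : M.carrier t) :
    Prop :=
  M.le a b ∧ M.le b a

/-- First-order axioms for sorted complete systems. -/
structure Ax {J : Type u} (Jsub : ℕ+ → Tup J → Tup J) (M : Str.{u, w} J) : Prop where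
  le_refl : ∀ (s : Srt J) (a : M.carrier s), M.le a a
  le_trans : ∀ (s t r : Srt J) (a : M.carrier s) (b : M.carrier t) (c : M.carrier r),
    M.le a b → M.le b c → M.le a c
  C_refl : ∀ (s : Srt J) (a : M.carrier s), M.C a a
  C_trans : ∀ (s t r : Srt J) (a : M.carrier s) (b : M.carrier t) (c : M.carrier r),
    M.C a b → M.C b c → M.C a c
  C_le : ∀ (s t : Srt J) (a : M.carrier s) (b : M.carrier t), M.C a b → M.le a b
  exists_image : ∀ (s t : Srt J) (a : M.carrier s) (b : M.carrier t), M.le a b →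
    ∃ b' : M.carrier t, M.Sim b' b ∧ M.C a b'
  image_unique : ∀ (s t : Srt J) (a : M.carrier s) (b b' : M.carrier t), M.C a b → M.C a b' →
    M.Sim b b' → b = b'
  exists_preimage : ∀ (s t : Srt J) (a : M.carrier s) (b : M.carrier t), M.le a b →
    ∃ a' : M.carrier s, M.Sim a' a ∧ M.C a' b
  P_sim : ∀ (s : Srt J) (a b c : M.carrier s), M.P a b c → M.Sim a b ∧ M.Sim b c
  P_total : ∀ (s : Srt J) (a b : M.carrier s), M.Sim a b → ∃ c, M.P a b c
  P_unique : ∀ (s : Srt J) (a b c c' : M.carrier s), M.P a b c → M.P a b c' → c = c'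
  P_assoc : ∀ (s : Srt J) (a b c x y z : M.carrier s), M.P a b x → M.P x c y → M.P b c z →
    M.P a z y
  P_one : ∀ (s : Srt J) (a : M.carrier s), ∃ e : M.carrier s, M.Sim e a ∧
    ∀ b : M.carrier s, M.Sim b a → M.P e b b ∧ ∃ c, M.P c b e
  P_image : ∀ (s t : Srt J) (a b c : M.carrier s) (a' b' c' : M.carrier t), M.P a b c →
    M.C a a' → M.C b b' → M.C c c' → M.Sim a' b' → M.Sim b' c' → M.P a' b' c'
  card : ∀ (s : Srt J) (a : M.carrier s) (x : Fin (s.1 + 1) → M.carrier s),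
    (∀ i, M.Sim (x i) a) → ∃ i j, i ≠ j ∧ x i = x j
  -- The condition on `x` is the pigeonhole form of "the class of `a` has at most `m` elements",
  -- that is, of a bound on the index of the subgroup of `a`.
  resort : ∀ (s : Srt J) (m : ℕ+) (T : Tup J), s.2.support ⊆ T.support → ∀ a : M.carrier s,
    (∀ x : Fin (m + 1) → M.carrier s, (∀ i, M.Sim (x i) a) → ∃ i j, i ≠ j ∧ x i = x j) →
    ∃ b : M.carrier (m, T), M.Sim b a
  nonempty_one : ∀ T : Tup J, ∃ _ : M.carrier (1, T), True
  le_one : ∀ (T : Tup J) (t : Srt J) (x : M.carrier (1, T)) (y : M.carrier t), M.le y x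
  -- The last clause says that the subgroup of `c` is the intersection of those of `a` and `b`; its
  -- index is at most the product of their indices.
  meet : ∀ (s t : Srt J) (a : M.carrier s) (b : M.carrier t),
    ∃ c : M.carrier (s.1 * t.1, s.2.append t.2), M.le c a ∧ M.le c b ∧
      ∀ (x y : M.carrier (s.1 * t.1, s.2.append t.2)) (a' : M.carrier s) (b' : M.carrier t),
        M.Sim x c → M.Sim y c → M.Sim a' a → M.Sim b' b → M.C x a' → M.C y a' → M.C x b' →
          M.C y b' → x = y
  -- The tuple `x` enumerates, with repetitions, a normal subgroup of the class of `a`. Closure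
  -- under products suffices for a subgroup because the class is finite. The element `b` is the
  -- union of the cosets `x i`.
  quot : ∀ (s : Srt J) (a : M.carrier s) (x : Fin s.1 → M.carrier s), (∀ i, M.Sim (x i) a) →
    (∀ i j, ∃ l, M.P (x i) (x j) (x l)) →
    (∀ (g y : M.carrier s) (i : Fin s.1), M.P g (x i) y → ∃ j, M.P (x j) g y) →
    ∃ b : M.carrier (s.1, Jsub s.1 s.2), ∀ h : M.carrier s, M.Sim h a → (M.C h b ↔ ∃ i, h = x i)
  -- If `h ⊆ b`, then `b` is the union of the translates of `h` inside it, so inclusion in `b'` may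
  -- be tested on these translates.
  C_of_fiber : ∀ (s t r : Srt J) (h : M.carrier s) (b : M.carrier t) (b' : M.carrier r),
    M.C h b → (∀ h' : M.carrier s, M.Sim h' h → M.C h' b → M.C h' b') → M.C b b'

section

variable {J : Type u} {E : Str.{u, w} J → Type (max u w)} {c : Ctx E}

theorem Definable.sim {s t : Srt J} {a : ∀ M : Str.{u, w} J, E M → M.carrier s}
    {b : ∀ M : Str.{u, w} J, E M → M.carrier t} (ha : Reads c a) (hb : Reads c b) :
    Definable c (fun M p => M.Sim (a M p) (b M p)) :=
  (Definable.le ha hb).and (Definable.le hb ha)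

/-- In the terms below, `.last` is the innermost bound variable and `.vk` is the one bound `k`
quantifiers further out. -/
theorem Reads.v1 {s₁ s₂ : Srt J} : Reads ((c.ext s₂).ext s₁) (fun _ p => p.1.2) :=
  Reads.last.wk

theorem Reads.v2 {s₁ s₂ s₃ : Srt J} :
    Reads (((c.ext s₃).ext s₂).ext s₁) (fun _ p => p.1.1.2) :=
  Reads.v1.wk

theorem Reads.v3 {s₁ s₂ s₃ s₄ : Srt J} :
    Reads ((((c.ext s₄).ext s₃).ext s₂).ext s₁) (fun _ p => p.1.1.1.2) :=
  Reads.v2.wk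

theorem Reads.v4 {s₁ s₂ s₃ s₄ s₅ : Srt J} :
    Reads (((((c.ext s₅).ext s₄).ext s₃).ext s₂).ext s₁) (fun _ p => p.1.1.1.1.2) :=
  Reads.v3.wk

theorem Reads.v5 {s₁ s₂ s₃ s₄ s₅ s₆ : Srt J} :
    Reads ((((((c.ext s₆).ext s₅).ext s₄).ext s₃).ext s₂).ext s₁)
      (fun _ p => p.1.1.1.1.1.2) :=
  Reads.v4.wk

theorem Reads.v6 {s₁ s₂ s₃ s₄ s₅ s₆ s₇ : Srt J} :
    Reads (((((((c.ext s₇).ext s₆).ext s₅).ext s₄).ext s₃).ext s₂).ext s₁)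
      (fun _ p => p.1.1.1.1.1.1.2) :=
  Reads.v5.wk

end

/-- A structure with all the first-order properties of a class of structures satisfying the axioms
satisfies the axioms. -/
theorem Ax.of_firstOrder {J : Type u} {Jsub : ℕ+ → Tup J → Tup J} {K : Str.{u, w} J → Prop}
    (hK : ∀ M, K M → Ax Jsub M) {M : Str.{u, w} J}
    (hM : ∀ Q : Str.{u, w} J → Prop, FirstOrder Q → (∀ N, K N → Q N) → Q M) : Ax Jsub M where
  le_refl s := hM (fun M => ∀ a : M.carrier s, M.le a a) (.all <| .le .last .last)
    fun N h => (hK N h).le_refl s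
  le_trans s t r := hM (fun M => ∀ (a : M.carrier s) (b : M.carrier t) (c : M.carrier r),
    M.le a b → M.le b c → M.le a c)
    (.all <| .all <| .all <| .imp (.le .v2 .v1) <| .imp (.le .v1 .last) <| .le .v2 .last)
    fun N h => (hK N h).le_trans s t r
  C_refl s := hM (fun M => ∀ a : M.carrier s, M.C a a) (.all <| .C .last .last)
    fun N h => (hK N h).C_refl s
  C_trans s t r := hM (fun M => ∀ (a : M.carrier s) (b : M.carrier t) (c : M.carrier r),
    M.C a b → M.C b c → M.C a c)
    (.all <| .all <| .all <| .imp (.C .v2 .v1) <| .imp (.C .v1 .last) <| .C .v2 .last)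
    fun N h => (hK N h).C_trans s t r
  C_le s t := hM (fun M => ∀ (a : M.carrier s) (b : M.carrier t), M.C a b → M.le a b)
    (.all <| .all <| .imp (.C .v1 .last) <| .le .v1 .last)
    fun N h => (hK N h).C_le s t
  exists_image s t := hM (fun M => ∀ (a : M.carrier s) (b : M.carrier t), M.le a b →
    ∃ b' : M.carrier t, M.Sim b' b ∧ M.C a b')
    (.all <| .all <| .imp (.le .v1 .last) <| .ex <| .and (.sim .last .v1) (.C .v2 .last))
    fun N h => (hK N h).exists_image s t
  image_unique s t := hM (fun M => ∀ (a : M.carrier s) (b b' : M.carrier t), M.C a b →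
    M.C a b' → M.Sim b b' → b = b')
    (.all <| .all <| .all <| .imp (.C .v2 .v1) <| .imp (.C .v2 .last) <|
      .imp (.sim .v1 .last) <| .eq .v1 .last)
    fun N h => (hK N h).image_unique s t
  exists_preimage s t := hM (fun M => ∀ (a : M.carrier s) (b : M.carrier t), M.le a b →
    ∃ a' : M.carrier s, M.Sim a' a ∧ M.C a' b)
    (.all <| .all <| .imp (.le .v1 .last) <| .ex <| .and (.sim .last .v2) (.C .last .v1))
    fun N h => (hK N h).exists_preimage s t
  P_sim s := hM (fun M => ∀ (a b c : M.carrier s), M.P a b c → M.Sim a b ∧ M.Sim b c)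
    (.all <| .all <| .all <| .imp (.P .v2 .v1 .last) <| .and (.sim .v2 .v1) (.sim .v1 .last))
    fun N h => (hK N h).P_sim s
  P_total s := hM (fun M => ∀ (a b : M.carrier s), M.Sim a b → ∃ c, M.P a b c)
    (.all <| .all <| .imp (.sim .v1 .last) <| .ex <| .P .v2 .v1 .last)
    fun N h => (hK N h).P_total s
  P_unique s := hM (fun M => ∀ (a b c c' : M.carrier s), M.P a b c → M.P a b c' → c = c')
    (.all <| .all <| .all <| .all <| .imp (.P .v3 .v2 .v1) <| .imp (.P .v3 .v2 .last) <|
      .eq .v1 .last)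
    fun N h => (hK N h).P_unique s
  P_assoc s := hM (fun M => ∀ (a b c x y z : M.carrier s), M.P a b x → M.P x c y →
    M.P b c z → M.P a z y)
    (.all <| .all <| .all <| .all <| .all <| .all <| .imp (.P .v5 .v4 .v2) <|
      .imp (.P .v2 .v3 .v1) <| .imp (.P .v4 .v3 .last) <| .P .v5 .last .v1)
    fun N h => (hK N h).P_assoc s
  P_one s := hM (fun M => ∀ (a : M.carrier s), ∃ e : M.carrier s, M.Sim e a ∧
    ∀ b : M.carrier s, M.Sim b a → M.P e b b ∧ ∃ c, M.P c b e)
    (.all <| .ex <| .and (.sim .last .v1) <| .all <| .imp (.sim .last .v2) <|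
      .and (.P .v1 .last .last) <| .ex <| .P .last .v1 .v2)
    fun N h => (hK N h).P_one s
  P_image s t := hM (fun M => ∀ (a b c : M.carrier s) (a' b' c' : M.carrier t), M.P a b c →
    M.C a a' → M.C b b' → M.C c c' → M.Sim a' b' → M.Sim b' c' → M.P a' b' c')
    (.all <| .all <| .all <| .all <| .all <| .all <| .imp (.P .v5 .v4 .v3) <|
      .imp (.C .v5 .v2) <| .imp (.C .v4 .v1) <| .imp (.C .v3 .last) <| .imp (.sim .v2 .v1) <|
      .imp (.sim .v1 .last) <| .P .v2 .v1 .last)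
    fun N h => (hK N h).P_image s t
  card s := hM (fun M => ∀ (a : M.carrier s) (x : Fin (s.1 + 1) → M.carrier s),
    (∀ i, M.Sim (x i) a) → ∃ i j, i ≠ j ∧ x i = x j)
    (.all <| .allBlock <| .imp (.forall_finite fun i => .sim (.block i) (.wkBlock .last)) <|
      .exists_finite fun i => .exists_finite fun j => .and (.const _) <|
        .eq (.block i) (.block j))
    fun N h => (hK N h).card s
  resort s m T hT := hM (fun M => ∀ a : M.carrier s,
    (∀ x : Fin (m + 1) → M.carrier s, (∀ i, M.Sim (x i) a) → ∃ i j, i ≠ j ∧ x i = x j) →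
    ∃ b : M.carrier (m, T), M.Sim b a)
    (.all <| .imp (.allBlock <| .imp
      (.forall_finite fun i => .sim (.block i) (.wkBlock .last)) <|
      .exists_finite fun i => .exists_finite fun j => .and (.const _) <|
        .eq (.block i) (.block j)) <| .ex <| .sim .last .v1)
    fun N h => (hK N h).resort s m T hT
  nonempty_one T := hM (fun M => ∃ _ : M.carrier (1, T), True) (.ex <| .const True)
    fun N h => (hK N h).nonempty_one T
  le_one T t := hM (fun M => ∀ (x : M.carrier (1, T)) (y : M.carrier t), M.le y x)
    (.all <| .all <| .le .last .v1)
    fun N h => (hK N h).le_one T t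
  meet s t := hM (fun M => ∀ (a : M.carrier s) (b : M.carrier t),
    ∃ c : M.carrier (s.1 * t.1, s.2.append t.2), M.le c a ∧ M.le c b ∧
      ∀ (x y : M.carrier (s.1 * t.1, s.2.append t.2)) (a' : M.carrier s) (b' : M.carrier t),
        M.Sim x c → M.Sim y c → M.Sim a' a → M.Sim b' b → M.C x a' → M.C y a' → M.C x b' →
          M.C y b' → x = y)
    (.all <| .all <| .ex <| .and (.le .last .v2) <| .and (.le .last .v1) <|
      .all <| .all <| .all <| .all <| .imp (.sim .v3 .v4) <| .imp (.sim .v2 .v4) <|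
      .imp (.sim .v1 .v6) <| .imp (.sim .last .v5) <| .imp (.C .v3 .v1) <| .imp (.C .v2 .v1) <|
      .imp (.C .v3 .last) <| .imp (.C .v2 .last) <| .eq .v3 .v2)
    fun N h => (hK N h).meet s t
  quot s := hM (fun M => ∀ (a : M.carrier s) (x : Fin s.1 → M.carrier s),
    (∀ i, M.Sim (x i) a) → (∀ i j, ∃ l, M.P (x i) (x j) (x l)) →
    (∀ (g y : M.carrier s) (i : Fin s.1), M.P g (x i) y → ∃ j, M.P (x j) g y) →
    ∃ b : M.carrier (s.1, Jsub s.1 s.2), ∀ h : M.carrier s, M.Sim h a →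
      (M.C h b ↔ ∃ i, h = x i))
    (.all <| .allBlock <| .imp (.forall_finite fun i => .sim (.block i) (.wkBlock .last)) <|
      .imp (.forall_finite fun i => .forall_finite fun j => .exists_finite fun l =>
        .P (.block i) (.block j) (.block l)) <|
      .imp (.all <| .all <| .forall_finite fun i => .imp
        (.P .v1 (.wk <| .wk <| .block i) .last) <| .exists_finite fun j =>
        .P (.wk <| .wk <| .block j) .v1 .last) <|
      .ex <| .all <| .imp (.sim .last (.wk <| .wk <| .wkBlock .last)) <|
        .iff (.C .last .v1) <| .exists_finite fun i => .eq .last (.wk <| .wk <| .block i))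
    fun N h => (hK N h).quot s
  C_of_fiber s t r := hM (fun M => ∀ (h : M.carrier s) (b : M.carrier t) (b' : M.carrier r),
    M.C h b → (∀ h' : M.carrier s, M.Sim h' h → M.C h' b → M.C h' b') → M.C b b')
    (.all <| .all <| .all <| .imp (.C .v2 .v1) <| .imp
      (.all <| .imp (.sim .last .v3) <| .imp (.C .last .v2) <| .C .last .v1) <| .C .v1 .last)
    fun N h => (hK N h).C_of_fiber s t r

/-! ### Consequences of the axioms -/

/-- The bridge between cardinality bounds and the pigeonhole statements that occur in the axioms,
which are first-order for each fixed `m`. -/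
theorem encard_le_iff_pigeonhole {α : Type*} {S : Set α} {m : ℕ} :
    S.encard ≤ m ↔ ∀ x : Fin (m + 1) → α, (∀ i, x i ∈ S) → ∃ i j, i ≠ j ∧ x i = x j := by
  constructor
  · intro h x hx
    by_contra! hne
    have hinj : Function.Injective x := fun i j hij => by
      by_contra hne'
      exact hne i j hne' hij
    have h1 := Set.encard_le_encard (Set.range_subset_iff.2 hx)
    rw [← Set.image_univ, hinj.encard_image, Set.encard_univ, ENat.card_eq_coe_fintype_card,
      Fintype.card_fin] at h1
    have h2 := h1.trans h
    norm_cast at h2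
    omega
  · intro h
    by_contra! hlt
    obtain ⟨t, ht, htc⟩ := Set.exists_subset_encard_eq (s := S) (k := ((m + 1 : ℕ) : ℕ∞))
      (by push_cast; exact Order.add_one_le_of_lt hlt)
    have hfin : t.Finite := Set.finite_of_encard_eq_coe htc
    have := hfin.to_subtype
    have hcard : Nat.card t = m + 1 := by
      rw [Nat.card_coe_set_eq, Set.ncard, htc]; simp
    obtain ⟨e⟩ : Nonempty (Fin (m + 1) ≃ t) := ⟨(Finite.equivFinOfCardEq hcard).symm⟩
    obtain ⟨i, j, hij, he⟩ := h (fun i => (e i).1) fun i => ht (e i).2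
    exact hij (e.injective (Subtype.ext he))

variable {J : Type u} {Jsub : ℕ+ → Tup J → Tup J} {M : Str.{u, w} J}

theorem Str.Sim.symm {s t : Srt J} {a : M.carrier s} {b : M.carrier t} (h : M.Sim a b) :
    M.Sim b a :=
  ⟨h.2, h.1⟩

/-- The elements of the sort of `a` which are equivalent to `a`. -/
def Str.cls (M : Str.{u, w} J) {s : Srt J} (a : M.carrier s) : Set (M.carrier s) :=
  {b | M.Sim b a}

namespace Ax

variable (hM : Ax Jsub M) {s t r q : Srt J}
include hM

theorem sim_refl (a : M.carrier s) : M.Sim a a :=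
  ⟨hM.le_refl _ a, hM.le_refl _ a⟩

theorem sim_trans {a : M.carrier s} {b : M.carrier t} {c : M.carrier r} (h : M.Sim a b)
    (h' : M.Sim b c) : M.Sim a c :=
  ⟨hM.le_trans _ _ _ _ _ _ h.1 h'.1, hM.le_trans _ _ _ _ _ _ h'.2 h.2⟩

theorem trans {a : M.carrier s} {b : M.carrier t} {c : M.carrier r} (h : M.le a b)
    (h' : M.le b c) : M.le a c :=
  hM.le_trans _ _ _ _ _ _ h h'

theorem ctrans {a : M.carrier s} {b : M.carrier t} {c : M.carrier r} (h : M.C a b)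
    (h' : M.C b c) : M.C a c :=
  hM.C_trans _ _ _ _ _ _ h h'

theorem cle {a : M.carrier s} {b : M.carrier t} (h : M.C a b) : M.le a b :=
  hM.C_le _ _ _ _ h

theorem eq_image {a : M.carrier s} {b b' : M.carrier t} (h : M.C a b) (h' : M.C a b')
    (hb : M.Sim b b') : b = b' :=
  hM.image_unique _ _ _ _ _ h h' hb

/-- The image of `b` in the class of `c` is also an image of `a`, and images are unique. -/
theorem C_image_mono {a : M.carrier s} {b : M.carrier t} {c : M.carrier r} (hab : M.C a b)
    (hac : M.C a c) (hbc : M.le b c) : M.C b c := by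
  obtain ⟨c', hc', hbc'⟩ := hM.exists_image _ _ b c hbc
  rwa [hM.eq_image hac (hM.ctrans hab hbc') hc'.symm]

theorem eq_of_C {a b : M.carrier s} (h : M.C a b) (hab : M.Sim a b) : a = b :=
  hM.eq_image (hM.C_refl _ a) h hab

/-- The elements of the sort of `a` which are equivalent to `a`, as a group. -/
@[ext]
structure Cls (hM : Ax Jsub M) {s : Srt J} (a : M.carrier s) : Type w where
  val : M.carrier s
  sim : M.Sim val a

theorem cls_sim {a : M.carrier s} (x y : hM.Cls a) : M.Sim x.1 y.1 :=
  hM.sim_trans x.2 y.2.symm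

omit hM

noncomputable instance (hM : Ax Jsub M) (a : M.carrier s) : Mul (hM.Cls a) where
  mul x y := ⟨(hM.P_total _ _ _ (hM.cls_sim x y)).choose,
    hM.sim_trans ((hM.P_sim _ _ _ _
      (hM.P_total _ _ _ (hM.cls_sim x y)).choose_spec).2.symm) y.2⟩

noncomputable instance (hM : Ax Jsub M) (a : M.carrier s) : One (hM.Cls a) where
  one := ⟨(hM.P_one _ a).choose, (hM.P_one _ a).choose_spec.1⟩

include hM

theorem mul_spec {a : M.carrier s} (x y : hM.Cls a) : M.P x.1 y.1 (x * y).1 :=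
  (hM.P_total _ _ _ (hM.cls_sim x y)).choose_spec

theorem P_iff {a : M.carrier s} (x y z : hM.Cls a) : M.P x.1 y.1 z.1 ↔ x * y = z :=
  ⟨fun h => Cls.ext (hM.P_unique _ _ _ _ _ (hM.mul_spec x y) h),
    fun h => h ▸ hM.mul_spec x y⟩

theorem exists_inv {a : M.carrier s} (x : hM.Cls a) : ∃ y : hM.Cls a, y * x = 1 := by
  obtain ⟨y, hy⟩ := ((hM.P_one _ a).choose_spec.2 x.1 x.2).2
  refine ⟨⟨y, hM.sim_trans (hM.P_sim _ _ _ _ hy).1 x.2⟩, ?_⟩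
  rw [← hM.P_iff]
  exact hy

omit hM

noncomputable instance (hM : Ax Jsub M) (a : M.carrier s) : Inv (hM.Cls a) where
  inv x := (hM.exists_inv x).choose

noncomputable instance (hM : Ax Jsub M) (a : M.carrier s) : Group (hM.Cls a) :=
  Group.ofLeftAxioms
    (fun x y z => ((hM.P_iff _ _ _).1 (hM.P_assoc _ _ _ _ _ _ _ (hM.mul_spec x y)
      (hM.mul_spec _ z) (hM.mul_spec y z))).symm)
    (fun x => (hM.P_iff _ _ _).1 ((hM.P_one _ a).choose_spec.2 x.1 x.2).1)
    (fun x => (hM.exists_inv x).choose_spec)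

include hM

theorem encard_cls (a : M.carrier s) : (M.cls a).encard ≤ ((s.1 : ℕ) : ℕ∞) :=
  encard_le_iff_pigeonhole.2 (hM.card _ a)

theorem finite_cls (a : M.carrier s) : (M.cls a).Finite :=
  Set.finite_of_encard_le_coe (hM.encard_cls a)

omit hM

instance (hM : Ax Jsub M) (a : M.carrier s) : Finite (hM.Cls a) :=
  have := (hM.finite_cls a).to_subtype
  Finite.of_injective (β := M.cls a) (fun x => ⟨x.1, x.2⟩) fun _ _ h =>
    Cls.ext (Subtype.mk.inj h)

include hM

theorem card_Cls (a : M.carrier s) : Nat.card (hM.Cls a) = (M.cls a).ncard := by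
  rw [← Nat.card_coe_set_eq]
  exact Nat.card_congr ⟨fun x => ⟨x.1, x.2⟩, fun x => ⟨x.1, x.2⟩, fun _ => rfl, fun _ => rfl⟩

theorem encard_cls_eq (a : M.carrier s) : (M.cls a).encard = (M.cls a).ncard :=
  (hM.finite_cls a).cast_ncard_eq.symm

theorem ncard_cls_le (a : M.carrier s) : (M.cls a).ncard ≤ s.1 := by
  have := hM.encard_cls a
  rw [hM.encard_cls_eq] at this
  exact_mod_cast this

theorem ncard_cls_pos (a : M.carrier s) : 0 < (M.cls a).ncard :=
  (Set.ncard_pos (hM.finite_cls a)).2 ⟨a, hM.sim_refl a⟩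

theorem exists_sort {T : Tup J} (m : ℕ+) (a : M.carrier s) (hT : s.2.support ⊆ T.support)
    (hm : (M.cls a).ncard ≤ m) : ∃ b : M.carrier (m, T), M.Sim b a := by
  refine hM.resort s m T hT a ?_
  refine encard_le_iff_pigeonhole (S := M.cls a).1 ?_
  rw [hM.encard_cls_eq]
  exact_mod_cast hm

theorem exists_img {a : M.carrier s} {b : M.carrier t} (hab : M.le a b) (x : hM.Cls a) :
    ∃ y : hM.Cls b, M.C x.1 y.1 := by
  obtain ⟨y, hy, hxy⟩ := hM.exists_image _ _ x.1 b (hM.trans x.2.1 hab)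
  exact ⟨⟨y, hy⟩, hxy⟩

/-- The homomorphism between the groups of two comparable elements. -/
noncomputable def img {a : M.carrier s} {b : M.carrier t} (hab : M.le a b) :
    hM.Cls a →* hM.Cls b :=
  MonoidHom.mk' (fun x => (hM.exists_img hab x).choose) fun x y => by
    symm
    rw [← hM.P_iff]
    exact hM.P_image _ _ _ _ _ _ _ _ (hM.mul_spec x y) (hM.exists_img hab x).choose_spec
      (hM.exists_img hab y).choose_spec (hM.exists_img hab _).choose_spec (hM.cls_sim _ _)
      (hM.cls_sim _ _)

theorem C_img {a : M.carrier s} {b : M.carrier t} (hab : M.le a b) (x : hM.Cls a) :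
    M.C x.1 (hM.img hab x).1 :=
  (hM.exists_img hab x).choose_spec

theorem C_iff {a : M.carrier s} {b : M.carrier t} (hab : M.le a b) (x : hM.Cls a)
    (y : hM.Cls b) : M.C x.1 y.1 ↔ hM.img hab x = y :=
  ⟨fun h => Cls.ext (hM.eq_image (hM.C_img hab x) h (hM.cls_sim _ _)),
    fun h => h ▸ hM.C_img hab x⟩

theorem img_surjective {a : M.carrier s} {b : M.carrier t} (hab : M.le a b) :
    Function.Surjective (hM.img hab) := by
  intro y
  obtain ⟨x, hx, hxy⟩ := hM.exists_preimage _ _ a y.1 (hM.trans hab y.2.2)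
  exact ⟨⟨x, hx⟩, (hM.C_iff hab _ _).1 hxy⟩

theorem ncard_cls_mono {a : M.carrier s} {b : M.carrier t} (hab : M.le a b) :
    (M.cls b).ncard ≤ (M.cls a).ncard := by
  rw [← hM.card_Cls, ← hM.card_Cls]
  exact Nat.card_le_card_of_surjective _ (hM.img_surjective hab)

theorem ncard_cls_sim {a : M.carrier s} {b : M.carrier t} (hab : M.Sim a b) :
    (M.cls a).ncard = (M.cls b).ncard :=
  le_antisymm (hM.ncard_cls_mono hab.2) (hM.ncard_cls_mono hab.1)

/-- The axiom `quot` speaks of tuples of length exactly `s.1`. Since the class of `a` has at most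
`s.1` elements, `K` can be listed by such a tuple, with repetitions. -/
theorem exists_quot (a : M.carrier s) (K : Subgroup (hM.Cls a)) [hK : K.Normal] :
    ∃ b : M.carrier (s.1, Jsub s.1 s.2), ∀ x : hM.Cls a, M.C x.1 b ↔ x ∈ K := by
  have hle : Nat.card K ≤ s.1 :=
    (Subgroup.card_le_card_group K).trans ((hM.card_Cls a).trans_le (hM.ncard_cls_le a))
  obtain ⟨f⟩ : Nonempty (K ↪ Fin s.1) := by
    have := Fintype.ofFinite K
    rw [Nat.card_eq_fintype_card] at hle
    exact Function.Embedding.nonempty_of_card_le (by simpa using hle)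
  have hsurj : Function.Surjective (Function.invFun f) := Function.invFun_surjective f.injective
  set g := Function.invFun f
  obtain ⟨b, hb⟩ := hM.quot s a (fun i => (g i).1.1) (fun i => (g i).1.2)
    (fun i j => by
      obtain ⟨l, hl⟩ := hsurj (g i * g j)
      exact ⟨l, by rw [hM.P_iff, hl]; rfl⟩)
    (fun c y i h => by
      have hc : M.Sim c a := hM.sim_trans (hM.P_sim _ _ _ _ h).1 (g i).1.2
      have hy : M.Sim y a := hM.sim_trans (hM.P_sim _ _ _ _ h).2.symm (g i).1.2
      have h' := (hM.P_iff ⟨c, hc⟩ (g i).1 ⟨y, hy⟩).1 h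
      obtain ⟨l, hl⟩ := hsurj ⟨⟨c, hc⟩ * (g i).1 * ⟨c, hc⟩⁻¹, hK.conj_mem _ (g i).2 _⟩
      refine ⟨l, (hM.P_iff (g l).1 ⟨c, hc⟩ ⟨y, hy⟩).2 ?_⟩
      rw [hl, ← h', inv_mul_cancel_right])
  refine ⟨b, fun x => (hb x.1 x.2).trans ⟨?_, fun hx => ?_⟩⟩
  · rintro ⟨i, hi⟩
    rw [Cls.ext hi]
    exact (g i).2
  · obtain ⟨i, hi⟩ := hsurj ⟨x, hx⟩
    exact ⟨i, by rw [hi]⟩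

theorem C_of_img {a : M.carrier s} {b : M.carrier t} {b' : M.carrier r} (x : hM.Cls a)
    (hx : M.C x.1 b) (h : ∀ y : hM.Cls a, M.C y.1 b → M.C y.1 b') : M.C b b' :=
  hM.C_of_fiber _ _ _ x.1 b b' hx fun y hy => h ⟨y, hM.sim_trans hy x.2⟩

theorem exists_fiber {a : M.carrier s} {b : M.carrier t} (hab : M.le a b) :
    ∃ x : hM.Cls a, M.C x.1 b := by
  obtain ⟨x, hx, hxb⟩ := hM.exists_preimage _ _ a b hab
  exact ⟨⟨x, hx⟩, hxb⟩

/-- Below `b`, the cosets in the class of `a` that are contained in `b` exhaust it. -/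
theorem C_of_le_iff {a : M.carrier s} {b : M.carrier t} {b' : M.carrier r} (hab : M.le a b) :
    M.C b b' ↔ ∀ y : hM.Cls a, M.C y.1 b → M.C y.1 b' := by
  refine ⟨fun h y hy => hM.ctrans hy h, fun h => ?_⟩
  obtain ⟨x, hx⟩ := hM.exists_fiber hab
  exact hM.C_of_img x hx h

/-- The order ignores which coset is taken, so it suffices to compare the identity cosets; these are
the unions of the two kernels. -/
theorem le_of_ker {a : M.carrier s} {b : M.carrier t} {b' : M.carrier r} (hab : M.le a b)
    (hab' : M.le a b') (h : (hM.img hab).ker ≤ (hM.img hab').ker) : M.le b b' := by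
  have hb := (1 : hM.Cls b).2
  have hb' := (1 : hM.Cls b').2
  refine hM.trans hb.2 (hM.trans (hM.cle (a := (1 : hM.Cls b).1) (b := (1 : hM.Cls b').1) ?_)
    hb'.1)
  refine (hM.C_of_le_iff (hM.trans hab hb.2)).2 fun y hy => ?_
  rw [hM.C_iff hab] at hy
  rw [hM.C_iff hab']
  exact h hy

theorem ker_of_le {a : M.carrier s} {b : M.carrier t} {b' : M.carrier r} (hab : M.le a b)
    (hab' : M.le a b') (hbb' : M.le b b') : (hM.img hab).ker ≤ (hM.img hab').ker := by
  intro x hx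
  have h1 : M.C x.1 (1 : hM.Cls b).1 := (hM.C_iff hab _ _).2 hx
  have h2 : M.C (1 : hM.Cls b).1 (1 : hM.Cls b').1 :=
    (hM.C_iff hbb' _ _).2 (map_one _)
  exact (hM.C_iff hab' _ _).1 (hM.ctrans h1 h2)

end Ax

/-! ### Meets -/

/-- The element `c` is a greatest lower bound of `a` and `b`. -/
def Str.IsMeet (M : Str.{u, w} J) {s t r : Srt J} (a : M.carrier s) (b : M.carrier t)
    (c : M.carrier r) : Prop :=
  M.le c a ∧ M.le c b ∧ ∀ (q : Srt J) (d : M.carrier q), M.le d a → M.le d b → M.le d c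

/-- The element `x` of the class of `c` is determined by its images in the classes of
`a` and `b`. -/
def Str.JointlyInjective (M : Str.{u, w} J) {s t r : Srt J} (a : M.carrier s) (b : M.carrier t)
    (c : M.carrier r) : Prop :=
  ∀ (x y : M.carrier r) (a' : M.carrier s) (b' : M.carrier t), M.Sim x c → M.Sim y c →
    M.Sim a' a → M.Sim b' b → M.C x a' → M.C y a' → M.C x b' → M.C y b' → x = y

namespace Ax

variable (hM : Ax Jsub M) {s t r q : Srt J}
include hM

theorem ker_of_jointlyInjective {a : M.carrier s} {b : M.carrier t} {c : M.carrier r}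
    (hca : M.le c a) (hcb : M.le c b) (h : M.JointlyInjective a b c) :
    (hM.img hca).ker ⊓ (hM.img hcb).ker = ⊥ := by
  refine eq_bot_iff.2 fun x ⟨hxa, hxb⟩ => ?_
  refine Cls.ext (h x.1 (1 : hM.Cls c).1 (1 : hM.Cls a).1 (1 : hM.Cls b).1 x.2
    (1 : hM.Cls c).2 (1 : hM.Cls a).2 (1 : hM.Cls b).2 ?_ ?_ ?_ ?_)
  · exact (hM.C_iff hca _ _).2 hxa
  · exact (hM.C_iff hca _ _).2 (map_one _)
  · exact (hM.C_iff hcb _ _).2 hxb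
  · exact (hM.C_iff hcb _ _).2 (map_one _)

theorem img_img {a : M.carrier s} {b : M.carrier t} {c : M.carrier r} (hab : M.le a b)
    (hbc : M.le b c) (x : hM.Cls a) :
    hM.img hbc (hM.img hab x) = hM.img (hM.trans hab hbc) x :=
  ((hM.C_iff (hM.trans hab hbc) _ _).1 (hM.ctrans (hM.C_img hab x) (hM.C_img hbc _))).symm

/-- Given a lower bound `d`, compare `c` and `d` inside a common lower bound `e`. What dies in `d`
dies in `a` and `b`, hence its image in the class of `c` lies in the trivial intersection of the two
kernels. -/
theorem isMeet_of_jointlyInjective {a : M.carrier s} {b : M.carrier t} {c : M.carrier r}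
    (hca : M.le c a) (hcb : M.le c b) (h : M.JointlyInjective a b c) : M.IsMeet a b c := by
  refine ⟨hca, hcb, fun q d hda hdb => ?_⟩
  obtain ⟨e, hec, hed, -⟩ := hM.meet _ _ c d
  refine hM.le_of_ker hed hec fun x hx => ?_
  have h1 := hM.ker_of_le hed (hM.trans hed hda) hda hx
  have h2 := hM.ker_of_le hed (hM.trans hed hdb) hdb hx
  have h3 : hM.img hec x ∈ (hM.img hca).ker ⊓ (hM.img hcb).ker := by
    constructor
    · exact (hM.img_img hec hca x).trans h1
    · exact (hM.img_img hec hcb x).trans h2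
  rw [hM.ker_of_jointlyInjective hca hcb h] at h3
  exact h3

theorem exists_meet (a : M.carrier s) (b : M.carrier t) :
    ∃ c : M.carrier (s.1 * t.1, s.2.append t.2), M.JointlyInjective a b c ∧ M.IsMeet a b c := by
  obtain ⟨c, hca, hcb, h⟩ := hM.meet _ _ a b
  exact ⟨c, h, hM.isMeet_of_jointlyInjective hca hcb h⟩

/-- Every element above `a` is equivalent to one of the sort prescribed by `Jsub`. -/
theorem exists_above {a : M.carrier s} {b : M.carrier t} (hab : M.le a b) :
    ∃ b' : M.carrier (s.1, Jsub s.1 s.2), M.Sim b' b := by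
  obtain ⟨b', hb'⟩ := hM.exists_quot a (hM.img hab).ker
  refine ⟨b', ?_⟩
  have hb1 := (1 : hM.Cls b).2
  have h1 : ∀ y : hM.Cls a, M.C y.1 b' ↔ M.C y.1 (1 : hM.Cls b).1 := fun y => by
    rw [hb', hM.C_iff hab]
    rfl
  have hab' : M.le a b' := hM.trans (1 : hM.Cls a).2.2
    (hM.cle ((hb' 1).2 (one_mem _)))
  have h2 : M.C b' (1 : hM.Cls b).1 := (hM.C_of_le_iff hab').2 fun y => (h1 y).1
  have h3 : M.C (1 : hM.Cls b).1 b' :=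
    (hM.C_of_le_iff (hM.trans hab hb1.2)).2 fun y => (h1 y).2
  exact hM.sim_trans ⟨hM.cle h2, hM.cle h3⟩ hb1

end Ax

/-! ### Embeddings -/

section

variable {J : Type u} {M : Str.{u, w} J} {N : Str.{u, w'} J} {K : Str.{u, w''} J}

/-- Composition of embeddings. -/
def Emb.comp (g : Emb N K) (f : Emb M N) : Emb M K where
  toFun s a := g.toFun s (f.toFun s a)
  inj s := (g.inj s).comp (f.inj s)
  map_le a b := (g.map_le _ _).trans (f.map_le a b)
  map_C a b := (g.map_C _ _).trans (f.map_C a b)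
  map_P a b c := (g.map_P _ _ _).trans (f.map_P a b c)

/-- The inverse of a surjective embedding. -/
noncomputable def Emb.symm (f : Emb M N) (hf : ∀ s, Function.Surjective (f.toFun s)) :
    Emb N M where
  toFun s := Function.surjInv (hf s)
  inj s := Function.injective_surjInv (hf s)
  map_le a b := by rw [← f.map_le, Function.surjInv_eq (hf _), Function.surjInv_eq (hf _)]
  map_C a b := by rw [← f.map_C, Function.surjInv_eq (hf _), Function.surjInv_eq (hf _)]
  map_P a b c := by rw [← f.map_P, Function.surjInv_eq (hf _), Function.surjInv_eq (hf _), Function.surjInv_eq (hf _)]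

theorem Emb.symm_apply (f : Emb M N) (hf : ∀ s, Function.Surjective (f.toFun s)) {s : Srt J}
    (a : M.carrier s) : (f.symm hf).toFun s (f.toFun s a) = a :=
  Function.leftInverse_surjInv ⟨f.inj s, hf s⟩ a

theorem Emb.symm_surjective (f : Emb M N) (hf : ∀ s, Function.Surjective (f.toFun s)) (s : Srt J) :
    Function.Surjective ((f.symm hf).toFun s) :=
  fun a => ⟨_, f.symm_apply hf a⟩

theorem Iso.symm (h : Iso M N) : Iso N M := by
  obtain ⟨f, hf⟩ := h
  exact ⟨f.symm hf, f.symm_surjective hf⟩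

theorem Iso.trans (h : Iso M N) (h' : Iso N K) : Iso M K := by
  obtain ⟨f, hf⟩ := h
  obtain ⟨g, hg⟩ := h'
  exact ⟨g.comp f, fun s => (hg s).comp (hf s)⟩

theorem Emb.map_sim (f : Emb M N) {s t : Srt J} (a : M.carrier s) (b : M.carrier t) :
    N.Sim (f.toFun s a) (f.toFun t b) ↔ M.Sim a b :=
  and_congr (f.map_le a b) (f.map_le b a)

theorem IsSCS.of_iso {Jsub : ℕ+ → Tup J → Tup J} {M N : Str.{u, w} J} (hM : IsSCS Jsub M)
    (h : Iso M N) : IsSCS Jsub N := by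
  obtain ⟨G, D, hG⟩ := hM
  exact ⟨G, D, hG.trans h⟩

end

/-! ### Representations of structures by sorted profinite groups -/

/-- A description of the structure `M` by open normal subgroups and cosets of a sorted profinite
group. -/
structure Rep {J : Type u} {Jsub : ℕ+ → Tup J → Tup J} (M : Str.{u, w} J)
    (G : ProfiniteGrp.{w'}) (D : SortingData Jsub G) where
  ker : ∀ {s : Srt J}, M.carrier s → OpenNormalSubgroup G
  mem : ∀ {s : Srt J}, M.carrier s → G → Prop
  index_le : ∀ {s : Srt J} (a : M.carrier s), (ker a).toSubgroup.index ≤ s.1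
  sort_mem : ∀ {s : Srt J} (a : M.carrier s), s.2 ∈ D.F (ker a)
  exists_mem : ∀ {s : Srt J} (a : M.carrier s), ∃ g, mem a g
  mem_iff : ∀ {s : Srt J} {a : M.carrier s} {g : G}, mem a g → ∀ h, mem a h ↔ g⁻¹ * h ∈ ker a
  le_iff : ∀ {s t : Srt J} (a : M.carrier s) (b : M.carrier t), M.le a b ↔ ker a ≤ ker b
  C_iff : ∀ {s t : Srt J} (a : M.carrier s) (b : M.carrier t),
    M.C a b ↔ ∀ g, mem a g → mem b g
  P_iff : ∀ {s : Srt J} (a b c : M.carrier s), M.P a b c ↔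
    ker a = ker b ∧ ker b = ker c ∧ ∃ g h, mem a g ∧ mem b h ∧ mem c (g * h)
  eq_of_mem : ∀ {s : Srt J} {a b : M.carrier s}, ker a = ker b → ∀ {g}, mem a g → mem b g → a = b
  exists_elt : ∀ (s : Srt J) (N : OpenNormalSubgroup G), N.toSubgroup.index ≤ s.1 →
    s.2 ∈ D.F N → ∀ g, ∃ a : M.carrier s, ker a = N ∧ mem a g

section

variable {J : Type u} {Jsub : ℕ+ → Tup J → Tup J}

/-- The description of the system of a sorted profinite group. -/
def systemRep (G : ProfiniteGrp.{w}) (D : SortingData Jsub G) : Rep (systemOf G D) G D where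
  ker a := a.1.1
  mem a g := (QuotientGroup.mk g : G ⧸ a.1.1.toSubgroup) = a.2
  index_le a := a.1.2.1
  sort_mem a := a.1.2.2
  exists_mem a := QuotientGroup.mk_surjective a.2
  mem_iff {s a g} hg h := by
    rw [← hg, eq_comm]
    exact QuotientGroup.eq
  le_iff a b := Iff.rfl
  C_iff a b := Iff.rfl
  P_iff {s} a b c := by
    constructor
    · rintro ⟨N, x, y, rfl, rfl, rfl⟩
      obtain ⟨g, rfl⟩ := QuotientGroup.mk_surjective x
      obtain ⟨h, rfl⟩ := QuotientGroup.mk_surjective y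
      exact ⟨rfl, rfl, g, h, rfl, rfl, rfl⟩
    · obtain ⟨⟨N, hN⟩, x⟩ := a
      obtain ⟨⟨N', hN'⟩, y⟩ := b
      obtain ⟨⟨N'', hN''⟩, z⟩ := c
      rintro ⟨h, h', g, g', hg, hg', hg''⟩
      dsimp only at h h'
      subst h h'
      dsimp only at hg hg' hg''
      subst hg hg' hg''
      exact ⟨⟨N, hN⟩, _, _, rfl, rfl, rfl⟩
  eq_of_mem {s a b} h g hg hg' := by
    obtain ⟨⟨N, hN⟩, x⟩ := a
    obtain ⟨⟨N', hN'⟩, y⟩ := b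
    dsimp only at h
    subst h
    dsimp only at hg hg'
    rw [← hg, ← hg']
  exists_elt s N hN hs g := ⟨⟨⟨N, hN, hs⟩, QuotientGroup.mk g⟩, rfl, rfl⟩

/-- Transport of a description along an isomorphism. -/
def Rep.comap {M : Str.{u, w} J} {N : Str.{u, w'} J} {G : ProfiniteGrp.{w''}}
    {D : SortingData Jsub G} (R : Rep N G D) (f : Emb M N)
    (hf : ∀ s, Function.Surjective (f.toFun s)) : Rep M G D where
  ker a := R.ker (f.toFun _ a)
  mem a g := R.mem (f.toFun _ a) g
  index_le a := R.index_le _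
  sort_mem a := R.sort_mem _
  exists_mem a := R.exists_mem _
  mem_iff hg h := R.mem_iff hg h
  le_iff a b := (f.map_le a b).symm.trans (R.le_iff _ _)
  C_iff a b := (f.map_C a b).symm.trans (R.C_iff _ _)
  P_iff a b c := (f.map_P a b c).symm.trans (R.P_iff _ _ _)
  eq_of_mem h _ hg hg' := f.inj _ (R.eq_of_mem h hg hg')
  exists_elt s N hN hs g := by
    obtain ⟨b, hb⟩ := R.exists_elt s N hN hs g
    obtain ⟨a, rfl⟩ := hf s b
    exact ⟨a, hb⟩

/-- Elements of a given sort correspond bijectively to the admissible pairs of an open normal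
subgroup and a coset, and these pairs depend only on the group and its sorting data. -/
theorem Rep.iso {M : Str.{u, w} J} {N : Str.{u, w'} J} {G : ProfiniteGrp.{w''}}
    {D : SortingData Jsub G} (R : Rep M G D) (R' : Rep N G D) : Iso M N := by
  have H : ∀ (s : Srt J) (a : M.carrier s), ∃ b : N.carrier s, R'.ker b = R.ker a ∧
      ∀ g, R'.mem b g ↔ R.mem a g := by
    intro s a
    obtain ⟨g, hg⟩ := R.exists_mem a
    obtain ⟨b, hb, hg'⟩ := R'.exists_elt s (R.ker a) (R.index_le a) (R.sort_mem a) g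
    exact ⟨b, hb, fun h => by rw [R.mem_iff hg, R'.mem_iff hg', hb]⟩
  choose f hf hf' using H
  refine ⟨⟨f, fun s a b hab => ?_, fun a b => ?_, fun a b => ?_, fun a b c => ?_⟩, fun s b => ?_⟩
  · obtain ⟨g, hg⟩ := R.exists_mem a
    refine R.eq_of_mem ?_ hg ?_
    · rw [← hf, hab, hf]
    · rwa [← hf', ← hab, hf']
  · rw [R.le_iff, R'.le_iff, hf, hf]
  · simp only [R.C_iff, R'.C_iff, hf']
  · simp only [R.P_iff, R'.P_iff, hf, hf']
  · obtain ⟨g, hg⟩ := R'.exists_mem b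
    obtain ⟨a, ha, hg'⟩ := R.exists_elt s (R'.ker b) (R'.index_le b) (R'.sort_mem b) g
    exact ⟨a, R'.eq_of_mem ((hf s a).trans ha) ((hf' s a g).2 hg') hg⟩

theorem IsSCS.exists_rep {M : Str.{u, w} J} (hM : IsSCS Jsub M) :
    ∃ (G : ProfiniteGrp.{w}) (D : SortingData Jsub G), Nonempty (Rep M G D) := by
  obtain ⟨G, D, h⟩ := hM
  obtain ⟨f, hf⟩ := h.symm
  exact ⟨G, D, ⟨(systemRep G D).comap f hf⟩⟩

theorem Rep.isSCS {M : Str.{u, w} J} {G : ProfiniteGrp.{w}} {D : SortingData Jsub G}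
    (R : Rep M G D) : IsSCS Jsub M :=
  ⟨G, D, (systemRep G D).iso R⟩

namespace Rep

variable {M : Str.{u, w} J} {G : ProfiniteGrp.{w'}} {D : SortingData Jsub G} (R : Rep M G D)
  {s t r : Srt J}

include R

theorem sim_iff (a : M.carrier s) (b : M.carrier t) : M.Sim a b ↔ R.ker a = R.ker b := by
  rw [Str.Sim, R.le_iff, R.le_iff]
  exact ⟨fun h => le_antisymm h.1 h.2, fun h => ⟨h.le, h.ge⟩⟩

theorem mem_mul {a : M.carrier s} {g n : G} (hg : R.mem a g) (hn : n ∈ R.ker a) :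
    R.mem a (g * n) := by
  rwa [R.mem_iff hg, inv_mul_cancel_left]

theorem exists_coset (a : M.carrier s) (g : G) :
    ∃ b : M.carrier s, R.ker b = R.ker a ∧ R.mem b g :=
  R.exists_elt s _ (R.index_le a) (R.sort_mem a) g

theorem C_of_mem {a : M.carrier s} {b : M.carrier t} (h : R.ker a ≤ R.ker b) {g : G}
    (hg : R.mem a g) (hg' : R.mem b g) : M.C a b := by
  rw [R.C_iff]
  intro k hk
  rw [R.mem_iff hg] at hk
  rw [R.mem_iff hg']
  exact h hk

theorem mem_of_P {a b c : M.carrier s} (h : M.P a b c) {g k : G} (hg : R.mem a g)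
    (hk : R.mem b k) : R.mem c (g * k) := by
  obtain ⟨hab, hbc, g', k', hg', hk', hgk⟩ := (R.P_iff _ _ _).1 h
  rw [R.mem_iff hgk]
  rw [R.mem_iff hg', hab, hbc] at hg
  rw [R.mem_iff hk', hbc] at hk
  have : (g' * k')⁻¹ * (g * k) = (k'⁻¹ * (g'⁻¹ * g) * k'⁻¹⁻¹) * (k'⁻¹ * k) := by group
  rw [this]
  exact mul_mem ((R.ker c).isNormal'.conj_mem _ hg _) hk

theorem finite_quotient (a : M.carrier s) : Finite (G ⧸ (R.ker a).toSubgroup) :=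
  Subgroup.quotient_finite_of_isOpen _ (R.ker a).toOpenSubgroup.isOpen

theorem index_ne_zero (a : M.carrier s) : (R.ker a).toSubgroup.index ≠ 0 := by
  have := R.finite_quotient a
  exact Nat.card_pos.ne'

/-- The union of a family of cosets which is closed under products and conjugation. -/
def cosetUnion (R : Rep M G D) (a : M.carrier s) (X : Set (M.carrier s)) (hne : X.Nonempty)
    (hX : ∀ x ∈ X, M.Sim x a)
    (hmul : ∀ x ∈ X, ∀ y ∈ X, ∃ z ∈ X, M.P x y z)
    (hconj : ∀ g y x, x ∈ X → M.P g x y → ∃ z ∈ X, M.P z g y) : OpenNormalSubgroup G :=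
  have hker : ∀ x ∈ X, R.ker x = R.ker a := fun x hx => (R.sim_iff _ _).1 (hX x hx)
  have hm : ∀ g h, (∃ x ∈ X, R.mem x g) → (∃ x ∈ X, R.mem x h) → ∃ x ∈ X, R.mem x (g * h) := by
    rintro g h ⟨x, hx, hg⟩ ⟨y, hy, hh⟩
    obtain ⟨z, hz, hP⟩ := hmul x hx y hy
    exact ⟨z, hz, R.mem_of_P hP hg hh⟩
  -- A power of `g` with exponent the index of the kernel lies in the kernel, so its coset, which is
  -- in the family, contains `1`.
  have hone : ∃ x ∈ X, R.mem x 1 := by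
    obtain ⟨x, hx⟩ := hne
    obtain ⟨g, hg⟩ := R.exists_mem x
    have hp : ∀ n : ℕ, ∃ y ∈ X, R.mem y (g ^ (n + 1)) := by
      intro n
      induction n with
      | zero => exact ⟨x, hx, by simpa using hg⟩
      | succ n ih => rw [pow_succ]; exact hm _ _ ih ⟨x, hx, hg⟩
    obtain ⟨y, hy, hgy⟩ := hp ((R.ker a).toSubgroup.index - 1)
    rw [Nat.sub_add_cancel (Nat.one_le_iff_ne_zero.2 (R.index_ne_zero a))] at hgy
    refine ⟨y, hy, ?_⟩
    rw [R.mem_iff hgy, mul_one, hker y hy]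
    exact inv_mem (Subgroup.pow_index_mem (R.ker a).toSubgroup g)
  have hN : ∀ n ∈ R.ker a, ∃ x ∈ X, R.mem x n := by
    intro n hn
    obtain ⟨x, hx, h1⟩ := hone
    exact ⟨x, hx, by simpa using R.mem_mul h1 (n := n) (by rwa [hker x hx])⟩
  have hinv : ∀ g, (∃ x ∈ X, R.mem x g) → ∃ x ∈ X, R.mem x g⁻¹ := by
    intro g hg
    have hp : ∀ n : ℕ, ∃ y ∈ X, R.mem y (g ^ n) := by
      intro n
      induction n with
      | zero => simpa using hone
      | succ n ih => rw [pow_succ]; exact hm _ _ ih hg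
    obtain ⟨n, hn⟩ : ∃ n, (R.ker a).toSubgroup.index = n + 1 :=
      Nat.exists_eq_succ_of_ne_zero (R.index_ne_zero a)
    have h1 : (g ^ (n + 1))⁻¹ ∈ R.ker a :=
      inv_mem (hn ▸ Subgroup.pow_index_mem (R.ker a).toSubgroup g)
    -- `g⁻¹ = gⁿ · (gⁿ⁺¹)⁻¹`, where `n + 1` is the index, so the second factor lies in the kernel.
    have h2 := hm _ _ (hp n) (hN _ h1)
    rwa [pow_succ', mul_inv_rev, mul_inv_cancel_left] at h2
  { carrier := {g | ∃ x ∈ X, R.mem x g}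
    mul_mem' := fun {g h} => hm g h
    one_mem' := hone
    inv_mem' := fun {g} => hinv g
    isOpen' := by
      have : IsOpen (((⟨⟨⟨{g | ∃ x ∈ X, R.mem x g}, fun {g h} => hm g h⟩, hone⟩,
          fun {g} => hinv g⟩ : Subgroup G) : Subgroup G) : Set G) :=
        Subgroup.isOpen_mono (H₁ := (R.ker a).toSubgroup) (fun n hn => hN n hn)
          (R.ker a).toOpenSubgroup.isOpen
      exact this
    isNormal' := ⟨by
      rintro g ⟨x, hx, hg⟩ c
      obtain ⟨c', hc', hcm⟩ := R.exists_coset x c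
      obtain ⟨y, hy, hym⟩ := R.exists_coset x (c * g)
      obtain ⟨z, hz, hP⟩ := hconj c' y x hx
        ((R.P_iff _ _ _).2 ⟨hc', hy.symm, c, g, hcm, hg, hym⟩)
      obtain ⟨k, hk⟩ := R.exists_mem z
      have h1 := R.mem_of_P hP hk hcm
      rw [R.mem_iff hym, hy] at h1
      refine ⟨z, hz, ?_⟩
      rw [R.mem_iff hk, hker z hz]
      have h2 := (R.ker a).isNormal'.conj_mem _ ((hker x hx) ▸ (inv_mem h1)) c
      have : k⁻¹ * (c * g * c⁻¹) = c * ((c * g)⁻¹ * (k * c))⁻¹ * c⁻¹ := by group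
      rw [this]
      exact h2⟩ }

/-- Soundness of the axioms. The sorting data enter in four places: `root` for `resort`, `whole` for
`nonempty_one`, `inter` for `meet` and `up` for `quot`. -/
theorem ax : Ax Jsub M where
  le_refl s a := (R.le_iff a a).2 le_rfl
  le_trans s t r a b c h h' := (R.le_iff _ _).2 (((R.le_iff _ _).1 h).trans ((R.le_iff _ _).1 h'))
  C_refl s a := (R.C_iff a a).2 fun _ h => h
  C_trans s t r a b c h h' :=
    (R.C_iff _ _).2 fun g hg => (R.C_iff _ _).1 h' g ((R.C_iff _ _).1 h g hg)
  C_le s t a b h := by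
    rw [R.le_iff]
    intro n hn
    obtain ⟨g, hg⟩ := R.exists_mem a
    have h1 := (R.C_iff _ _).1 h g hg
    have h2 := (R.C_iff _ _).1 h _ (R.mem_mul hg hn)
    rwa [R.mem_iff h1, inv_mul_cancel_left] at h2
  exists_image s t a b h := by
    obtain ⟨g, hg⟩ := R.exists_mem a
    obtain ⟨b', hb', hg'⟩ := R.exists_coset b g
    refine ⟨b', (R.sim_iff _ _).2 hb', R.C_of_mem ?_ hg hg'⟩
    rw [hb', ← R.le_iff]
    exact h
  image_unique s t a b b' h h' hb := by
    obtain ⟨g, hg⟩ := R.exists_mem a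
    exact R.eq_of_mem ((R.sim_iff _ _).1 hb) ((R.C_iff _ _).1 h g hg) ((R.C_iff _ _).1 h' g hg)
  exists_preimage s t a b h := by
    obtain ⟨g, hg⟩ := R.exists_mem b
    obtain ⟨a', ha', hg'⟩ := R.exists_coset a g
    refine ⟨a', (R.sim_iff _ _).2 ha', R.C_of_mem ?_ hg' hg⟩
    rw [ha', ← R.le_iff]
    exact h
  P_sim s a b c h := by
    obtain ⟨h1, h2, -⟩ := (R.P_iff _ _ _).1 h
    exact ⟨(R.sim_iff _ _).2 h1, (R.sim_iff _ _).2 h2⟩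
  P_total s a b h := by
    obtain ⟨g, hg⟩ := R.exists_mem a
    obtain ⟨k, hk⟩ := R.exists_mem b
    obtain ⟨c, hc, hgk⟩ := R.exists_coset b (g * k)
    exact ⟨c, (R.P_iff _ _ _).2 ⟨(R.sim_iff _ _).1 h, hc.symm, g, k, hg, hk, hgk⟩⟩
  P_unique s a b c c' h h' := by
    obtain ⟨g, hg⟩ := R.exists_mem a
    obtain ⟨k, hk⟩ := R.exists_mem b
    have h1 := ((R.P_iff _ _ _).1 h).2.1
    have h2 := ((R.P_iff _ _ _).1 h').2.1
    exact R.eq_of_mem (h1.symm.trans h2) (R.mem_of_P h hg hk) (R.mem_of_P h' hg hk)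
  P_assoc s a b c x y z h1 h2 h3 := by
    obtain ⟨g, hg⟩ := R.exists_mem a
    obtain ⟨k, hk⟩ := R.exists_mem b
    obtain ⟨l, hl⟩ := R.exists_mem c
    obtain ⟨e1, e2, -⟩ := (R.P_iff _ _ _).1 h1
    obtain ⟨e3, e4, -⟩ := (R.P_iff _ _ _).1 h2
    obtain ⟨e5, e6, -⟩ := (R.P_iff _ _ _).1 h3
    refine (R.P_iff _ _ _).2 ⟨e1.trans (e5.trans e6), e6.symm.trans e4, g, k * l, hg,
      R.mem_of_P h3 hk hl, ?_⟩
    rw [← mul_assoc]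
    exact R.mem_of_P h2 (R.mem_of_P h1 hg hk) hl
  P_one s a := by
    obtain ⟨e, he, h1⟩ := R.exists_coset a 1
    refine ⟨e, (R.sim_iff _ _).2 he, fun b hb => ?_⟩
    rw [R.sim_iff] at hb
    obtain ⟨g, hg⟩ := R.exists_mem b
    obtain ⟨c, hc, hgc⟩ := R.exists_coset a g⁻¹
    exact ⟨(R.P_iff _ _ _).2 ⟨he.trans hb.symm, rfl, 1, g, h1, hg, by simpa using hg⟩,
      c, (R.P_iff _ _ _).2 ⟨hc.trans hb.symm, hb.trans he.symm, g⁻¹, g, hgc, hg,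
        by simpa using h1⟩⟩
  P_image s t a b c a' b' c' h ha hb hc h1 h2 := by
    obtain ⟨g, hg⟩ := R.exists_mem a
    obtain ⟨k, hk⟩ := R.exists_mem b
    exact (R.P_iff _ _ _).2 ⟨(R.sim_iff _ _).1 h1, (R.sim_iff _ _).1 h2, g, k,
      (R.C_iff _ _).1 ha _ hg, (R.C_iff _ _).1 hb _ hk, (R.C_iff _ _).1 hc _ (R.mem_of_P h hg hk)⟩
  card s a x hx := by
    choose g hg using fun i => R.exists_mem (x i)
    have := R.finite_quotient a
    have := Fintype.ofFinite (G ⧸ (R.ker a).toSubgroup)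
    obtain ⟨i, j, hij, h⟩ := Fintype.exists_ne_map_eq_of_card_lt
      (fun i => (QuotientGroup.mk (g i) : G ⧸ (R.ker a).toSubgroup)) (by
        rw [Fintype.card_fin, ← Nat.card_eq_fintype_card]
        exact Nat.lt_succ_of_le (R.index_le a))
    have hk : ∀ i, R.ker (x i) = R.ker a := fun i => (R.sim_iff _ _).1 (hx i)
    refine ⟨i, j, hij, R.eq_of_mem ((hk i).trans (hk j).symm) (g := g j) ?_ (hg j)⟩
    rw [R.mem_iff (hg i), hk i]
    exact QuotientGroup.eq.1 h
  resort s m T hT a h := by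
    have hidx : (R.ker a).toSubgroup.index ≤ m := by
      by_contra! hlt
      have := R.finite_quotient a
      have := Fintype.ofFinite (G ⧸ (R.ker a).toSubgroup)
      obtain ⟨f⟩ : Nonempty (Fin (m + 1) ↪ G ⧸ (R.ker a).toSubgroup) :=
        Function.Embedding.nonempty_of_card_le (by
          rw [Fintype.card_fin, ← Nat.card_eq_fintype_card]; exact hlt)
      choose g hg using fun i => QuotientGroup.mk_surjective (f i)
      choose x hx hx' using fun i => R.exists_coset a (g i)
      obtain ⟨i, j, hij, he⟩ := h x fun i => (R.sim_iff _ _).2 (hx i)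
      apply hij
      apply f.injective
      rw [← hg, ← hg, QuotientGroup.eq]
      have := hx' j
      rw [← he, R.mem_iff (hx' i), hx i] at this
      exact this
    obtain ⟨b, hb, -⟩ := R.exists_elt (m, T) (R.ker a) hidx
      ((D.root _ _).1 (R.sort_mem a) hT) 1
    exact ⟨b, (R.sim_iff _ _).2 hb⟩
  nonempty_one T := by
    obtain ⟨b, -⟩ := R.exists_elt (1, T) ⟨⊤, inferInstanceAs (⊤ : Subgroup G).Normal⟩
      (by
        change (⊤ : Subgroup G).index ≤ _
        rw [Subgroup.index_top]; exact le_rfl)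
      (by rw [D.whole _ rfl]; exact Set.mem_univ _) 1
    exact ⟨b, trivial⟩
  le_one T t x y := by
    rw [R.le_iff]
    have h1 : (R.ker x).toSubgroup.index = 1 :=
      le_antisymm (R.index_le x) (Nat.one_le_iff_ne_zero.2 (R.index_ne_zero x))
    rw [Subgroup.index_eq_one] at h1
    intro g _
    exact h1.ge (Subgroup.mem_top g)
  meet s t a b := by
    obtain ⟨c, hc, -⟩ := R.exists_elt (s.1 * t.1, s.2.append t.2) (R.ker a ⊓ R.ker b)
      (Subgroup.index_inf_le.trans (Nat.mul_le_mul (R.index_le a) (R.index_le b)))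
      (D.inter _ _ _ _ (R.sort_mem a) (R.sort_mem b)) 1
    refine ⟨c, (R.le_iff _ _).2 (hc.trans_le inf_le_left),
      (R.le_iff _ _).2 (hc.trans_le inf_le_right), ?_⟩
    intro x y a' b' hx hy ha hb hxa hya hxb hyb
    rw [R.sim_iff] at hx hy ha hb
    obtain ⟨g, hg⟩ := R.exists_mem x
    obtain ⟨k, hk⟩ := R.exists_mem y
    refine R.eq_of_mem (hx.trans hy.symm) hg ?_
    rw [R.mem_iff hk, hy, hc]
    constructor
    · have := (R.mem_iff ((R.C_iff _ _).1 hya _ hk) _).1 ((R.C_iff _ _).1 hxa _ hg)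
      rwa [ha] at this
    · have := (R.mem_iff ((R.C_iff _ _).1 hyb _ hk) _).1 ((R.C_iff _ _).1 hxb _ hg)
      rwa [hb] at this
  quot s a x hx hmul hconj := by
    set N := R.cosetUnion a (Set.range x) ⟨x ⟨0, s.1.pos⟩, Set.mem_range_self _⟩
      (by rintro _ ⟨i, rfl⟩; exact hx i)
      (by
        rintro _ ⟨i, rfl⟩ _ ⟨j, rfl⟩
        obtain ⟨l, hl⟩ := hmul i j
        exact ⟨_, ⟨l, rfl⟩, hl⟩)
      (by
        rintro g y _ ⟨i, rfl⟩ h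
        obtain ⟨j, hj⟩ := hconj g y i h
        exact ⟨_, ⟨j, rfl⟩, hj⟩) with hNdef
    have hmem : ∀ g, g ∈ N ↔ ∃ i, R.mem (x i) g := fun g =>
      ⟨fun ⟨_, ⟨i, hi⟩, h⟩ => ⟨i, hi ▸ h⟩, fun ⟨i, h⟩ => ⟨_, ⟨i, rfl⟩, h⟩⟩
    have hk : ∀ i, R.ker (x i) = R.ker a := fun i => (R.sim_iff _ _).1 (hx i)
    have hle : R.ker a ≤ N := fun n hn => by
      obtain ⟨i, hi⟩ := (hmem 1).1 (one_mem N)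
      exact (hmem n).2 ⟨i, by simpa using R.mem_mul hi (n := n) (by rwa [hk i])⟩
    obtain ⟨b, hb, hb1⟩ := R.exists_elt (s.1, Jsub s.1 s.2) N
      ((Nat.le_of_dvd (Nat.pos_of_ne_zero (R.index_ne_zero a))
        (Subgroup.index_dvd_of_le hle)).trans (R.index_le a))
      (D.up _ _ _ _ hle (R.index_le a) (R.sort_mem a)) 1
    have hbm : ∀ g, R.mem b g ↔ g ∈ N := fun g => by
      rw [R.mem_iff hb1, inv_one, one_mul, hb]
    refine ⟨b, fun h hh => ⟨fun hC => ?_, ?_⟩⟩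
    · obtain ⟨g, hg⟩ := R.exists_mem h
      obtain ⟨i, hi⟩ := (hmem g).1 ((hbm g).1 ((R.C_iff _ _).1 hC g hg))
      exact ⟨i, R.eq_of_mem (((R.sim_iff _ _).1 hh).trans (hk i).symm) hg hi⟩
    · rintro ⟨i, rfl⟩
      rw [R.C_iff]
      exact fun g hg => (hbm g).2 ((hmem g).2 ⟨i, hg⟩)
  C_of_fiber s t r h b b' hb H := by
    rw [R.C_iff]
    intro k hk
    obtain ⟨h', hh', hk'⟩ := R.exists_coset h k
    refine (R.C_iff _ _).1 (H h' ((R.sim_iff _ _).2 hh') (R.C_of_mem ?_ hk' hk)) k hk'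
    rw [hh']
    intro n hn
    obtain ⟨g, hg⟩ := R.exists_mem h
    have h1 := (R.C_iff _ _).1 hb _ hg
    have h2 := (R.C_iff _ _).1 hb _ (R.mem_mul hg hn)
    rwa [R.mem_iff h1, inv_mul_cancel_left] at h2

end Rep

theorem IsSCS.ax {M : Str.{u, w} J} (hM : IsSCS Jsub M) : Ax Jsub M := by
  obtain ⟨G, D, ⟨R⟩⟩ := hM.exists_rep
  exact R.ax

/-- A tuple is needed to produce an element of a model of the axioms, for instance as a lower bound
of the empty set. -/
theorem IsSCS.nonempty_tup {M : Str.{u, w} J} (hM : IsSCS Jsub M) : Nonempty (Tup J) := by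
  obtain ⟨G, D, -⟩ := hM
  exact (D.nonempty ⟨⊤, inferInstanceAs (⊤ : Subgroup G).Normal⟩).to_type

end

/-! ### The profinite group of a structure satisfying the axioms -/

variable {J : Type u} {Jsub : ℕ+ → Tup J → Tup J} {M : Str.{u, w} J}

namespace Ax

instance (hM : Ax Jsub M) {s : Srt J} (a : M.carrier s) : TopologicalSpace (hM.Cls a) := ⊥

instance (hM : Ax Jsub M) {s : Srt J} (a : M.carrier s) : DiscreteTopology (hM.Cls a) := ⟨rfl⟩

/-- The group of compatible families of elements of the classes. -/
def threads (hM : Ax Jsub M) : Subgroup (∀ p : M.Elt, hM.Cls p.2) where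
  carrier := {x | ∀ (p q : M.Elt) (h : M.le p.2 q.2), hM.img h (x p) = x q}
  mul_mem' {x y} hx hy p q h := by
    rw [Pi.mul_apply, Pi.mul_apply, map_mul, hx p q h, hy p q h]
  one_mem' p q h := map_one _
  inv_mem' {x} hx p q h := by
    rw [Pi.inv_apply, Pi.inv_apply, map_inv, hx p q h]

variable (hM : Ax Jsub M) {s t r : Srt J}

theorem isClosed_threads : IsClosed (hM.threads : Set (∀ p : M.Elt, hM.Cls p.2)) := by
  have : (hM.threads : Set (∀ p : M.Elt, hM.Cls p.2)) =
      ⋂ (p : M.Elt) (q : M.Elt) (h : M.le p.2 q.2), {x | hM.img h (x p) = x q} := by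
    ext x
    simp only [Set.mem_iInter]
    rfl
  rw [this]
  refine isClosed_iInter fun p => isClosed_iInter fun q => isClosed_iInter fun h => ?_
  exact isClosed_eq (continuous_of_discreteTopology.comp (continuous_apply p)) (continuous_apply q)

instance : CompactSpace hM.threads :=
  isCompact_iff_compactSpace.1 hM.isClosed_threads.isCompact

/-- The profinite group of a structure satisfying the axioms. -/
noncomputable def group : ProfiniteGrp.{max u w} := ProfiniteGrp.of hM.threads

/-- The projection of the profinite group to the class of an element. -/
noncomputable def proj (a : M.carrier s) : hM.group →* hM.Cls a :=
  (Pi.evalMonoidHom (fun p : M.Elt => hM.Cls p.2) ⟨s, a⟩).comp hM.threads.subtype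

theorem continuous_proj (a : M.carrier s) : Continuous (hM.proj a) :=
  (continuous_apply (⟨s, a⟩ : M.Elt)).comp continuous_subtype_val

theorem img_proj {a : M.carrier s} {b : M.carrier t} (h : M.le a b) (g : hM.group) :
    hM.img h (hM.proj a g) = hM.proj b g :=
  g.2 ⟨s, a⟩ ⟨t, b⟩ h

include hM in
theorem exists_lower (S : Finset M.Elt) [Nonempty (Tup J)] :
    ∃ p : M.Elt, ∀ q ∈ S, M.le p.2 q.2 := by
  classical
  induction S using Finset.induction_on with
  | empty =>
    obtain ⟨x, -⟩ := hM.nonempty_one (Classical.arbitrary (Tup J))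
    exact ⟨⟨_, x⟩, by simp⟩
  | insert a S _ ih =>
    obtain ⟨p, hp⟩ := ih
    obtain ⟨c, -, hc⟩ := hM.exists_meet p.2 a.2
    refine ⟨⟨_, c⟩, fun q hq => ?_⟩
    rcases Finset.mem_insert.1 hq with rfl | hq
    · exact hc.2.1
    · exact hM.trans hc.1 (hp q hq)

/-- Compactness. For `q ≤ a`, the families with value `y` at `a` that are compatible from `q`
upwards form a non-empty closed set, because transition maps are surjective. These sets are directed
because meets exist, and a common point is a thread through `y`. -/
theorem proj_surjective (a : M.carrier s) : Function.Surjective (hM.proj a) := by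
  classical
  intro y
  let Z : {q : M.Elt // M.le q.2 a} → Set (∀ p : M.Elt, hM.Cls p.2) := fun q =>
    {x | x ⟨s, a⟩ = y ∧ ∀ (r : M.Elt) (h : M.le q.1.2 r.2), hM.img h (x q) = x r}
  have hclosed : ∀ q, IsClosed (Z q) := fun q => by
    have : Z q = {x | x ⟨s, a⟩ = y} ∩
        ⋂ (r : M.Elt) (h : M.le q.1.2 r.2), {x | hM.img h (x q) = x r} := by
      ext x
      simp only [Set.mem_inter_iff, Set.mem_iInter]
      rfl
    rw [this]
    refine (isClosed_eq (continuous_apply _) continuous_const).inter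
      (isClosed_iInter fun r => isClosed_iInter fun h => ?_)
    exact isClosed_eq (continuous_of_discreteTopology.comp (continuous_apply _))
      (continuous_apply r)
  have hne : ∀ q, (Z q).Nonempty := fun q => by
    obtain ⟨z, hz⟩ := hM.img_surjective q.2 y
    -- Nothing is required at coordinates not above `q`, so the value there is the default `1`.
    let x : ∀ p : M.Elt, hM.Cls p.2 := fun r =>
      if h : M.le q.1.2 r.2 then hM.img h z else 1
    have hx : ∀ r (h : M.le q.1.2 r.2), x r = hM.img h z := fun r h => dif_pos h
    refine ⟨x, (hx ⟨s, a⟩ q.2).trans hz, fun r h => ?_⟩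
    rw [hx r h, hx q.1 (hM.le_refl _ _), hM.img_img]
  have hdir : Directed (· ⊇ ·) Z := fun q q' => by
    obtain ⟨c, -, hc⟩ := hM.exists_meet q.1.2 q'.1.2
    refine ⟨⟨⟨_, c⟩, hM.trans hc.1 q.2⟩, fun x hx => ⟨hx.1, fun r h => ?_⟩,
      fun x hx => ⟨hx.1, fun r h => ?_⟩⟩
    · rw [← hx.2 q.1 hc.1, hM.img_img]
      exact hx.2 r _
    · rw [← hx.2 q'.1 hc.2.1, hM.img_img]
      exact hx.2 r _
  have : Nonempty {q : M.Elt // M.le q.2 a} := ⟨⟨⟨s, a⟩, hM.le_refl _ a⟩⟩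
  obtain ⟨x, hx⟩ := IsCompact.nonempty_iInter_of_directed_nonempty_isCompact_isClosed Z hdir hne
    (fun q => (hclosed q).isCompact) hclosed
  rw [Set.mem_iInter] at hx
  refine ⟨⟨x, fun p q h => ?_⟩, (hx ⟨⟨s, a⟩, hM.le_refl _ a⟩).1⟩
  -- Compatibility is only known from elements below `a`, so it is checked through the meet of `a`
  -- and `p`.
  obtain ⟨c, -, hc⟩ := hM.exists_meet a p.2
  have h1 := (hx ⟨⟨_, c⟩, hc.1⟩).2
  rw [← h1 p hc.2.1, hM.img_img]
  exact h1 q _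

/-- The kernel of the projection to the class of an element. -/
noncomputable def kernel (a : M.carrier s) : OpenNormalSubgroup hM.group where
  toSubgroup := (hM.proj a).ker
  isOpen' := (isOpen_discrete ({1} : Set (hM.Cls a))).preimage (hM.continuous_proj a)
  isNormal' := inferInstanceAs (hM.proj a).ker.Normal

theorem mem_kernel (a : M.carrier s) (g : hM.group) : g ∈ hM.kernel a ↔ hM.proj a g = 1 :=
  Iff.rfl

theorem index_kernel (a : M.carrier s) :
    (hM.kernel a).toSubgroup.index = (M.cls a).ncard := by
  change (hM.proj a).ker.index = _
  rw [Subgroup.index_ker, MonoidHom.range_eq_top.2 (hM.proj_surjective a), Subgroup.card_top,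
    hM.card_Cls]

theorem kernel_le_iff (a : M.carrier s) (b : M.carrier t) :
    hM.kernel a ≤ hM.kernel b ↔ M.le a b := by
  constructor
  · intro h
    obtain ⟨c, -, hca, hcb, -⟩ := hM.exists_meet a b
    refine hM.le_of_ker hca hcb fun x hx => ?_
    obtain ⟨g, rfl⟩ := hM.proj_surjective c x
    rw [MonoidHom.mem_ker, hM.img_proj] at hx ⊢
    exact h hx
  · intro h g hg
    rw [mem_kernel] at hg ⊢
    rw [← hM.img_proj h, hg, map_one]

theorem kernel_eq_iff (a : M.carrier s) (b : M.carrier t) :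
    hM.kernel a = hM.kernel b ↔ M.Sim a b := by
  rw [le_antisymm_iff, kernel_le_iff, kernel_le_iff]
  rfl

/-- An open `N` contains a neighbourhood of `1` given by finitely many coordinates, hence the kernel
at a common lower bound `d` of them. Then `N` is the preimage of a normal subgroup of the class of
`d`, which the axiom `quot` represents by an element. -/
theorem exists_kernel_eq [Nonempty (Tup J)] (N : OpenNormalSubgroup hM.group) :
    ∃ (s : Srt J) (a : M.carrier s), hM.kernel a = N := by
  obtain ⟨U, hU, hUN⟩ := isOpen_induced_iff.1 N.toOpenSubgroup.isOpen
  have h1U : (1 : ∀ p : M.Elt, hM.Cls p.2) ∈ U := by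
    have : (1 : hM.group) ∈ (N : Set hM.group) := one_mem N
    change (1 : hM.group) ∈ (N.toOpenSubgroup : Set hM.group) at this
    rw [← hUN] at this
    exact this
  obtain ⟨I, V, hV, hVU⟩ := isOpen_pi_iff.1 hU 1 h1U
  obtain ⟨⟨r, d⟩, hd⟩ := hM.exists_lower I
  have hdN : hM.kernel d ≤ N := by
    intro g hg
    have : g ∈ (N.toOpenSubgroup : Set hM.group) := by
      rw [← hUN]
      refine hVU fun p hp => ?_
      have h1 : hM.proj p.2 g = 1 := (hM.kernel_le_iff d p.2).2 (hd p hp) hg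
      have h2 : g.1 p = 1 := h1
      rw [h2]
      exact (hV p hp).2
    exact this
  have hK : (N.toSubgroup.map (hM.proj d)).Normal :=
    N.isNormal'.map _ (hM.proj_surjective d)
  obtain ⟨b, hb⟩ := hM.exists_quot d (N.toSubgroup.map (hM.proj d))
  have hdb : M.le d b := hM.trans (1 : hM.Cls d).2.2 (hM.cle ((hb 1).2 (one_mem _)))
  let b₀ : hM.Cls b := ⟨b, hM.sim_refl b⟩
  have hb₀ : b₀ = 1 := by
    rw [← map_one (hM.img hdb)]
    exact ((hM.C_iff hdb 1 b₀).1 ((hb 1).2 (one_mem _))).symm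
  refine ⟨_, b, SetLike.ext fun g => ?_⟩
  rw [mem_kernel, ← hM.img_proj hdb, ← hb₀, ← hM.C_iff, hb]
  constructor
  · rintro ⟨n, hn, hng⟩
    have h1 : n⁻¹ * g ∈ hM.kernel d := by
      rw [mem_kernel, map_mul, map_inv, hng, inv_mul_cancel]
    simpa using mul_mem (show n ∈ N from hn) (hdN h1)
  · exact fun hg => ⟨g, hg, rfl⟩

/-- The sorting data on the profinite group of a structure satisfying the axioms. -/
noncomputable def sortingData [Nonempty (Tup J)] : SortingData Jsub hM.group :=
  have hroot : ∀ (N : OpenNormalSubgroup hM.group) (T T' : Tup J), T.support ⊆ T'.support →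
      (∃ (k : ℕ+) (a : M.carrier (k, T)), hM.kernel a = N) →
      ∃ (k : ℕ+) (a : M.carrier (k, T')), hM.kernel a = N := by
    rintro N T T' hT ⟨k, a, rfl⟩
    obtain ⟨b, hb⟩ := hM.exists_sort k a hT (hM.ncard_cls_le a)
    exact ⟨k, b, (hM.kernel_eq_iff _ _).2 hb⟩
  -- A tuple belongs to `F N` if `N` is represented in some sort with that tuple, for an arbitrary
  -- integer. Invariance under permutation is then a case of `hroot`.
  { F := fun N => {T | ∃ (k : ℕ+) (a : M.carrier (k, T)), hM.kernel a = N}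
    nonempty := fun N => by
      obtain ⟨s, a, ha⟩ := hM.exists_kernel_eq N
      exact ⟨s.2, s.1, a, ha⟩
    whole := fun N hN => Set.eq_univ_of_forall fun T => by
      obtain ⟨x, -⟩ := hM.nonempty_one T
      refine ⟨1, x, ?_⟩
      have h1 : (hM.kernel x).toSubgroup.index = 1 := by
        rw [index_kernel]
        exact le_antisymm (hM.ncard_cls_le x) (hM.ncard_cls_pos x)
      rw [Subgroup.index_eq_one, ← hN] at h1
      exact SetLike.ext fun g => SetLike.ext_iff.1 h1 g
    root := fun N T => ⟨fun h T' hT => hroot N T T' hT h, fun h => h fun _ hj => hj⟩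
    perm := fun N T T' h => ⟨hroot N T T' fun _ hj => h.mem_iff.1 hj,
      hroot N T' T fun _ hj => h.mem_iff.2 hj⟩
    up := by
      rintro N₁ N₂ k T hN hk ⟨k', a, rfl⟩
      obtain ⟨s, b, rfl⟩ := hM.exists_kernel_eq N₂
      rw [index_kernel] at hk
      -- `a` may have another integer in its sort than `k`. It is first moved to the sort `(k, T)`,
      -- so that the elements above it get the tuple `Jsub k T`.
      obtain ⟨a', ha'⟩ := hM.exists_sort k a subset_rfl hk
      obtain ⟨b', hb'⟩ := hM.exists_above (hM.trans ha'.1 ((hM.kernel_le_iff _ _).1 hN))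
      exact ⟨k, b', (hM.kernel_eq_iff _ _).2 hb'⟩
    inter := by
      rintro N₁ N₂ T₁ T₂ ⟨k₁, a, rfl⟩ ⟨k₂, b, rfl⟩
      obtain ⟨c, hc, hca, hcb, -⟩ := hM.exists_meet a b
      refine ⟨k₁ * k₂, c, le_antisymm (le_inf ((hM.kernel_le_iff _ _).2 hca)
        ((hM.kernel_le_iff _ _).2 hcb)) fun g hg => ?_⟩
      have h1 : hM.proj a g = 1 := hg.1
      have h2 : hM.proj b g = 1 := hg.2
      rw [← hM.img_proj hca] at h1
      rw [← hM.img_proj hcb] at h2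
      have h3 : hM.proj c g ∈ (hM.img hca).ker ⊓ (hM.img hcb).ker := ⟨h1, h2⟩
      rw [hM.ker_of_jointlyInjective hca hcb hc] at h3
      exact h3
    conj := by
      intro N₁ N₂ g h
      have : N₁ = N₂ := SetLike.ext fun x => by
        rw [h]
        refine ⟨fun hx => N₁.isNormal'.conj_mem x hx g, fun hx => ?_⟩
        have h1 := N₁.isNormal'.conj_mem _ hx g⁻¹
        rwa [show g⁻¹ * (g * x * g⁻¹) * g⁻¹⁻¹ = x by group] at h1
      rw [this] }

theorem proj_val {a b : M.carrier s} (h : M.Sim a b) (g : hM.group) :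
    (hM.proj a g).val = (hM.proj b g).val := by
  refine hM.eq_of_C ?_ (hM.sim_trans (hM.proj a g).2 (hM.sim_trans h (hM.proj b g).2.symm))
  rw [← hM.img_proj h.1]
  exact hM.C_img _ _

/-- The description of a structure satisfying the axioms by its profinite group. -/
noncomputable def rep [Nonempty (Tup J)] : Rep M hM.group hM.sortingData :=
  have hmem : ∀ {s : Srt J} {a : M.carrier s} {g : hM.group}, (hM.proj a g).val = a →
      ∀ h, (hM.proj a h).val = a ↔ g⁻¹ * h ∈ hM.kernel a := by
    intro s a g hg h
    rw [mem_kernel, map_mul, map_inv, inv_mul_eq_one, Cls.ext_iff, hg, eq_comm]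
  have hex : ∀ {s : Srt J} (a : M.carrier s), ∃ g, (hM.proj a g).val = a := fun a => by
    obtain ⟨g, hg⟩ := hM.proj_surjective a ⟨a, hM.sim_refl a⟩
    exact ⟨g, by rw [hg]⟩
  { ker := hM.kernel
    -- A thread belongs to the coset named by `a` when its value at `a` is `a` itself.
    mem := fun a g => (hM.proj a g).val = a
    index_le := fun a => (hM.index_kernel a).trans_le (hM.ncard_cls_le a)
    sort_mem := fun {s} a => ⟨s.1, a, rfl⟩
    exists_mem := hex
    mem_iff := hmem
    le_iff := fun a b => (hM.kernel_le_iff a b).symm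
    C_iff := fun a b => by
      constructor
      · intro h g hg
        have h1 := hM.C_img (hM.cle h) (hM.proj a g)
        rw [hM.img_proj, hg] at h1
        exact hM.eq_image h1 h (hM.proj b g).2
      · intro h
        obtain ⟨g, hg⟩ := hex a
        have hle : hM.kernel a ≤ hM.kernel b := fun n hn => by
          have h1 := h (g * n) ((hmem hg _).2 (by rwa [inv_mul_cancel_left]))
          rwa [hmem (h g hg), inv_mul_cancel_left] at h1
        have h1 := hM.C_img ((hM.kernel_le_iff _ _).1 hle) (hM.proj a g)
        rwa [hM.img_proj, hg, h g hg] at h1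
    P_iff := fun a b c => by
      simp only [kernel_eq_iff]
      constructor
      · intro h
        obtain ⟨hab, hbc⟩ := hM.P_sim _ _ _ _ h
        obtain ⟨g, hg⟩ := hex a
        obtain ⟨k, hk⟩ := hex b
        refine ⟨hab, hbc, g, k, hg, hk, ?_⟩
        have h1 := hM.mul_spec (hM.proj c g) (hM.proj c k)
        rw [hM.proj_val (hM.sim_trans hab hbc).symm g, hM.proj_val hbc.symm k, hg, hk,
          ← map_mul] at h1
        exact hM.P_unique _ _ _ _ _ h1 h
      · rintro ⟨hab, hbc, g, k, hg, hk, hgk⟩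
        have h1 := hM.mul_spec (hM.proj c g) (hM.proj c k)
        rwa [hM.proj_val (hM.sim_trans hab hbc).symm g, hM.proj_val hbc.symm k, hg, hk,
          ← map_mul, hgk] at h1
    eq_of_mem := fun {s a b} h g hg hg' => by
      rw [← hg, ← hg', hM.proj_val ((hM.kernel_eq_iff _ _).1 h)]
    exists_elt := fun s N hN hs g => by
      obtain ⟨k, a, rfl⟩ := hs
      rw [index_kernel] at hN
      obtain ⟨b, hb⟩ := hM.exists_sort s.1 a subset_rfl hN
      have h1 := (hM.proj b g).2
      exact ⟨(hM.proj b g).val, (hM.kernel_eq_iff _ _).2 (hM.sim_trans h1 hb),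
        hM.proj_val h1 g⟩ }

/-- Completeness of the axioms. Threads are indexed by the elements of all sorts, so the group lives
in a universe containing that of `J`; hence the form `max u v` of the universe of `M`. -/
theorem isSCS [Nonempty (Tup J)] {M : Str.{u, max u v} J} (hM : Ax Jsub M) : IsSCS Jsub M :=
  Rep.isSCS (G := hM.group) hM.rep

end Ax

/-! ### Subsystems -/

/-- Closure conditions which characterize subsystems. -/
structure Closed {J : Type u} (Jsub : ℕ+ → Tup J → Tup J) (M : Str.{u, w} J) (A : Set M.Elt) :
    Prop where
  sim : ∀ (s t : Srt J) (a : M.carrier s) (b : M.carrier t), (⟨s, a⟩ : M.Elt) ∈ A → M.Sim b a →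
    s.2.support ⊆ t.2.support → (⟨t, b⟩ : M.Elt) ∈ A
  top : ∀ (s : Srt J) (b : M.carrier s), (∀ (t : Srt J) (x : M.carrier t), M.le x b) →
    (⟨s, b⟩ : M.Elt) ∈ A
  above : ∀ (s t : Srt J) (a : M.carrier s) (b : M.carrier t), (⟨s, a⟩ : M.Elt) ∈ A → M.le a b →
    t.2 = Jsub s.1 s.2 → (⟨t, b⟩ : M.Elt) ∈ A
  meet : ∀ (s t r : Srt J) (a : M.carrier s) (b : M.carrier t) (c : M.carrier r),
    (⟨s, a⟩ : M.Elt) ∈ A → (⟨t, b⟩ : M.Elt) ∈ A → M.IsMeet a b c → r.2 = s.2.append t.2 →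
    (⟨r, c⟩ : M.Elt) ∈ A

section

variable {J : Type u} {Jsub : ℕ+ → Tup J → Tup J} {M : Str.{u, w} J} {A B : Set M.Elt}
  {s t : Srt J}

theorem Closed.univ : Closed Jsub M Set.univ where
  sim _ _ _ _ _ _ _ := trivial
  top _ _ _ := trivial
  above _ _ _ _ _ _ _ := trivial
  meet _ _ _ _ _ _ _ _ _ _ := trivial

theorem Closed.sInter {𝒜 : Set (Set M.Elt)} (h : ∀ A ∈ 𝒜, Closed Jsub M A) :
    Closed Jsub M (⋂₀ 𝒜) where
  sim s t a b ha hab hst A hA := (h A hA).sim s t a b (ha A hA) hab hst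
  top s b hb A hA := (h A hA).top s b hb
  above s t a b ha hab hst A hA := (h A hA).above s t a b (ha A hA) hab hst
  meet s t r a b c ha hb hc hr A hA := (h A hA).meet s t r a b c (ha A hA) (hb A hA) hc hr

/-- Universal axioms pass to substructures, and each closure condition keeps the witnesses of some
existential axioms inside `A`. -/
theorem Closed.ax (hM : Ax Jsub M) (hA : Closed Jsub M A) : Ax Jsub (M.restrict A) where
  le_refl s a := hM.le_refl s a.1
  le_trans s t r a b c := hM.le_trans s t r a.1 b.1 c.1
  C_refl s a := hM.C_refl s a.1
  C_trans s t r a b c := hM.C_trans s t r a.1 b.1 c.1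
  C_le s t a b := hM.C_le s t a.1 b.1
  exists_image s t a b h := by
    obtain ⟨b', hb', hC⟩ := hM.exists_image s t a.1 b.1 h
    exact ⟨⟨b', hA.sim _ _ _ _ b.2 hb' subset_rfl⟩, hb', hC⟩
  image_unique s t a b b' h h' hb := Subtype.ext (hM.image_unique s t a.1 b.1 b'.1 h h' hb)
  exists_preimage s t a b h := by
    obtain ⟨a', ha', hC⟩ := hM.exists_preimage s t a.1 b.1 h
    exact ⟨⟨a', hA.sim _ _ _ _ a.2 ha' subset_rfl⟩, ha', hC⟩
  P_sim s a b c := hM.P_sim s a.1 b.1 c.1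
  P_total s a b h := by
    obtain ⟨c, hc⟩ := hM.P_total s a.1 b.1 h
    exact ⟨⟨c, hA.sim _ _ _ _ b.2 (hM.P_sim _ _ _ _ hc).2.symm subset_rfl⟩, hc⟩
  P_unique s a b c c' h h' := Subtype.ext (hM.P_unique s a.1 b.1 c.1 c'.1 h h')
  P_assoc s a b c x y z := hM.P_assoc s a.1 b.1 c.1 x.1 y.1 z.1
  P_one s a := by
    obtain ⟨e, he, h⟩ := hM.P_one s a.1
    refine ⟨⟨e, hA.sim _ _ _ _ a.2 he subset_rfl⟩, he, fun b hb => ?_⟩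
    obtain ⟨h1, c, hc⟩ := h b.1 hb
    exact ⟨h1, ⟨c, hA.sim _ _ _ _ b.2 (hM.P_sim _ _ _ _ hc).1 subset_rfl⟩, hc⟩
  P_image s t a b c a' b' c' := hM.P_image s t a.1 b.1 c.1 a'.1 b'.1 c'.1
  card s a x hx := by
    obtain ⟨i, j, hij, h⟩ := hM.card s a.1 (fun i => (x i).1) hx
    exact ⟨i, j, hij, Subtype.ext h⟩
  resort s m T hT a h := by
    obtain ⟨b, hb⟩ := hM.resort s m T hT a.1 fun x hx => by
      obtain ⟨i, j, hij, he⟩ := h (fun i => ⟨x i, hA.sim _ _ _ _ a.2 (hx i) subset_rfl⟩) hx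
      exact ⟨i, j, hij, congrArg Subtype.val he⟩
    exact ⟨⟨b, hA.sim _ _ _ _ a.2 hb hT⟩, hb⟩
  nonempty_one T := by
    obtain ⟨x, -⟩ := hM.nonempty_one T
    exact ⟨⟨x, hA.top _ _ fun t y => hM.le_one T t x y⟩, trivial⟩
  le_one T t x y := hM.le_one T t x.1 y.1
  meet s t a b := by
    obtain ⟨c, h, hc⟩ := hM.exists_meet a.1 b.1
    exact ⟨⟨c, hA.meet _ _ _ _ _ _ a.2 b.2 hc rfl⟩, hc.1, hc.2.1, fun x y a' b' hx hy ha hb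
      h1 h2 h3 h4 => Subtype.ext (h x.1 y.1 a'.1 b'.1 hx hy ha hb h1 h2 h3 h4)⟩
  quot s a x hx hmul hconj := by
    obtain ⟨b, hb⟩ := hM.quot s a.1 (fun i => (x i).1) hx
      (fun i j => (hmul i j).imp fun l hl => hl)
      (fun g y i h => hconj
        ⟨g, hA.sim _ _ _ _ (x i).2 (hM.P_sim _ _ _ _ h).1 subset_rfl⟩
        ⟨y, hA.sim _ _ _ _ (x i).2 (hM.P_sim _ _ _ _ h).2.symm subset_rfl⟩ i h)
    have h0 : M.C (x ⟨0, s.1.pos⟩).1 b := (hb _ (hx _)).2 ⟨_, rfl⟩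
    refine ⟨⟨b, hA.above _ _ _ _ (x ⟨0, s.1.pos⟩).2 (hM.cle h0) rfl⟩, fun h hh => ?_⟩
    exact (hb h.1 hh).trans (exists_congr fun i => Subtype.ext_iff.symm)
  C_of_fiber s t r h b b' hb H := hM.C_of_fiber s t r h.1 b.1 b'.1 hb fun h' hh' hC =>
    H ⟨h', hA.sim _ _ _ _ h.2 hh' subset_rfl⟩ hh' hC

/-- The embedding of a substructure. -/
def inclusion (M : Str.{u, w} J) (A : Set M.Elt) : Emb (M.restrict A) M where
  toFun _ a := a.1
  inj _ := Subtype.val_injective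
  map_le _ _ := Iff.rfl
  map_C _ _ := Iff.rfl
  map_P _ _ _ := Iff.rfl

namespace Ax

variable (hM : Ax Jsub M) (hA : Ax Jsub (M.restrict A))
include hM hA

/-- The class cannot grow from `A` to `M`. If it has `n` elements in `A`, then `A` represents it in
a sort whose integer is `n`, and the bound on classes of that sort in `M` leaves no room for more.
-/
theorem image_cls_restrict (a : (M.restrict A).carrier s) :
    (inclusion M A).toFun s '' (M.restrict A).cls a = M.cls ((inclusion M A).toFun s a) := by
  have hsub : (inclusion M A).toFun s '' (M.restrict A).cls a ⊆
      M.cls ((inclusion M A).toFun s a) := by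
    rintro _ ⟨x, hx, rfl⟩
    exact hx
  refine Set.eq_of_subset_of_ncard_le hsub ?_ (hM.finite_cls _)
  rw [Set.ncard_image_of_injective _ ((inclusion M A).inj s)]
  obtain ⟨b, hb⟩ := hA.exists_sort ⟨_, hA.ncard_cls_pos a⟩ a subset_rfl le_rfl
  exact (hM.ncard_cls_sim (a := b.1) (b := (inclusion M A).toFun s a) hb).symm.trans_le
    (hM.ncard_cls_le b.1)

theorem ncard_cls_restrict (a : (M.restrict A).carrier s) :
    ((M.restrict A).cls a).ncard = (M.cls ((inclusion M A).toFun s a)).ncard := by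
  rw [← hM.image_cls_restrict hA, Set.ncard_image_of_injective _ ((inclusion M A).inj s)]

theorem mem_of_sim (a : (M.restrict A).carrier s) {b : M.carrier s} (h : M.Sim b a.1) :
    (⟨s, b⟩ : M.Elt) ∈ A := by
  have : b ∈ M.cls ((inclusion M A).toFun s a) := h
  rw [← hM.image_cls_restrict hA] at this
  obtain ⟨x, -, rfl⟩ := this
  exact x.2

theorem mem_of_sim_of_support (a : (M.restrict A).carrier s) {b : M.carrier t} (h : M.Sim b a.1)
    (hst : s.2.support ⊆ t.2.support) : (⟨t, b⟩ : M.Elt) ∈ A := by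
  obtain ⟨b', hb'⟩ := hA.exists_sort t.1 a hst 
    ((hM.ncard_cls_restrict hA a).trans_le ((hM.ncard_cls_sim h).symm.trans_le
      (hM.ncard_cls_le b)))
  exact hM.mem_of_sim hA b' (hM.sim_trans h (Str.Sim.symm hb'))

/-- The inclusion of the group of an element in a substructure. -/
noncomputable def clsInclusion (a : (M.restrict A).carrier s) : hA.Cls a →* hM.Cls a.1 :=
  MonoidHom.mk' (fun x => ⟨x.1.1, x.2⟩) fun x y =>
    ((hM.P_iff ⟨x.1.1, x.2⟩ ⟨y.1.1, y.2⟩ ⟨(x * y).1.1, (x * y).2⟩).1 (hA.mul_spec x y)).symm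

/-- Quotients and meets formed inside `A` have the same kernels as those formed in `M`, so they are
equivalent to them. Since classes in `A` are full in `M`, and `A` can change sorts, the elements of
`M` itself lie in `A`. -/
theorem closed_of_restrict : Closed Jsub M A where
  sim s t a b ha hab hst := hM.mem_of_sim_of_support hA ⟨a, ha⟩ hab hst
  top s b hb := by
    obtain ⟨x, -⟩ := hA.nonempty_one s.2
    exact hM.mem_of_sim_of_support hA x ⟨hM.le_one _ _ _ _, hb _ _⟩ subset_rfl
  above s t a b ha hab hst := by
    let a' : (M.restrict A).carrier s := ⟨a, ha⟩
    obtain ⟨b', hb'⟩ := hA.exists_quot a' ((hM.img hab).ker.comap (hM.clsInclusion hA a'))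
    refine hM.mem_of_sim_of_support hA b' ?_ (by rw [hst])
    have hb1 := (1 : hM.Cls b).2
    have h1 : ∀ y : hM.Cls a, M.C y.1 b'.1 ↔ M.C y.1 (1 : hM.Cls b).1 := fun y => by
      rw [hM.C_iff hab]
      exact hb' ⟨⟨y.1, hM.mem_of_sim hA ⟨a, ha⟩ y.2⟩, y.2⟩
    have hab' : M.le a b'.1 := hM.trans (1 : hM.Cls a).2.2
      (hM.cle ((h1 1).2 ((hM.C_iff hab _ _).2 (map_one _))))
    have h2 : M.C b'.1 (1 : hM.Cls b).1 := (hM.C_of_le_iff hab').2 fun y => (h1 y).1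
    have h3 : M.C (1 : hM.Cls b).1 b'.1 :=
      (hM.C_of_le_iff (hM.trans hab hb1.2)).2 fun y => (h1 y).2
    exact hM.sim_trans hb1.symm ⟨hM.cle h3, hM.cle h2⟩
  meet s t r a b c ha hb hc hr := by
    obtain ⟨d, hd, hda, hdb, -⟩ := hA.exists_meet (⟨a, ha⟩ : (M.restrict A).carrier s)
      (⟨b, hb⟩ : (M.restrict A).carrier t)
    have h1 : M.IsMeet a b d.1 := hM.isMeet_of_jointlyInjective hda hdb
      fun x y a' b' hx hy ha' hb' h1 h2 h3 h4 => congrArg Subtype.val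
        (hd ⟨x, hM.mem_of_sim hA d hx⟩ ⟨y, hM.mem_of_sim hA d hy⟩
          ⟨a', hM.mem_of_sim hA ⟨a, ha⟩ ha'⟩ ⟨b', hM.mem_of_sim hA ⟨b, hb⟩ hb'⟩
          hx hy ha' hb' h1 h2 h3 h4)
    exact hM.mem_of_sim_of_support hA d
      ⟨h1.2.2 _ _ hc.1 hc.2.1, hc.2.2 _ _ h1.1 h1.2.1⟩ (by rw [hr])

end Ax

/-- The embedding of a substructure in a larger one. -/
def inclusionOfSubset (h : A ⊆ B) : Emb (M.restrict A) (M.restrict B) where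
  toFun _ a := ⟨a.1, h a.2⟩
  inj _ _ _ hab := Subtype.ext (Subtype.mk.inj hab)
  map_le _ _ := Iff.rfl
  map_C _ _ := Iff.rfl
  map_P _ _ _ := Iff.rfl

/-- The action of an embedding on the elements of all sorts. -/
def Emb.elt {M : Str.{u, w} J} {N : Str.{u, w'} J} (f : Emb M N) (p : M.Elt) : N.Elt :=
  ⟨p.1, f.toFun p.1 p.2⟩

theorem Emb.elt_injective {M : Str.{u, w} J} {N : Str.{u, w'} J} (f : Emb M N) :
    Function.Injective f.elt := by
  rintro ⟨s, a⟩ ⟨t, b⟩ h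
  obtain rfl : s = t := congrArg Sigma.fst h
  have h' : f.toFun s a = f.toFun s b := eq_of_heq (Sigma.mk.inj h).2
  rw [f.inj s h']

/-- An embedding restricts to an isomorphism of a substructure with its image. -/
def Emb.restrictImage {M : Str.{u, w} J} {N : Str.{u, w'} J} (f : Emb M N) (B : Set M.Elt) :
    Emb (M.restrict B) (N.restrict (f.elt '' B)) where
  toFun s a := ⟨f.toFun s a.1, ⟨⟨s, a.1⟩, a.2, rfl⟩⟩
  inj s _ _ h := Subtype.ext (f.inj s (Subtype.mk.inj h))
  map_le a b := f.map_le a.1 b.1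
  map_C a b := f.map_C a.1 b.1
  map_P a b c := f.map_P a.1 b.1 c.1

theorem Emb.restrictImage_surjective {M : Str.{u, w} J} {N : Str.{u, w'} J} (f : Emb M N)
    (B : Set M.Elt) (s : Srt J) : Function.Surjective ((f.restrictImage B).toFun s) := by
  rintro ⟨b, ⟨t, a⟩, ha, hab⟩
  obtain rfl : t = s := congrArg Sigma.fst hab
  obtain rfl : f.toFun t a = b := eq_of_heq (Sigma.mk.inj hab).2
  exact ⟨⟨a, ha⟩, rfl⟩

theorem Emb.iso_restrict_image {M : Str.{u, w} J} {N : Str.{u, w'} J} (f : Emb M N)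
    (B : Set M.Elt) : Iso (M.restrict B) (N.restrict (f.elt '' B)) :=
  ⟨f.restrictImage B, f.restrictImage_surjective B⟩

theorem Emb.iso_restrict_range {M : Str.{u, w} J} {N : Str.{u, w'} J} (f : Emb M N) :
    Iso M (N.restrict (f.elt '' Set.univ)) := by
  refine Iso.trans (N := M.restrict Set.univ) ?_ (f.iso_restrict_image _)
  exact Iso.symm ⟨inclusion M Set.univ, fun s a => ⟨⟨a, trivial⟩, rfl⟩⟩

/-- Consequently a lower bound of a set is a lower bound of everything the set generates. -/
theorem Closed.setOf_le (hM : Ax Jsub M) (p : M.Elt) : Closed Jsub M {q | M.le p.2 q.2} where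
  sim _ _ _ _ ha hab _ := hM.trans ha hab.2
  top _ _ hb := hb _ _
  above _ _ _ _ ha hab _ := hM.trans ha hab
  meet _ _ _ _ _ _ ha hb hc _ := hc.2.2 _ _ ha hb

theorem Closed.exists_lower [Nonempty (Tup J)] (hM : Ax Jsub M) (hA : Closed Jsub M A)
    {S : Set M.Elt} (hS : S.Finite) (hSA : S ⊆ A) : ∃ p ∈ A, ∀ q ∈ S, M.le p.2 q.2 := by
  induction S, hS using Set.Finite.induction_on with
  | empty =>
    obtain ⟨x, -⟩ := hM.nonempty_one (Classical.arbitrary (Tup J))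
    exact ⟨⟨_, x⟩, hA.top _ _ fun t y => hM.le_one _ t x y, by simp⟩
  | @insert a S _ _ ih =>
    obtain ⟨p, hpA, hp⟩ := ih ((Set.subset_insert a S).trans hSA)
    obtain ⟨c, -, hc⟩ := hM.exists_meet p.2 a.2
    refine ⟨⟨_, c⟩, hA.meet _ _ _ _ _ _ hpA (hSA (Set.mem_insert a S)) hc rfl, ?_⟩
    rintro q (rfl | hq)
    · exact hc.2.1
    · exact hM.trans hc.1 (hp q hq)

end

/-! ### Generated subsystems -/

section

variable {J : Type u} {Jsub : ℕ+ → Tup J → Tup J} [Nonempty (Tup J)] {M N : Str.{u, max u v} J}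
  {A X Y : Set M.Elt}

theorem Closed.isSubsystem (hM : Ax Jsub M) (hA : Closed Jsub M A) : IsSubsystem Jsub M A :=
  Ax.isSCS.{u, v} (hA.ax hM)

omit [Nonempty (Tup J)] in
theorem IsSubsystem.closed (hM : Ax Jsub M) (hA : IsSubsystem Jsub M A) : Closed Jsub M A :=
  hM.closed_of_restrict hA.ax

omit [Nonempty (Tup J)] in
-- Being a subsystem amounts to closure conditions, and these survive intersections. So the
-- intersection of all subsystems containing `X` is again a subsystem.
theorem closed_generated (hM : Ax Jsub M) (X : Set M.Elt) :
    Closed Jsub M (generated Jsub M X) :=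
  Closed.sInter fun _ hA => hA.1.closed hM

omit [Nonempty (Tup J)] in
theorem subset_generated (X : Set M.Elt) : X ⊆ generated Jsub M X :=
  fun _ hp _ hA => hA.2 hp

theorem Closed.generated_subset (hM : Ax Jsub M) (hA : Closed Jsub M A) (h : X ⊆ A) :
    generated Jsub M X ⊆ A :=
  fun _ hp => hp A ⟨hA.isSubsystem.{u, v} hM, h⟩

theorem generated_mono (hM : Ax Jsub M) (h : X ⊆ generated Jsub M Y) :
    generated Jsub M X ⊆ generated Jsub M Y :=
  (closed_generated hM Y).generated_subset.{u, v} hM h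

/-- Closure refers to the ambient structure, but being a sorted complete system does not; the latter
is what passes to the isomorphic image. -/
theorem Closed.image (hM : Ax Jsub M) (hN : Ax Jsub N) (f : Emb M N) (hA : Closed Jsub M A) :
    Closed Jsub N (f.elt '' A) :=
  hN.closed_of_restrict ((hA.isSubsystem.{u, v} hM).of_iso (f.iso_restrict_image A)).ax

theorem image_generated (hM : Ax Jsub M) (hN : Ax Jsub N) (f : Emb M N) (X : Set M.Elt) :
    f.elt '' generated Jsub M X = generated Jsub N (f.elt '' X) := by
  apply subset_antisymm
  · have h1 : generated Jsub N (f.elt '' X) ⊆ f.elt '' Set.univ :=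
      (Closed.univ.image.{u, v} hM hN f).generated_subset.{u, v} hN
        (Set.image_mono (Set.subset_univ _))
    have h2 : f.elt '' (f.elt ⁻¹' generated Jsub N (f.elt '' X)) =
        generated Jsub N (f.elt '' X) := by
      rw [Set.image_preimage_eq_iff, ← Set.image_univ]
      exact h1
    have h3 : Closed Jsub M (f.elt ⁻¹' generated Jsub N (f.elt '' X)) := by
      have h4 := f.iso_restrict_image (f.elt ⁻¹' generated Jsub N (f.elt '' X))
      rw [h2] at h4
      exact hM.closed_of_restrict
        (((closed_generated hN _).isSubsystem.{u, v} hN).of_iso h4.symm).ax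
    exact Set.image_subset_iff.2 (h3.generated_subset.{u, v} hM
      (Set.image_subset_iff.1 (subset_generated _)))
  · exact ((closed_generated hM X).image.{u, v} hM hN f).generated_subset.{u, v} hN
      (Set.image_mono (subset_generated X))

theorem exists_least_generated (hM : Ax Jsub M) (hX : X.Finite) :
    ∃ p ∈ generated Jsub M X, ∀ q ∈ generated Jsub M X, M.le p.2 q.2 := by
  obtain ⟨p, hp, h⟩ := (closed_generated hM X).exists_lower hM hX (subset_generated X)
  exact ⟨p, hp, (Closed.setOf_le hM p).generated_subset.{u, v} hM h⟩

/-- The set `X` is finite and locally full, and it has a least element. -/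
structure IsFrame (M : Str.{u, w} J) (X : Set M.Elt) : Prop where
  finite : X.Finite
  locallyFull : LocallyFull M X
  exists_least : ∃ p ∈ X, ∀ q ∈ X, M.le p.2 q.2

theorem IsFrame.isPresystem (hM : Ax Jsub M) (hX : IsFrame M X) : IsPresystem Jsub M X := by
  obtain ⟨p, hp, h⟩ := hX.exists_least
  exact ⟨hX.locallyFull, fun q hq =>
    ⟨p, hp, (Closed.setOf_le hM p).generated_subset.{u, v} hM h hq⟩⟩

/-- Adjoin a least element of the generated subsystem and fill up the classes, which are finite;
nothing leaves the generated subsystem. -/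
theorem exists_isFrame (hM : Ax Jsub M) (hX : X.Finite) :
    ∃ Y, IsFrame M Y ∧ X ⊆ Y ∧ generated Jsub M Y = generated Jsub M X := by
  obtain ⟨p, hp, h⟩ := exists_least_generated.{u, v} hM hX
  let Y : Set M.Elt := ⋃ q ∈ insert p X, Sigma.mk q.1 '' M.cls q.2
  have hY : ∀ (s : Srt J) (a : M.carrier s), (⟨s, a⟩ : M.Elt) ∈ Y ↔
      ∃ b : M.carrier s, (⟨s, b⟩ : M.Elt) ∈ insert p X ∧ M.Sim a b := by
    intro s a
    simp only [Y, Set.mem_iUnion]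
    constructor
    · rintro ⟨⟨t, b⟩, hq, x, hx, hxa⟩
      obtain rfl : t = s := congrArg Sigma.fst hxa
      obtain rfl : x = a := eq_of_heq (Sigma.mk.inj hxa).2
      exact ⟨b, hq, hx⟩
    · rintro ⟨b, hb, hab⟩
      exact ⟨⟨s, b⟩, hb, a, hab, rfl⟩
  have hYg : Y ⊆ generated Jsub M X := by
    rintro ⟨s, a⟩ ha
    obtain ⟨b, hb, hab⟩ := (hY s a).1 ha
    refine (closed_generated hM X).sim _ _ _ _ ?_ hab subset_rfl
    rcases hb with rfl | hb
    · exact hp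
    · exact subset_generated X hb
  have hXY : insert p X ⊆ Y := fun ⟨s, a⟩ ha => (hY s a).2 ⟨a, ha, hM.sim_refl a⟩
  refine ⟨Y, ⟨?_, ?_, p, hXY (Set.mem_insert _ _), fun q hq => h q (hYg hq)⟩,
    (Set.subset_insert _ _).trans hXY, subset_antisymm (generated_mono.{u, v} hM hYg)
      (generated_mono.{u, v} hM (((Set.subset_insert _ _).trans hXY).trans
        (subset_generated Y)))⟩
  · exact (hX.insert p).biUnion fun q _ => (hM.finite_cls q.2).image _
  · intro s a b ha hab hba
    obtain ⟨c, hc, hac⟩ := (hY s a).1 ha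
    exact (hY s b).2 ⟨c, hc, hM.sim_trans ⟨hba, hab⟩ hac⟩

theorem IsFrame.image (hM : Ax Jsub M) (hN : Ax Jsub N) (f : Emb M N) (hX : IsFrame M X) :
    IsFrame N (f.elt '' X) where
  finite := hX.finite.image _
  locallyFull := by
    rintro s a b ⟨⟨t, a'⟩, ha', haa⟩ hab hba
    obtain rfl : t = s := congrArg Sigma.fst haa
    obtain rfl : f.toFun t a' = a := eq_of_heq (Sigma.mk.inj haa).2
    have h1 := (Closed.univ.image.{u, v} hM hN f).sim _ _ (f.toFun t a') b
      ⟨⟨t, a'⟩, trivial, rfl⟩ ⟨hba, hab⟩ subset_rfl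
    obtain ⟨⟨t', b'⟩, -, hbb⟩ := h1
    obtain rfl : t' = t := congrArg Sigma.fst hbb
    obtain rfl : f.toFun t' b' = b := eq_of_heq (Sigma.mk.inj hbb).2
    exact ⟨⟨t', b'⟩, hX.locallyFull _ _ _ ha' ((f.map_le _ _).1 hab) ((f.map_le _ _).1 hba), rfl⟩
  exists_least := by
    obtain ⟨p, hp, h⟩ := hX.exists_least
    refine ⟨f.elt p, ⟨p, hp, rfl⟩, ?_⟩
    rintro _ ⟨q, hq, rfl⟩
    exact (f.map_le _ _).2 (h q hq)

end

/-! ### Extension of finite partial isomorphisms -/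

section

variable {J : Type u} {Jsub : ℕ+ → Tup J → Tup J} {M M' : Str.{u, w} J}
  {s t r : Srt J}

namespace Ax

variable (hM : Ax Jsub M)
include hM

theorem C_iff_mem_ker {a : M.carrier s} {b : M.carrier t} (hab : M.le a b) {x : hM.Cls a}
    (hx : M.C x.1 b) (y : hM.Cls a) : M.C y.1 b ↔ x⁻¹ * y ∈ (hM.img hab).ker := by
  rw [hM.C_iff hab x ⟨b, hM.sim_refl b⟩] at hx
  rw [hM.C_iff hab y ⟨b, hM.sim_refl b⟩, MonoidHom.mem_ker, map_mul, map_inv, inv_mul_eq_one,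
    hx, eq_comm]

theorem ker_eq_of_sim {a : M.carrier s} {b : M.carrier t} {b' : M.carrier r} (hab : M.le a b)
    (hab' : M.le a b') (h : M.Sim b b') : (hM.img hab).ker = (hM.img hab').ker :=
  le_antisymm (hM.ker_of_le hab hab' h.1) (hM.ker_of_le hab' hab h.2)

theorem index_ker_img {a : M.carrier s} {b : M.carrier t} (hab : M.le a b) :
    (hM.img hab).ker.index = (M.cls b).ncard := by
  rw [Subgroup.index_ker, MonoidHom.range_eq_top.2 (hM.img_surjective hab), Subgroup.card_top,
    hM.card_Cls]

/-- The largest class is equivalent to one in a sort with integer `1`, so it has a single element.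
-/
theorem C_of_top {a : M.carrier s} {b : M.carrier t}
    (hb : ∀ (r : Srt J) (x : M.carrier r), M.le x b) : M.C a b := by
  obtain ⟨b', hb', hC⟩ := hM.exists_image _ _ a b (hb _ a)
  obtain ⟨x, -⟩ := hM.nonempty_one t.2
  have h1 : (M.cls b).ncard ≤ 1 := by
    rw [← hM.ncard_cls_sim ⟨hb _ x, hM.le_one _ _ x b⟩]
    exact hM.ncard_cls_le x
  rwa [← (Set.ncard_le_one (hM.finite_cls b)).1 h1 b' hb' b (hM.sim_refl b)]

theorem exists_top (s : Srt J) :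
    ∃ b : M.carrier s, ∀ (r : Srt J) (x : M.carrier r), M.le x b := by
  obtain ⟨x, -⟩ := hM.nonempty_one s.2
  obtain ⟨b, hb⟩ := hM.exists_sort s.1 x subset_rfl
    ((hM.ncard_cls_le x).trans s.1.pos)
  exact ⟨b, fun r y => hM.trans (hM.le_one _ _ x y) hb.2⟩

theorem ker_of_jointlyInjective_of_le {q : Srt J} {a : M.carrier s} {b : M.carrier t}
    {c : M.carrier r} {d : M.carrier q} (hdc : M.le d c) (hca : M.le c a) (hcb : M.le c b)
    (h : M.JointlyInjective a b c) :
    (hM.img hdc).ker = (hM.img (hM.trans hdc hca)).ker ⊓ (hM.img (hM.trans hdc hcb)).ker := by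
  refine le_antisymm (le_inf (hM.ker_of_le _ _ hca) (hM.ker_of_le _ _ hcb)) fun x hx => ?_
  have h1 : hM.img hdc x ∈ (hM.img hca).ker ⊓ (hM.img hcb).ker :=
    ⟨(hM.img_img hdc hca x).trans hx.1, (hM.img_img hdc hcb x).trans hx.2⟩
  rw [hM.ker_of_jointlyInjective hca hcb h] at h1
  exact h1

end Ax

/-! ### Correspondences induced by an isomorphism of groups -/

variable {hM : Ax Jsub M} {hM' : Ax Jsub M'} {s₀ : Srt J} {a₀ : M.carrier s₀}
  {a₀' : M'.carrier s₀} (θ : hM.Cls a₀ ≃* hM'.Cls a₀')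

/-- The elements `b` and `b'` correspond to each other under an isomorphism of the groups of
`a₀ ≤ b` and `a₀' ≤ b'`. -/
structure Corr (b : M.carrier s) (b' : M'.carrier s) : Prop where
  le : M.le a₀ b
  le' : M'.le a₀' b'
  C_iff : ∀ x : hM.Cls a₀, M.C x.1 b ↔ M'.C (θ x).1 b'

namespace Corr

variable {θ} {b : M.carrier s} {b' : M'.carrier s} {d : M.carrier t} {d' : M'.carrier t}

theorem symm (h : Corr θ b b') : Corr θ.symm b' b :=
  ⟨h.le', h.le, fun x => by rw [h.C_iff, MulEquiv.apply_symm_apply]⟩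

theorem C_imp (hb : Corr θ b b') (hd : Corr θ d d') (h : M.C b d) : M'.C b' d' := by
  rw [hM'.C_of_le_iff hb.le']
  intro y hy
  obtain ⟨x, rfl⟩ := θ.surjective y
  exact (hd.C_iff x).1 (hM.ctrans ((hb.C_iff x).2 hy) h)

theorem C_iff_C (hb : Corr θ b b') (hd : Corr θ d d') : M.C b d ↔ M'.C b' d' :=
  ⟨hb.C_imp hd, hb.symm.C_imp hd.symm⟩

/-- The kernel is a translate of the fibre over `b`, and `θ` preserves fibres. -/
theorem mem_ker (hb : Corr θ b b') (x : hM.Cls a₀) :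
    x ∈ (hM.img hb.le).ker ↔ θ x ∈ (hM'.img hb.le').ker := by
  obtain ⟨y, hy⟩ := hM.exists_fiber hb.le
  have h1 := hM.C_iff_mem_ker hb.le hy (y * x)
  have h2 := hM'.C_iff_mem_ker hb.le' ((hb.C_iff y).1 hy) (θ (y * x))
  rw [inv_mul_cancel_left] at h1
  rw [map_mul, inv_mul_cancel_left, ← map_mul] at h2
  rw [← h1, ← h2, hb.C_iff]

theorem of_ker (hb : M.le a₀ b) (hb' : M'.le a₀' b')
    (h : ∀ x, x ∈ (hM.img hb).ker ↔ θ x ∈ (hM'.img hb').ker) {x : hM.Cls a₀} (hx : M.C x.1 b)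
    (hx' : M'.C (θ x).1 b') : Corr θ b b' :=
  ⟨hb, hb', fun y => by
    rw [hM.C_iff_mem_ker hb hx, hM'.C_iff_mem_ker hb' hx', h, map_mul, map_inv]⟩

theorem le_imp (hb : Corr θ b b') (hd : Corr θ d d') (h : M.le b d) : M'.le b' d' := by
  refine hM'.le_of_ker hb.le' hd.le' fun y hy => ?_
  obtain ⟨x, rfl⟩ := θ.surjective y
  exact (hd.mem_ker x).1 (hM.ker_of_le hb.le hd.le h ((hb.mem_ker x).2 hy))

theorem le_iff (hb : Corr θ b b') (hd : Corr θ d d') : M.le b d ↔ M'.le b' d' :=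
  ⟨hb.le_imp hd, hb.symm.le_imp hd.symm⟩

theorem sim_imp (hb : Corr θ b b') (hd : Corr θ d d') (h : M.Sim b d) : M'.Sim b' d' :=
  ⟨hb.le_imp hd h.1, hd.le_imp hb h.2⟩

theorem eq_of_eq {b₁ b₂ : M.carrier s} {b₁' b₂' : M'.carrier s} (h₁ : Corr θ b₁ b₁')
    (h₂ : Corr θ b₂ b₂') (h : b₁ = b₂) : b₁' = b₂' := by
  subst h
  exact hM'.eq_of_C (h₁.C_imp h₂ (hM.C_refl _ _)) (h₁.sim_imp h₂ (hM.sim_refl _))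

theorem P_imp {b₁ b₂ b₃ : M.carrier s} {b₁' b₂' b₃' : M'.carrier s} (h₁ : Corr θ b₁ b₁')
    (h₂ : Corr θ b₂ b₂') (h₃ : Corr θ b₃ b₃') (h : M.P b₁ b₂ b₃) : M'.P b₁' b₂' b₃' := by
  obtain ⟨h12, h23⟩ := hM.P_sim _ _ _ _ h
  obtain ⟨x₁, hx₁⟩ := hM.exists_fiber h₁.le
  obtain ⟨x₂, hx₂⟩ := hM.exists_fiber h₂.le
  have hx₃ : M.C (x₁ * x₂).1 b₃ := by
    have e₁ := (hM.C_iff h₃.le x₁ ⟨b₁, hM.sim_trans h12 h23⟩).1 hx₁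
    have e₂ := (hM.C_iff h₃.le x₂ ⟨b₂, h23⟩).1 hx₂
    rw [hM.C_iff h₃.le _ ⟨b₃, hM.sim_refl _⟩, map_mul, e₁, e₂, ← hM.P_iff]
    exact h
  refine hM'.P_image _ _ _ _ _ _ _ _ (hM'.mul_spec (θ x₁) (θ x₂)) ((h₁.C_iff _).1 hx₁)
    ((h₂.C_iff _).1 hx₂) ?_ (h₁.sim_imp h₂ h12) (h₂.sim_imp h₃ h23)
  rw [← map_mul]
  exact (h₃.C_iff _).1 hx₃

theorem P_iff {b₁ b₂ b₃ : M.carrier s} {b₁' b₂' b₃' : M'.carrier s} (h₁ : Corr θ b₁ b₁')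
    (h₂ : Corr θ b₂ b₂') (h₃ : Corr θ b₃ b₃') : M.P b₁ b₂ b₃ ↔ M'.P b₁' b₂' b₃' :=
  ⟨h₁.P_imp h₂ h₃, h₁.symm.P_imp h₂.symm h₃.symm⟩

theorem ncard_cls (hb : Corr θ b b') : (M.cls b).ncard = (M'.cls b').ncard := by
  rw [← hM.index_ker_img hb.le, ← hM'.index_ker_img hb.le',
    ← Subgroup.index_comap_of_surjective (f := θ.toMonoidHom) _ θ.surjective]
  congr 1
  ext x
  exact hb.mem_ker x

/-- Corresponding classes have the same size, so the class of `b'` is also represented in the sort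
of `d`. There the partner is the image of `θ x`, for any `x` contained in `d`. -/
theorem exists_of_sim (hb : Corr θ b b') (hd : M.Sim d b)
    (hst : s.2.support ⊆ t.2.support) : ∃ d' : M'.carrier t, Corr θ d d' := by
  obtain ⟨e, he⟩ := hM'.exists_sort t.1 b' hst (by
    rw [← hb.ncard_cls, ← hM.ncard_cls_sim hd]
    exact hM.ncard_cls_le d)
  have hle : M.le a₀ d := hM.trans hb.le hd.2
  obtain ⟨x, hx⟩ := hM.exists_fiber hle
  obtain ⟨d', hd', hxd⟩ := hM'.exists_image _ _ (θ x).1 e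
    (hM'.trans (θ x).2.1 (hM'.trans hb.le' he.2))
  have hdb' := hM'.sim_trans hd' he
  have hle' : M'.le a₀' d' := hM'.trans hb.le' hdb'.2
  refine ⟨d', of_ker hle hle' (fun y => ?_) hx hxd⟩
  rw [hM.ker_eq_of_sim hle hb.le hd, hM'.ker_eq_of_sim hle' hb.le' hdb', hb.mem_ker]

/-- Matching kernels do not match `e` with `e'`, which may be different cosets. They do match the
identities of the two classes, from which every equivalent element is reached. -/
theorem exists_of_ker {e : M.carrier t} {e' : M'.carrier t} (he : M.le a₀ e) (he' : M'.le a₀' e')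
    (h : ∀ x, x ∈ (hM.img he).ker ↔ θ x ∈ (hM'.img he').ker) {q : Srt J} {d : M.carrier q}
    (hd : M.Sim d e) (htq : t.2 = q.2) : ∃ d' : M'.carrier q, Corr θ d d' := by
  have h1 := (1 : hM.Cls e).2
  have h1' := (1 : hM'.Cls e').2
  have h2 : Corr θ (1 : hM.Cls e).1 (1 : hM'.Cls e').1 :=
    of_ker (hM.trans he h1.2) (hM'.trans he' h1'.2) (fun x => by
      rw [hM.ker_eq_of_sim _ he h1, hM'.ker_eq_of_sim _ he' h1', h])
      (x := 1) ((hM.C_iff he _ _).2 (map_one _))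
      ((hM'.C_iff he' _ _).2 (by rw [map_one, map_one]))
  exact h2.exists_of_sim (hM.sim_trans hd h1.symm) (by rw [htq])

/-- The kernel of `d` is transported by `θ` and pushed down to the class of `b'`; nothing is lost,
as it contains the kernel of `b'`. The quotient is taken at `b'` rather than at `a₀'` because the
sort of a quotient is prescribed by that of the element divided. -/
theorem exists_of_le (hb : Corr θ b b') (hbd : M.le b d) (ht : t.2 = Jsub s.1 s.2) :
    ∃ d' : M'.carrier t, Corr θ d d' := by
  have hle : M.le a₀ d := hM.trans hb.le hbd
  let K : Subgroup (hM'.Cls a₀') := (hM.img hle).ker.comap θ.symm.toMonoidHom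
  have hK : K.Normal := Subgroup.normal_comap _
  have hQ : (K.map (hM'.img hb.le')).Normal := hK.map _ (hM'.img_surjective _)
  obtain ⟨e', he'⟩ := hM'.exists_quot b' (K.map (hM'.img hb.le'))
  obtain ⟨e, he⟩ := hM.exists_above hbd
  have hbe' : M'.le b' e' := hM'.trans (1 : hM'.Cls b').2.2 (hM'.cle ((he' 1).2 (one_mem _)))
  have hle' : M'.le a₀' e' := hM'.trans hb.le' hbe'
  have hle₂ : M.le a₀ e := hM.trans hle he.2
  have h1 : M'.C (1 : hM'.Cls a₀').1 e' := by
    refine hM'.ctrans (hM'.C_img hb.le' 1) ((he' _).2 ?_)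
    rw [map_one]
    exact one_mem _
  refine exists_of_ker hle₂ hle' (fun x => ?_) he.symm ht.symm
  have h2 := hM'.C_iff_mem_ker hle' h1 (θ x)
  rw [inv_one, one_mul] at h2
  rw [← h2, hM.ker_eq_of_sim hle₂ hle he]
  have h3 : M'.C (θ x).1 e' ↔ hM'.img hb.le' (θ x) ∈ K.map (hM'.img hb.le') := by
    rw [← he']
    refine ⟨fun h => ?_, fun h => hM'.ctrans (hM'.C_img _ _) h⟩
    exact hM'.C_image_mono (hM'.C_img hb.le' _) h (hM'.trans (hM'.img hb.le' (θ x)).2.1 hbe')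
  rw [h3]
  constructor
  · intro hx
    have h4 : θ.symm (θ x) ∈ (hM.img hle).ker := by rwa [θ.symm_apply_apply]
    exact ⟨θ x, h4, rfl⟩
  · rintro ⟨y, hy, hyx⟩
    obtain ⟨z, rfl⟩ := θ.surjective y
    have hz : z ∈ (hM.img hle).ker := by
      have : θ.symm (θ z) ∈ (hM.img hle).ker := hy
      rwa [θ.symm_apply_apply] at this
    have hzx : θ (z⁻¹ * x) ∈ (hM'.img hb.le').ker := by
      rw [MonoidHom.mem_ker, map_mul, map_inv, map_mul, map_inv, hyx, inv_mul_cancel]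
    have := mul_mem hz (hM.ker_of_le hb.le hle hbd ((hb.mem_ker _).2 hzx))
    rwa [mul_inv_cancel_left] at this

theorem exists_of_isMeet (hb : Corr θ b b') (hd : Corr θ d d') {c : M.carrier r}
    (hc : M.IsMeet b d c) (hr : r.2 = s.2.append t.2) : ∃ c' : M'.carrier r, Corr θ c c' := by
  obtain ⟨e, he, heb, hed, hem⟩ := hM.exists_meet b d
  obtain ⟨e', he', heb', hed', hem'⟩ := hM'.exists_meet b' d'
  refine exists_of_ker (hem _ _ hb.le hd.le) (hem' _ _ hb.le' hd.le') (fun x => ?_)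
    ⟨hem _ _ hc.1 hc.2.1, hc.2.2 _ _ heb hed⟩ hr.symm
  rw [hM.ker_of_jointlyInjective_of_le _ heb hed he,
    hM'.ker_of_jointlyInjective_of_le _ heb' hed' he']
  exact and_congr (hb.mem_ker x) (hd.mem_ker x)

theorem exists_of_top {b : M.carrier s} (hb : ∀ (r : Srt J) (x : M.carrier r), M.le x b) :
    ∃ b' : M'.carrier s, Corr θ b b' := by
  obtain ⟨b', hb'⟩ := hM'.exists_top s
  exact ⟨b', hb _ _, hb' _ _, fun x => iff_of_true (hM.C_of_top hb) (hM'.C_of_top hb')⟩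

variable (θ) in
theorem closed : Closed Jsub M {p | ∃ b', Corr θ p.2 b'} where
  sim := fun _ _ _ _ ⟨_, h⟩ hab hst => h.exists_of_sim hab hst
  top _ _ hb := exists_of_top hb
  above := fun _ _ _ _ ⟨_, h⟩ hab ht => h.exists_of_le hab ht
  meet := fun _ _ _ _ _ _ ⟨_, h⟩ ⟨_, h'⟩ hc hr => h.exists_of_isMeet h' hc hr

end Corr

/-! ### Finite partial isomorphisms -/

/-- The multiplication relation, as a relation between elements of all sorts. -/
def Str.PElt (M : Str.{u, w} J) (p q r : M.Elt) : Prop :=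
  ∃ (s : Srt J) (a b c : M.carrier s), p = ⟨s, a⟩ ∧ q = ⟨s, b⟩ ∧ r = ⟨s, c⟩ ∧ M.P a b c

theorem Str.PElt_iff (M : Str.{u, w} J) (a b c : M.carrier s) :
    M.PElt ⟨s, a⟩ ⟨s, b⟩ ⟨s, c⟩ ↔ M.P a b c := by
  constructor
  · rintro ⟨t, a', b', c', ha, hb, hc, h⟩
    obtain rfl : s = t := congrArg Sigma.fst ha
    rw [eq_of_heq (Sigma.mk.inj ha).2, eq_of_heq (Sigma.mk.inj hb).2,
      eq_of_heq (Sigma.mk.inj hc).2]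
    exact h
  · exact fun h => ⟨s, a, b, c, rfl, rfl, rfl, h⟩

/-- A relation between the elements of two structures which preserves the basic relations. -/
structure PartialIso (T : M.Elt → M'.Elt → Prop) : Prop where
  sort : ∀ {p p'}, T p p' → p.1 = p'.1
  le : ∀ {p p' q q'}, T p p' → T q q' → (M.le p.2 q.2 ↔ M'.le p'.2 q'.2)
  C : ∀ {p p' q q'}, T p p' → T q q' → (M.C p.2 q.2 ↔ M'.C p'.2 q'.2)
  P : ∀ {p p' q q' r r'}, T p p' → T q q' → T r r' → (M.PElt p q r ↔ M'.PElt p' q' r')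

end

section

variable {J : Type u} {Jsub : ℕ+ → Tup J → Tup J} [Nonempty (Tup J)] {M M' : Str.{u, max u v} J}
  {s t r : Srt J}

theorem Corr.exists_emb {hM : Ax Jsub M} {hM' : Ax Jsub M'} {s₀ : Srt J} {a₀ : M.carrier s₀}
    {a₀' : M'.carrier s₀} (θ : hM.Cls a₀ ≃* hM'.Cls a₀') {X : Set M.Elt}
    (hX : ∀ p ∈ X, ∃ b', Corr θ p.2 b') :
    ∃ f : Emb (M.restrict (generated Jsub M X)) M',
      ∀ (s : Srt J) (a : (M.restrict (generated Jsub M X)).carrier s),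
        Corr θ a.1 (f.toFun s a) := by
  have h := (Corr.closed θ).generated_subset.{u, v} hM hX
  have h' : ∀ (s : Srt J) (a : (M.restrict (generated Jsub M X)).carrier s),
      ∃ b', Corr θ a.1 b' := fun s a => h a.2
  choose f hf using h'
  exact ⟨⟨f, fun s a b hab => Subtype.ext ((hf s a).symm.eq_of_eq (hf s b).symm hab),
    fun a b => ((hf _ a).le_iff (hf _ b)).symm, fun a b => ((hf _ a).C_iff_C (hf _ b)).symm,
    fun a b c => ((hf _ a).P_iff (hf _ b) (hf _ c)).symm⟩, hf⟩

omit [Nonempty (Tup J)] in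
-- Equality need not be demanded of a partial isomorphism: two elements of one sort are equal as
-- soon as they are equivalent and one is contained in the other.
theorem PartialIso.right_unique (hM' : Ax Jsub M') (hM : Ax Jsub M) {T : M.Elt → M'.Elt → Prop}
    (hT : PartialIso T) {p : M.Elt} {p' q' : M'.Elt} (h : T p p') (h' : T p q') : p' = q' := by
  have hs : p'.1 = q'.1 := (hT.sort h).symm.trans (hT.sort h')
  have h1 := (hT.le h h').1 (hM.le_refl _ _)
  have h2 := (hT.le h' h).1 (hM.le_refl _ _)
  have h3 := (hT.C h h').1 (hM.C_refl _ _)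
  obtain ⟨s, a⟩ := p'
  obtain ⟨t, b⟩ := q'
  obtain rfl : s = t := hs
  obtain rfl := hM'.eq_of_C (a := a) (b := b) h3 ⟨h1, h2⟩
  rfl

omit [Nonempty (Tup J)] in
theorem PartialIso.flip {T : M.Elt → M'.Elt → Prop} (hT : PartialIso T) :
    PartialIso (fun p' p => T p p') where
  sort h := (hT.sort h).symm
  le h h' := (hT.le h h').symm
  C h h' := (hT.C h h').symm
  P h h' h'' := (hT.P h h' h'').symm

/-- A partial isomorphism between locally full finite sets extends to an embedding of the
generated subsystem. -/
theorem PartialIso.exists_emb (hM : Ax Jsub M) (hM' : Ax Jsub M') {T : M.Elt → M'.Elt → Prop}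
    (hT : PartialIso T) (hdom : IsFrame M {p | ∃ p', T p p'})
    (hran : LocallyFull M' {p' | ∃ p, T p p'}) :
    ∃ f : Emb (M.restrict (generated Jsub M {p | ∃ p', T p p'})) M',
      ∀ p p', T p p' → ∀ hp : p ∈ generated Jsub M {p | ∃ p', T p p'},
        f.elt ⟨p.1, ⟨p.2, hp⟩⟩ = p' := by
  obtain ⟨⟨s₀, a₀⟩, ⟨p₀', h₀⟩, hleast⟩ := hdom.exists_least
  obtain ⟨t, a₀'⟩ := p₀'
  obtain rfl : s₀ = t := hT.sort h₀
  -- Local fullness on both sides makes `T` a bijection between the full classes of the two least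
  -- elements. It is the isomorphism `θ`.
  have h1 : ∀ x : hM.Cls a₀, ∃ x' : hM'.Cls a₀', T ⟨s₀, x.1⟩ ⟨s₀, x'.1⟩ := fun x => by
    obtain ⟨⟨t, x'⟩, hx⟩ := hdom.locallyFull s₀ a₀ x.1 ⟨_, h₀⟩ x.2.2 x.2.1
    obtain rfl : s₀ = t := hT.sort hx
    exact ⟨⟨x', (hT.le hx h₀).1 x.2.1, (hT.le h₀ hx).1 x.2.2⟩, hx⟩
  have h2 : ∀ x' : hM'.Cls a₀', ∃ x : hM.Cls a₀, T ⟨s₀, x.1⟩ ⟨s₀, x'.1⟩ := fun x' => by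
    obtain ⟨⟨t, x⟩, hx⟩ := hran s₀ a₀' x'.1 ⟨_, h₀⟩ x'.2.2 x'.2.1
    obtain rfl : t = s₀ := hT.sort hx
    exact ⟨⟨x, (hT.le hx h₀).2 x'.2.1, (hT.le h₀ hx).2 x'.2.2⟩, hx⟩
  choose f hf using h1
  choose g hg using h2
  have huniq : ∀ (x : hM.Cls a₀) (y z : hM'.Cls a₀'), T ⟨s₀, x.1⟩ ⟨s₀, y.1⟩ →
      T ⟨s₀, x.1⟩ ⟨s₀, z.1⟩ → y = z := fun x y z h h' =>
    Ax.Cls.ext (eq_of_heq (Sigma.mk.inj (hT.right_unique hM' hM h h')).2)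
  have huniq' : ∀ (x y : hM.Cls a₀) (z : hM'.Cls a₀'), T ⟨s₀, x.1⟩ ⟨s₀, z.1⟩ →
      T ⟨s₀, y.1⟩ ⟨s₀, z.1⟩ → x = y := fun x y z h h' =>
    Ax.Cls.ext (eq_of_heq (Sigma.mk.inj (hT.flip.right_unique hM hM' h h')).2)
  let θ : hM.Cls a₀ ≃* hM'.Cls a₀' :=
    { toFun := f
      invFun := g
      left_inv := fun x => huniq' _ _ (f x) (hg _) (hf _)
      right_inv := fun x => huniq (g x) _ _ (hf _) (hg _)
      map_mul' := fun x y => by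
        symm
        rw [← hM'.P_iff, ← Str.PElt_iff, ← hT.P (hf x) (hf y) (hf (x * y)), Str.PElt_iff]
        exact hM.mul_spec x y }
  have hcorr : ∀ (s : Srt J) (b : M.carrier s) (b' : M'.carrier s), T ⟨s, b⟩ ⟨s, b'⟩ →
      Corr θ b b' := fun s b b' h =>
    ⟨hleast _ ⟨_, h⟩, (hT.le h₀ h).1 (hleast _ ⟨_, h⟩), fun x => hT.C (hf x) h⟩
  obtain ⟨F, hF⟩ := Corr.exists_emb.{u, v} θ (X := {p | ∃ p', T p p'}) (by
    rintro ⟨s, b⟩ ⟨⟨t, b'⟩, h⟩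
    obtain rfl : s = t := hT.sort h
    exact ⟨b', hcorr _ _ _ h⟩)
  refine ⟨F, ?_⟩
  rintro ⟨s, b⟩ ⟨t, b'⟩ h hp
  obtain rfl : s = t := hT.sort h
  have := (hF s ⟨b, hp⟩).eq_of_eq (hcorr _ _ _ h) rfl
  exact Sigma.ext rfl (heq_of_eq this)

/-- Two embeddings which agree on the class of a least element are equal. -/
theorem Emb.eq_of_least (hM : Ax Jsub M) (hM' : Ax Jsub M') (f g : Emb M M') {a₀ : M.carrier s}
    (hle : ∀ (t : Srt J) (b : M.carrier t), M.le a₀ b)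
    (h : ∀ x : M.carrier s, M.Sim x a₀ → f.toFun s x = g.toFun s x) (b : M.carrier t) :
    f.toFun t b = g.toFun t b := by
  obtain ⟨x, hx, hxb⟩ := hM.exists_preimage _ _ a₀ b (hle _ b)
  refine hM'.eq_image ((f.map_C _ _).2 hxb) (by rw [h x hx]; exact (g.map_C _ _).2 hxb) ?_
  have key : ∀ f g : Emb M M', (∀ x : M.carrier s, M.Sim x a₀ → f.toFun s x = g.toFun s x) →
      M'.le (f.toFun t b) (g.toFun t b) := by
    intro f g h
    refine hM'.cle (hM'.C_of_fiber _ _ _ (f.toFun s x) _ _ ((f.map_C _ _).2 hxb) fun y hy hC => ?_)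
    -- The image of an embedding is a subsystem, so its classes are full and `y` comes from an
    -- element equivalent to `x`.
    have hmem := (Closed.univ.image.{u, v} hM hM' f).sim _ _ (f.toFun s x) y
      ⟨⟨s, x⟩, trivial, rfl⟩ hy subset_rfl
    obtain ⟨⟨t', z⟩, -, hz⟩ := hmem
    obtain rfl : t' = s := congrArg Sigma.fst hz
    obtain rfl : f.toFun t' z = y := eq_of_heq (Sigma.mk.inj hz).2
    rw [h z (hM.sim_trans ((f.map_sim _ _).1 hy) hx)]
    exact (g.map_C _ _).2 ((f.map_C _ _).1 hC)
  exact ⟨key f g h, key g f fun x hx => (h x hx).symm⟩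

end

/-! ### Finite tuples -/

section

variable {J : Type u} {M M' N : Str.{u, w} J} {n : ℕ} {σ : Fin n → Srt J}

/-- The members of a tuple with index in `I`. -/
def entries (e : ∀ i, M.carrier (σ i)) (I : Set (Fin n)) : Set M.Elt :=
  {p | ∃ i ∈ I, p = ⟨σ i, e i⟩}

/-- Two tuples satisfy the same atomic formulas with indices in `I`. -/
structure SameType (I : Set (Fin n)) (e : ∀ i, M.carrier (σ i)) (e' : ∀ i, M'.carrier (σ i)) :
    Prop where
  le : ∀ i j, i ∈ I → j ∈ I → (M.le (e i) (e j) ↔ M'.le (e' i) (e' j))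
  C : ∀ i j, i ∈ I → j ∈ I → (M.C (e i) (e j) ↔ M'.C (e' i) (e' j))
  P : ∀ i j k, i ∈ I → j ∈ I → k ∈ I →
    (M.PElt ⟨_, e i⟩ ⟨_, e j⟩ ⟨_, e k⟩ ↔ M'.PElt ⟨_, e' i⟩ ⟨_, e' j⟩ ⟨_, e' k⟩)

/-- The members of the tuple with index in `I` form a locally full set. -/
def TupleFull (I : Set (Fin n)) (e : ∀ i, M.carrier (σ i)) : Prop :=
  ∀ i, i ∈ I → ∀ y : M.carrier (σ i), M.Sim y (e i) →
    ∃ j, j ∈ I ∧ (⟨σ j, e j⟩ : M.Elt) = ⟨σ i, y⟩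

/-- The members of the tuple with index in `I` have a least element. -/
def TupleLeast (I : Set (Fin n)) (e : ∀ i, M.carrier (σ i)) : Prop :=
  ∃ i, i ∈ I ∧ ∀ j, j ∈ I → M.le (e i) (e j)

theorem tupleFull_iff {I : Set (Fin n)} {e : ∀ i, M.carrier (σ i)} :
    TupleFull I e ↔ LocallyFull M (entries e I) := by
  constructor
  · rintro h s a b ⟨i, hi, hia⟩ hab hba
    obtain rfl : s = σ i := congrArg Sigma.fst hia
    obtain rfl : a = e i := eq_of_heq (Sigma.mk.inj hia).2
    obtain ⟨j, hj, hjb⟩ := h i hi b ⟨hba, hab⟩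
    exact ⟨j, hj, hjb.symm⟩
  · intro h i hi y hy
    obtain ⟨j, hj, hjy⟩ := h _ _ y ⟨i, hi, rfl⟩ hy.2 hy.1
    exact ⟨j, hj, hjy.symm⟩

theorem isFrame_entries {I : Set (Fin n)} {e : ∀ i, M.carrier (σ i)} :
    IsFrame M (entries e I) ↔ TupleFull I e ∧ TupleLeast I e := by
  rw [tupleFull_iff]
  constructor
  · rintro ⟨-, h, _, ⟨i, hi, rfl⟩, hle⟩
    exact ⟨h, i, hi, fun j hj => hle _ ⟨j, hj, rfl⟩⟩
  · rintro ⟨h, i, hi, hle⟩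
    refine ⟨?_, h, _, ⟨i, hi, rfl⟩, ?_⟩
    · refine ((Set.toFinite I).image fun i => (⟨σ i, e i⟩ : M.Elt)).subset ?_
      rintro _ ⟨i, hi, rfl⟩
      exact ⟨i, hi, rfl⟩
    · rintro _ ⟨j, hj, rfl⟩
      exact hle j hj

theorem exists_entries_eq {X : Set M.Elt} (hX : X.Finite) :
    ∃ (n : ℕ) (σ : Fin n → Srt J) (e : ∀ i, M.carrier (σ i)), entries e Set.univ = X := by
  have := hX.to_subtype
  obtain ⟨n, ⟨f⟩⟩ := Finite.exists_equiv_fin X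
  refine ⟨n, fun i => (f.symm i).1.1, fun i => (f.symm i).1.2, Set.ext fun p => ?_⟩
  constructor
  · rintro ⟨i, -, rfl⟩
    exact (f.symm i).2
  · intro hp
    have h : (f.symm (f ⟨p, hp⟩)).1 = p := by rw [f.symm_apply_apply]
    exact ⟨f ⟨p, hp⟩, trivial, h.symm⟩

theorem SameType.partialIso {I : Set (Fin n)} {e : ∀ i, M.carrier (σ i)}
    {e' : ∀ i, M'.carrier (σ i)} (h : SameType I e e') :
    PartialIso fun (p : M.Elt) (p' : M'.Elt) =>
      ∃ i ∈ I, p = ⟨σ i, e i⟩ ∧ p' = ⟨σ i, e' i⟩ where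
  sort := by
    rintro _ _ ⟨i, hi, rfl, rfl⟩
    rfl
  le := by
    rintro _ _ _ _ ⟨i, hi, rfl, rfl⟩ ⟨j, hj, rfl, rfl⟩
    exact h.le i j hi hj
  C := by
    rintro _ _ _ _ ⟨i, hi, rfl, rfl⟩ ⟨j, hj, rfl, rfl⟩
    exact h.C i j hi hj
  P := by
    rintro _ _ _ _ _ _ ⟨i, hi, rfl, rfl⟩ ⟨j, hj, rfl, rfl⟩ ⟨k, hk, rfl, rfl⟩
    exact h.P i j k hi hj hk

theorem PartialIso.sameType {T : M.Elt → M'.Elt → Prop} (hT : PartialIso T) {I : Set (Fin n)}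
    {e : ∀ i, M.carrier (σ i)} {e' : ∀ i, M'.carrier (σ i)}
    (h : ∀ i ∈ I, T ⟨σ i, e i⟩ ⟨σ i, e' i⟩) : SameType I e e' where
  le i j hi hj := hT.le (h i hi) (h j hj)
  C i j hi hj := hT.C (h i hi) (h j hj)
  P i j k hi hj hk := hT.P (h i hi) (h j hj) (h k hk)

theorem Emb.map_PElt (f : Emb M N) (p q r : M.Elt) :
    N.PElt (f.elt p) (f.elt q) (f.elt r) ↔ M.PElt p q r := by
  constructor
  · rintro ⟨s, a, b, c, ha, hb, hc, h⟩
    obtain ⟨s, p⟩ := p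
    obtain ⟨t, q⟩ := q
    obtain ⟨u, r⟩ := r
    obtain rfl := congrArg Sigma.fst ha
    obtain rfl := congrArg Sigma.fst hb
    obtain rfl := congrArg Sigma.fst hc
    rw [← eq_of_heq (Sigma.mk.inj ha).2, ← eq_of_heq (Sigma.mk.inj hb).2,
      ← eq_of_heq (Sigma.mk.inj hc).2] at h
    exact ⟨_, p, q, r, rfl, rfl, rfl, (f.map_P _ _ _).1 h⟩
  · rintro ⟨s, a, b, c, rfl, rfl, rfl, h⟩
    exact ⟨s, _, _, _, rfl, rfl, rfl, (f.map_P _ _ _).2 h⟩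

theorem Emb.partialIso (f : Emb N M) (g : Emb N M') :
    PartialIso fun (p : M.Elt) (p' : M'.Elt) => ∃ q, p = f.elt q ∧ p' = g.elt q where
  sort := by
    rintro _ _ ⟨q, rfl, rfl⟩
    rfl
  le := by
    rintro _ _ _ _ ⟨q, rfl, rfl⟩ ⟨r, rfl, rfl⟩
    exact (f.map_le _ _).trans (g.map_le _ _).symm
  C := by
    rintro _ _ _ _ ⟨q, rfl, rfl⟩ ⟨r, rfl, rfl⟩
    exact (f.map_C _ _).trans (g.map_C _ _).symm
  P := by
    rintro _ _ _ _ _ _ ⟨q, rfl, rfl⟩ ⟨r, rfl, rfl⟩ ⟨k, rfl, rfl⟩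
    exact (f.map_PElt _ _ _).trans (g.map_PElt _ _ _).symm

theorem IsFrame.of_image (f : Emb M N) {X : Set M.Elt} (h : IsFrame N (f.elt '' X)) :
    IsFrame M X where
  finite := h.finite.of_finite_image f.elt_injective.injOn
  locallyFull s a b ha hab hba := by
    obtain ⟨q, hq, hqb⟩ := h.locallyFull s (f.toFun s a) (f.toFun s b) ⟨_, ha, rfl⟩
      ((f.map_le _ _).2 hab) ((f.map_le _ _).2 hba)
    rwa [← f.elt_injective (a₁ := q) (a₂ := ⟨s, b⟩) hqb]
  exists_least := by
    obtain ⟨_, ⟨p, hp, rfl⟩, hle⟩ := h.exists_least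
    exact ⟨p, hp, fun q hq => (f.map_le _ _).1 (hle _ ⟨q, hq, rfl⟩)⟩

theorem entries_map (f : Emb M N) (e : ∀ i, M.carrier (σ i)) (I : Set (Fin n)) :
    entries (fun i => f.toFun _ (e i)) I = f.elt '' entries e I := by
  ext p
  constructor
  · rintro ⟨i, hi, rfl⟩
    exact ⟨_, ⟨i, hi, rfl⟩, rfl⟩
  · rintro ⟨_, ⟨i, hi, rfl⟩, rfl⟩
    exact ⟨i, hi, rfl⟩

/-- The identity embedding. -/
def Emb.refl (M : Str.{u, w} J) : Emb M M where
  toFun _ a := a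
  inj _ _ _ h := h
  map_le _ _ := Iff.rfl
  map_C _ _ := Iff.rfl
  map_P _ _ _ := Iff.rfl

/-- The embedding in a substructure which contains all elements. -/
def Emb.toRestrict {A : Set M.Elt} (h : ∀ p, p ∈ A) : Emb M (M.restrict A) where
  toFun _ a := ⟨a, h _⟩
  inj _ _ _ h := Subtype.mk.inj h
  map_le _ _ := Iff.rfl
  map_C _ _ := Iff.rfl
  map_P _ _ _ := Iff.rfl

/-! ### Definability of properties of tuples -/

theorem Definable.pElt {E : Str.{u, w} J → Type (max u w)} {c : Ctx E} {s t r : Srt J}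
    {a : ∀ M : Str.{u, w} J, E M → M.carrier s} {b : ∀ M : Str.{u, w} J, E M → M.carrier t}
    {d : ∀ M : Str.{u, w} J, E M → M.carrier r} (ha : Reads c a) (hb : Reads c b)
    (hd : Reads c d) :
    Definable c (fun M p => M.PElt ⟨s, a M p⟩ ⟨t, b M p⟩ ⟨r, d M p⟩) := by
  by_cases h : s = t ∧ s = r
  · obtain ⟨rfl, rfl⟩ := h
    exact (Definable.P ha hb hd).congr fun M p => M.PElt_iff _ _ _
  · refine (Definable.const False).congr fun M p => iff_false_intro ?_
    rintro ⟨q, x, y, z, hx, hy, hz, -⟩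
    exact h ⟨(congrArg Sigma.fst hx).trans (congrArg Sigma.fst hy).symm,
      (congrArg Sigma.fst hx).trans (congrArg Sigma.fst hz).symm⟩

variable {E : Str.{u, w} J → Type (max u w)} {c : Ctx E}
  {e e' : ∀ M : Str.{u, w} J, E M → ∀ i, M.carrier (σ i)}

theorem Definable.tupleFull (I : Set (Fin n)) (he : ∀ i, Reads c (fun M p => e M p i)) :
    Definable c (fun M p => TupleFull I (e M p)) :=
  .forall_finite fun i => .imp (.const _) <| .all <| .imp (.sim .last (he i).wk) <|
    .exists_finite fun j => .and (.const _) <| .elt_eq (he j).wk .last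

theorem Definable.tupleLeast (I : Set (Fin n)) (he : ∀ i, Reads c (fun M p => e M p i)) :
    Definable c (fun M p => TupleLeast I (e M p)) :=
  .exists_finite fun i => .and (.const _) <| .forall_finite fun j => .imp (.const _) <|
    .le (he i) (he j)

theorem sameType_iff {I : Set (Fin n)} {e : ∀ i, M.carrier (σ i)} {e' : ∀ i, M'.carrier (σ i)} :
    SameType I e e' ↔
      (∀ i j, i ∈ I → j ∈ I → (M.le (e i) (e j) ↔ M'.le (e' i) (e' j))) ∧
      (∀ i j, i ∈ I → j ∈ I → (M.C (e i) (e j) ↔ M'.C (e' i) (e' j))) ∧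
      ∀ i j k, i ∈ I → j ∈ I → k ∈ I →
        (M.PElt ⟨_, e i⟩ ⟨_, e j⟩ ⟨_, e k⟩ ↔ M'.PElt ⟨_, e' i⟩ ⟨_, e' j⟩ ⟨_, e' k⟩) :=
  ⟨fun h => ⟨h.le, h.C, h.P⟩, fun h => ⟨h.1, h.2.1, h.2.2⟩⟩

theorem Definable.sameType (I : Set (Fin n)) (he : ∀ i, Reads c (fun M p => e M p i))
    (he' : ∀ i, Reads c (fun M p => e' M p i)) :
    Definable c (fun M p => SameType I (e M p) (e' M p)) := by
  refine Definable.congr ?_ fun M p => sameType_iff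
  exact .and (.forall_finite fun i => .forall_finite fun j => .imp (.const _) <|
      .imp (.const _) <| .iff (.le (he i) (he j)) (.le (he' i) (he' j))) <|
    .and (.forall_finite fun i => .forall_finite fun j => .imp (.const _) <|
      .imp (.const _) <| .iff (.C (he i) (he j)) (.C (he' i) (he' j))) <|
    .forall_finite fun i => .forall_finite fun j => .forall_finite fun k => .imp (.const _) <|
      .imp (.const _) <| .imp (.const _) <|
        .iff (.pElt (he i) (he j) (he k)) (.pElt (he' i) (he' j) (he' k))

theorem Definable.sameType_const (I : Set (Fin n)) (d : ∀ i, N.carrier (σ i))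
    (he' : ∀ i, Reads c (fun M p => e' M p i)) :
    Definable c (fun M p => SameType I d (e' M p)) := by
  refine Definable.congr ?_ fun M p => sameType_iff
  exact .and (.forall_finite fun i => .forall_finite fun j => .imp (.const _) <|
      .imp (.const _) <| .iff (.const _) (.le (he' i) (he' j))) <|
    .and (.forall_finite fun i => .forall_finite fun j => .imp (.const _) <|
      .imp (.const _) <| .iff (.const _) (.C (he' i) (he' j))) <|
    .forall_finite fun i => .forall_finite fun j => .forall_finite fun k => .imp (.const _) <|
      .imp (.const _) <| .imp (.const _) <| .iff (.const _) (.pElt (he' i) (he' j) (he' k))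

/-- The first-order form of an instance of the co-sorted embedding property. -/
def TupleExtension (σ : Fin n → Srt J) (I : Set (Fin n)) (M : Str.{u, w} J) : Prop :=
  ∀ e z : ∀ i, M.carrier (σ i), TupleFull Set.univ e → TupleLeast Set.univ e → TupleFull I e →
    TupleLeast I e → SameType I e z → TupleFull I z →
    ∃ x : ∀ i, M.carrier (σ i), (∀ i, i ∈ I → x i = z i) ∧ SameType Set.univ e x ∧
      TupleFull Set.univ x

theorem firstOrder_tupleExtension (σ : Fin n → Srt J) (I : Set (Fin n)) :
    FirstOrder (TupleExtension.{u, w} σ I) :=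
  .allBlock <| .allBlock <|
    .imp (.tupleFull _ fun i => .wkBlock <| .block i) <|
    .imp (.tupleLeast _ fun i => .wkBlock <| .block i) <|
    .imp (.tupleFull _ fun i => .wkBlock <| .block i) <|
    .imp (.tupleLeast _ fun i => .wkBlock <| .block i) <|
    .imp (.sameType _ (fun i => .wkBlock <| .block i) fun i => .block i) <|
    .imp (.tupleFull _ fun i => .block i) <|
    .exBlock <| .and (.forall_finite fun i => .imp (.const _) <|
      .eq (.block i) (.wkBlock <| .block i)) <|
    .and (.sameType _ (fun i => .wkBlock <| .wkBlock <| .block i) fun i => .block i) <|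
    .tupleFull _ fun i => .block i

theorem firstOrder_exists_sameType (d : ∀ i, N.carrier (σ i)) :
    FirstOrder fun M : Str.{u, w} J =>
      ∃ x : ∀ i, M.carrier (σ i), SameType Set.univ d x ∧ TupleFull Set.univ x :=
  .exBlock <| .and (.sameType_const _ _ fun i => .block i) <| .tupleFull _ fun i => .block i

end

/-! ### Embeddings of finitely generated systems -/

section

variable {J : Type u} {Jsub : ℕ+ → Tup J → Tup J} [Nonempty (Tup J)] {M M' A : Str.{u, max u v} J}

theorem SameType.exists_emb (hM : Ax Jsub M) (hM' : Ax Jsub M') {n : ℕ} {σ : Fin n → Srt J}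
    {I : Set (Fin n)} {e : ∀ i, M.carrier (σ i)} {e' : ∀ i, M'.carrier (σ i)}
    (h : SameType I e e') (hfull : TupleFull I e) (hleast : TupleLeast I e)
    (hfull' : TupleFull I e') :
    ∃ f : Emb (M.restrict (generated Jsub M (entries e I))) M',
      ∀ i ∈ I, ∀ hi : (⟨σ i, e i⟩ : M.Elt) ∈ generated Jsub M (entries e I),
        f.toFun (σ i) ⟨e i, hi⟩ = e' i := by
  have hdom : {p : M.Elt | ∃ p' : M'.Elt, ∃ i ∈ I, p = ⟨σ i, e i⟩ ∧ p' = ⟨σ i, e' i⟩} =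
      entries e I :=
    Set.ext fun p => ⟨fun ⟨_, i, hi, h, _⟩ => ⟨i, hi, h⟩, fun ⟨i, hi, h⟩ => ⟨_, i, hi, h, rfl⟩⟩
  have hran : {p' : M'.Elt | ∃ p : M.Elt, ∃ i ∈ I, p = ⟨σ i, e i⟩ ∧ p' = ⟨σ i, e' i⟩} =
      entries e' I :=
    Set.ext fun p => ⟨fun ⟨_, i, hi, _, h⟩ => ⟨i, hi, h⟩, fun ⟨i, hi, h⟩ => ⟨_, i, hi, rfl, h⟩⟩
  have key := h.partialIso.exists_emb.{u, v} hM hM'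
    (by rw [hdom]; exact isFrame_entries.2 ⟨hfull, hleast⟩)
    (by rw [hran]; exact tupleFull_iff.1 hfull')
  rw [hdom] at key
  obtain ⟨f, hf⟩ := key
  refine ⟨f, fun i hi hg => ?_⟩
  have := hf ⟨σ i, e i⟩ ⟨σ i, e' i⟩ ⟨i, hi, rfl, rfl⟩ hg
  exact eq_of_heq (Sigma.mk.inj this).2

theorem isFGSystem_restrict (hM : Ax Jsub M) {B : Set M.Elt} (hB : IsFGSubsystem Jsub M B) :
    IsFGSystem Jsub (M.restrict B) := by
  obtain ⟨hB, X, hX, hXB⟩ := hB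
  refine ⟨hB, (inclusion M B).elt ⁻¹' X, hX.preimage (inclusion M B).elt_injective.injOn, ?_⟩
  have hXB' : X ⊆ B := hXB ▸ subset_generated X
  have h1 : (inclusion M B).elt '' ((inclusion M B).elt ⁻¹' X) = X := by
    rw [Set.image_preimage_eq_iff]
    exact fun p hp => ⟨⟨p.1, ⟨p.2, hXB' hp⟩⟩, rfl⟩
  have h2 := image_generated.{u, v} hB.ax hM (inclusion M B) ((inclusion M B).elt ⁻¹' X)
  rw [h1, hXB] at h2
  refine Set.eq_univ_of_forall fun p => ?_
  have h3 := h2.ge (show (inclusion M B).elt p ∈ B from p.2.2)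
  exact (inclusion M B).elt_injective.mem_set_image.1 h3

theorem isFGSubsystem_generated (hM : Ax Jsub M) {X : Set M.Elt} (hX : X.Finite) :
    IsFGSubsystem Jsub M (generated Jsub M X) :=
  ⟨(closed_generated hM X).isSubsystem.{u, v} hM, X, hX, rfl⟩

theorem IsFGSystem.image (hA : IsFGSystem Jsub A) (hM : Ax Jsub M) (f : Emb A M) :
    IsFGSubsystem Jsub M (f.elt '' Set.univ) := by
  obtain ⟨hA, X, hX, hXA⟩ := hA
  rw [← hXA, image_generated.{u, v} hA.ax hM]
  exact isFGSubsystem_generated.{u, v} hM (hX.image _)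

theorem IsFGSystem.exists_isFrame (hA : IsFGSystem Jsub A) {Y : Set A.Elt} (hY : Y.Finite) :
    ∃ X, IsFrame A X ∧ Y ⊆ X ∧ generated Jsub A X = Set.univ := by
  obtain ⟨hA, X, hX, hXA⟩ := hA
  obtain ⟨Z, hZ, hXZ, hZA⟩ := SortedSystem.exists_isFrame.{u, v} hA.ax (hX.union hY)
  refine ⟨Z, hZ, Set.subset_union_right.trans hXZ, Set.eq_univ_of_univ_subset ?_⟩
  rw [← hXA, hZA]
  exact generated_mono.{u, v} hA.ax (Set.subset_union_left.trans (subset_generated _))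

theorem inCoFSIm_iff (hA : IsFGSystem Jsub A) (hM : Ax Jsub M) :
    InCoFSIm Jsub M A ↔ Nonempty (Emb A M) := by
  constructor
  · rintro ⟨B, -, h⟩
    obtain ⟨f, -⟩ := h.symm
    exact ⟨(inclusion M B).comp f⟩
  · rintro ⟨f⟩
    exact ⟨_, hA.image.{u, v} hM f, f.iso_restrict_range.symm⟩

/-- An embedding carries a generating frame of `A` to a frame of `M`, which is a finite presystem
generating the image. -/
theorem occurs_iff (hA : IsFGSystem Jsub A) (hM : Ax Jsub M) :
    Occurs Jsub A M ↔ Nonempty (Emb A M) := by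
  constructor
  · rintro ⟨X, -, -, h⟩
    obtain ⟨f, -⟩ := h.symm
    exact ⟨(inclusion M _).comp f⟩
  · rintro ⟨f⟩
    obtain ⟨X, hX, -, hXA⟩ := hA.exists_isFrame.{u, v} Set.finite_empty
    have h1 := hX.image.{u, v} hA.1.ax hM f
    refine ⟨f.elt '' X, h1.finite, h1.isPresystem.{u, v} hM, ?_⟩
    rw [← image_generated.{u, v} hA.1.ax hM, hXA]
    exact f.iso_restrict_range.symm

/-- The sentence asks for a locally full tuple with the diagram of a frame generating `A`. By the
extension of partial isomorphisms such a tuple yields an embedding of `A`. -/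
theorem exists_expresses_occurs (hA : IsFGSystem Jsub A) :
    ∃ φ : Sentence J, Expresses Jsub φ (Occurs Jsub A) := by
  obtain ⟨X, hX, -, hXA⟩ := hA.exists_isFrame.{u, v} Set.finite_empty
  obtain ⟨n, σ, d, rfl⟩ := exists_entries_eq hX.finite
  obtain ⟨hfull, hleast⟩ := isFrame_entries.1 hX
  obtain ⟨φ, hφ⟩ := (firstOrder_exists_sameType d).exists_sentence
  refine ⟨φ, fun M hM => (hφ M).trans ?_⟩
  rw [occurs_iff.{u, v} hA hM.ax]
  constructor
  · rintro ⟨x, hx, hxf⟩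
    obtain ⟨f, -⟩ := hx.exists_emb.{u, v} hA.1.ax hM.ax hfull hleast hxf
    exact ⟨f.comp (Emb.toRestrict fun p => hXA ▸ trivial)⟩
  · rintro ⟨f⟩
    refine ⟨fun i => f.toFun _ (d i), ((Emb.refl A).partialIso f).sameType fun i _ =>
      ⟨⟨σ i, d i⟩, rfl, rfl⟩, ?_⟩
    rw [tupleFull_iff, entries_map]
    exact (hX.image.{u, v} hA.1.ax hM.ax f).locallyFull

omit [Nonempty (Tup J)] in
theorem Expresses.omitted {φ : Sentence J} (h : Expresses Jsub φ (Occurs Jsub A)) :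
    Expresses Jsub (.imp φ .falsum) (Omitted Jsub A) := fun M hM => by
  have h1 : Models M (.imp φ .falsum) ↔ ¬ Models M φ := Iff.rfl
  rw [h1, h M hM]
  exact ⟨fun H Y hY hYp hiso => H ⟨Y, hY, hYp, hiso⟩, fun H ⟨Y, hY, hYp, hiso⟩ => H Y hY hYp hiso⟩

/-! ### The co-sorted embedding property is first-order -/

/-- Apply co-SEP to the subsystems generated by `e` and by its part over `I`, with the embedding
extending the assignment of `z` to that part. -/
theorem CoSEP.tupleExtension (hM : Ax Jsub M) (hco : CoSEP Jsub M) {n : ℕ} (σ : Fin n → Srt J)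
    (I : Set (Fin n)) : TupleExtension σ I M := by
  intro e z hef hel hIf hIl hez hzf
  obtain ⟨f, hf⟩ := hez.exists_emb.{u, v} hM hM hIf hIl hzf
  have hsub : entries e I ⊆ entries e Set.univ := fun p ⟨i, _, h⟩ => ⟨i, trivial, h⟩
  have hsub' : generated Jsub M (entries e I) ⊆ generated Jsub M (entries e Set.univ) :=
    generated_mono.{u, v} hM (hsub.trans (subset_generated _))
  have hframe : IsFrame M (entries e Set.univ) := isFrame_entries.2 ⟨hef, hel⟩
  obtain ⟨g, hg⟩ := hco _ _ (isFGSubsystem_generated.{u, v} hM hframe.finite)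
    (isFGSubsystem_generated.{u, v} hM (hframe.finite.subset hsub)) (inclusionOfSubset hsub') f
  let e' : ∀ i, (M.restrict (generated Jsub M (entries e Set.univ))).carrier (σ i) :=
    fun i => ⟨e i, subset_generated _ ⟨i, trivial, rfl⟩⟩
  refine ⟨fun i => g.toFun _ (e' i), fun i hi => ?_, ?_, ?_⟩
  · have hi' : (⟨σ i, e i⟩ : M.Elt) ∈ generated Jsub M (entries e I) :=
      subset_generated _ ⟨i, hi, rfl⟩
    exact (hg _ ⟨e i, hi'⟩).trans (hf i hi hi')
  · exact ((inclusion M _).partialIso g).sameType fun i _ => ⟨⟨σ i, e' i⟩, rfl, rfl⟩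
  · rw [tupleFull_iff, entries_map]
    have h1 : IsFrame _ (entries e' Set.univ) := by
      refine IsFrame.of_image (inclusion M _) ?_
      rw [← entries_map]
      exact hframe
    exact (h1.image.{u, v} ((closed_generated hM _).ax hM) hM g).locallyFull

/-- Choose a generating frame `Y` of `B`, enlarge `p(Y)` to a generating frame `Z` of `A`, and let
`e` list `Z`, with `I` the indices of `p(Y)`. A tuple extending `f` on `Y` gives an embedding `g` of
`A`, and `g ∘ p = f` need only be checked on the class of the least element of `Y`. -/
theorem CoSEP.of_tupleExtension (hM : Ax Jsub M)
    (h : ∀ (n : ℕ) (σ : Fin n → Srt J) (I : Set (Fin n)), TupleExtension σ I M) :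
    CoSEP Jsub M := by
  classical
  intro A B hA hB p f
  have hA' := isFGSystem_restrict.{u, v} hM hA
  have hB' := isFGSystem_restrict.{u, v} hM hB
  have hAax := hA'.1.ax
  have hBax := hB'.1.ax
  obtain ⟨Y, hY, -, hYB⟩ := hB'.exists_isFrame.{u, v} Set.finite_empty
  obtain ⟨Z, hZ, hYZ, hZA⟩ := hA'.exists_isFrame.{u, v} (hY.finite.image p.elt)
  obtain ⟨n, σ, e, rfl⟩ := exists_entries_eq hZ.finite
  let I : Set (Fin n) := {i | (⟨σ i, e i⟩ : (M.restrict A).Elt) ∈ p.elt '' Y}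
  have hI : ∀ i ∈ I, ∃ y : (M.restrict B).carrier (σ i), (⟨σ i, y⟩ : (M.restrict B).Elt) ∈ Y ∧
      p.toFun _ y = e i := by
    rintro i ⟨⟨s, y⟩, hy, hyi⟩
    have hs : s = σ i := congrArg Sigma.fst hyi
    subst hs
    exact ⟨y, hy, eq_of_heq (Sigma.mk.inj hyi).2⟩
  choose y hyY hy using hI
  let E : ∀ i, M.carrier (σ i) := fun i => (inclusion M A).toFun _ (e i)
  -- Only the entries over `I` are used; elsewhere the value is an arbitrary default.
  let z : ∀ i, M.carrier (σ i) := fun i => if hi : i ∈ I then f.toFun _ (y i hi) else E i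
  have hz : ∀ i (hi : i ∈ I), z i = f.toFun _ (y i hi) := fun i hi => dif_pos hi
  have hEI : entries e I = p.elt '' Y := by
    ext q
    constructor
    · rintro ⟨i, hi, rfl⟩
      exact hi
    · intro hq
      obtain ⟨i, -, rfl⟩ := hYZ hq
      exact ⟨i, hq, rfl⟩
  have hzI : entries z I = f.elt '' Y := by
    ext q
    constructor
    · rintro ⟨i, hi, rfl⟩
      exact ⟨_, hyY i hi, by rw [hz i hi]; rfl⟩
    · rintro ⟨⟨s, b⟩, hb, rfl⟩
      obtain ⟨i, -, hi⟩ := hYZ ⟨_, hb, rfl⟩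
      have hiI : i ∈ I := ⟨_, hb, hi⟩
      have hs : s = σ i := congrArg Sigma.fst hi
      subst hs
      have hb' : p.toFun _ b = p.toFun _ (y i hiI) :=
        (eq_of_heq (Sigma.mk.inj hi).2).trans (hy i hiI).symm
      exact ⟨i, hiI, by rw [hz i hiI, ← p.inj _ hb']; rfl⟩
  have hE1 : IsFrame M (entries E Set.univ) := by
    rw [entries_map]
    exact hZ.image.{u, v} hAax hM _
  have hE2 : IsFrame M (entries E I) := by
    rw [entries_map, hEI]
    exact (hY.image.{u, v} hBax hAax p).image.{u, v} hAax hM _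
  have hEz : SameType I E z :=
    (((inclusion M A).comp p).partialIso f).sameType fun i hi =>
      ⟨⟨σ i, y i hi⟩, congrArg (fun a => (inclusion M A).elt ⟨σ i, a⟩) (hy i hi).symm,
        by rw [hz i hi]; rfl⟩
  obtain ⟨x, hxz, hEx, hxf⟩ := h n σ I E z (isFrame_entries.1 hE1).1 (isFrame_entries.1 hE1).2
    (isFrame_entries.1 hE2).1 (isFrame_entries.1 hE2).2 hEz (by
      rw [tupleFull_iff, hzI]
      exact (hY.image.{u, v} hBax hM f).locallyFull)
  have hgen : generated Jsub M (entries E Set.univ) = A := by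
    rw [entries_map, ← image_generated.{u, v} hAax hM, hZA]
    ext q
    exact ⟨fun ⟨q', _, h⟩ => h ▸ q'.2.2, fun hq => ⟨⟨q.1, ⟨q.2, hq⟩⟩, trivial, rfl⟩⟩
  have key := hEx.exists_emb.{u, v} hM hM (isFrame_entries.1 hE1).1 (isFrame_entries.1 hE1).2 hxf
  rw [hgen] at key
  obtain ⟨g, hg⟩ := key
  refine ⟨g, fun s b => ?_⟩
  obtain ⟨⟨t, a₀⟩, ha₀, hle⟩ := hY.exists_least
  have hle' : ∀ q : (M.restrict B).Elt, (M.restrict B).le a₀ q.2 := by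
    intro q
    have := (Closed.setOf_le hBax ⟨t, a₀⟩).generated_subset.{u, v} hBax hle
    rw [hYB] at this
    exact this (Set.mem_univ q)
  refine Emb.eq_of_least.{u, v} hBax hM (g.comp p) f (a₀ := a₀) (fun t b => hle' ⟨t, b⟩)
    (fun b hb => ?_) b
  have hbY := hY.locallyFull t a₀ b ha₀ hb.2 hb.1
  obtain ⟨i, -, hi⟩ := hYZ ⟨_, hbY, rfl⟩
  have hiI : i ∈ I := ⟨_, hbY, hi⟩
  have hs : t = σ i := congrArg Sigma.fst hi
  subst hs
  have h1 : p.toFun _ b = e i := eq_of_heq (Sigma.mk.inj hi).2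
  have h2 : b = y i hiI := p.inj _ (h1.trans (hy i hiI).symm)
  have h3 : g.toFun _ (e i) = x i := hg i trivial (e i).2
  change g.toFun _ (p.toFun _ b) = _
  rw [h1, h3, hxz i hiI, hz i hiI, h2]

end

/-! ### Back and forth -/

section

variable {J : Type u} {Jsub : ℕ+ → Tup J → Tup J} {M N S : Str.{u, max u v} J}

/-- An embedding as an isomorphism onto its image. -/
def Emb.toRange (f : Emb M N) : Emb M (N.restrict (f.elt '' Set.univ)) where
  toFun s a := ⟨f.toFun s a, ⟨⟨s, a⟩, trivial, rfl⟩⟩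
  inj s _ _ h := f.inj s (Subtype.mk.inj h)
  map_le := f.map_le
  map_C := f.map_C
  map_P := f.map_P

theorem Emb.toRange_surjective (f : Emb M N) (s : Srt J) :
    Function.Surjective (f.toRange.toFun s) := by
  rintro ⟨b, ⟨t, a⟩, ha, hab⟩
  obtain rfl : t = s := congrArg Sigma.fst hab
  obtain rfl : f.toFun t a = b := eq_of_heq (Sigma.mk.inj hab).2
  exact ⟨a, rfl⟩

/-- The inverse of an embedding, on its image. -/
noncomputable def Emb.rangeInv (f : Emb M N) : Emb (N.restrict (f.elt '' Set.univ)) M :=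
  f.toRange.symm f.toRange_surjective

theorem Emb.rangeInv_toRange (f : Emb M N) {s : Srt J} (a : M.carrier s) :
    f.rangeInv.toFun s (f.toRange.toFun s a) = a :=
  f.toRange.symm_apply f.toRange_surjective a

/-- The assignments `e` and `e'` correspond to each other under an embedding of a finitely
generated subsystem. -/
def Similar (Jsub : ℕ+ → Tup J → Tup J) {Γ : List (Srt J)} (e : Env M Γ) (e' : Env S Γ) : Prop :=
  ∃ A : Set M.Elt, IsFGSubsystem Jsub M A ∧ ∃ f : Emb (M.restrict A) S,
    ∀ (s : Srt J) (x : Var Γ s), ∃ h : (⟨s, e s x⟩ : M.Elt) ∈ A, f.toFun s ⟨e s x, h⟩ = e' s x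

variable [Nonempty (Tup J)] {Γ : List (Srt J)} {e : Env M Γ} {e' : Env S Γ}

theorem Similar.symm (hM : Ax Jsub M) (hS : Ax Jsub S) (h : Similar Jsub e e') :
    Similar Jsub e' e := by
  obtain ⟨A, hA, f, hf⟩ := h
  refine ⟨_, (isFGSystem_restrict.{u, v} hM hA).image.{u, v} hS f,
    (inclusion M A).comp f.rangeInv, fun s x => ?_⟩
  obtain ⟨h, hx⟩ := hf s x
  refine ⟨⟨⟨s, ⟨e s x, h⟩⟩, trivial, Sigma.ext rfl (heq_of_eq hx)⟩, ?_⟩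
  refine Eq.trans ?_ (congrArg ((inclusion M A).toFun s) (f.rangeInv_toRange ⟨e s x, h⟩))
  refine congrArg (fun b => (inclusion M A).toFun s (f.rangeInv.toFun s b)) (Subtype.ext ?_)
  exact hx.symm

/-- Let `A'` be generated by `A` and `a`, and let `k` embed `A'` in `S`, perhaps in disagreement
with `f`. Co-SEP of `S`, applied to `k ∘ f⁻¹ : f(A) → k(A')` and the inclusion of `f(A)`, gives `g`
such that `g ∘ k` extends `f`. -/
theorem Similar.forth (hM : Ax Jsub M) (hS : Ax Jsub S) (hco : CoSEP Jsub S)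
    (hMS : ∀ A, IsFGSubsystem Jsub M A → Nonempty (Emb (M.restrict A) S))
    (h : Similar Jsub e e') {s : Srt J} (a : M.carrier s) :
    ∃ b : S.carrier s, Similar Jsub (Env.cons a e) (Env.cons b e') := by
  obtain ⟨A, hA, f, hf⟩ := h
  obtain ⟨X, hX, hXA⟩ := hA.2
  have hA' := isFGSubsystem_generated.{u, v} hM (hX.insert ⟨s, a⟩)
  set A' := generated Jsub M (insert ⟨s, a⟩ X)
  have hsub : A ⊆ A' := by
    rw [← hXA]
    exact generated_mono.{u, v} hM ((Set.subset_insert _ _).trans (subset_generated _))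
  obtain ⟨k⟩ := hMS A' hA'
  obtain ⟨g, hg⟩ := hco _ _ ((isFGSystem_restrict.{u, v} hM hA').image.{u, v} hS k)
    ((isFGSystem_restrict.{u, v} hM hA).image.{u, v} hS f)
    (k.toRange.comp ((inclusionOfSubset hsub).comp f.rangeInv)) (inclusion S _)
  have haA : (⟨s, a⟩ : M.Elt) ∈ A' := subset_generated _ (Set.mem_insert _ _)
  have key : ∀ (t : Srt J) (y : (M.restrict A).carrier t),
      (g.comp k.toRange).toFun t ((inclusionOfSubset hsub).toFun t y) = f.toFun t y := by
    intro t y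
    refine Eq.trans ?_ (hg t (f.toRange.toFun t y))
    exact congrArg (fun z => g.toFun t (k.toRange.toFun t ((inclusionOfSubset hsub).toFun t z)))
      (f.rangeInv_toRange y).symm
  refine ⟨(g.comp k.toRange).toFun s ⟨a, haA⟩, A', hA', g.comp k.toRange, fun t x => ?_⟩
  cases x with
  | zero => exact ⟨haA, rfl⟩
  | succ x =>
    obtain ⟨h, hx⟩ := hf t x
    exact ⟨hsub h, (key t ⟨e t x, h⟩).trans hx⟩

theorem Similar.sat_iff (hM : Ax Jsub M) (hS : Ax Jsub S) (hcoM : CoSEP Jsub M)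
    (hcoS : CoSEP Jsub S)
    (hMS : ∀ A, IsFGSubsystem Jsub M A → Nonempty (Emb (M.restrict A) S))
    (hSM : ∀ A, IsFGSubsystem Jsub S A → Nonempty (Emb (S.restrict A) M)) (φ : Fml J Γ)
    (h : Similar Jsub e e') : Sat M φ e ↔ Sat S φ e' := by
  induction φ with
  | falsum => exact Iff.rfl
  | eq x y =>
    obtain ⟨A, -, f, hf⟩ := h
    obtain ⟨hx, hx'⟩ := hf _ x
    obtain ⟨hy, hy'⟩ := hf _ y
    rw [Sat, Sat, ← hx', ← hy']
    exact ⟨fun h => congrArg _ (Subtype.ext h), fun h => congrArg Subtype.val (f.inj _ h)⟩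
  | le x y =>
    obtain ⟨A, -, f, hf⟩ := h
    obtain ⟨hx, hx'⟩ := hf _ x
    obtain ⟨hy, hy'⟩ := hf _ y
    rw [Sat, Sat, ← hx', ← hy']
    exact (f.map_le ⟨_, hx⟩ ⟨_, hy⟩).symm
  | C x y =>
    obtain ⟨A, -, f, hf⟩ := h
    obtain ⟨hx, hx'⟩ := hf _ x
    obtain ⟨hy, hy'⟩ := hf _ y
    rw [Sat, Sat, ← hx', ← hy']
    exact (f.map_C ⟨_, hx⟩ ⟨_, hy⟩).symm
  | P x y z =>
    obtain ⟨A, -, f, hf⟩ := h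
    obtain ⟨hx, hx'⟩ := hf _ x
    obtain ⟨hy, hy'⟩ := hf _ y
    obtain ⟨hz, hz'⟩ := hf _ z
    rw [Sat, Sat, ← hx', ← hy', ← hz']
    exact (f.map_P ⟨_, hx⟩ ⟨_, hy⟩ ⟨_, hz⟩).symm
  | imp φ ψ ihφ ihψ => exact imp_congr (ihφ h) (ihψ h)
  | all s φ ih =>
    constructor
    · intro H b
      obtain ⟨a, ha⟩ := (h.symm.{u, v} hM hS).forth.{u, v} hS hM hcoM hSM b
      exact (ih (ha.symm.{u, v} hS hM)).1 (H a)
    · intro H a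
      obtain ⟨b, hb⟩ := h.forth.{u, v} hM hS hcoS hMS a
      exact (ih hb).2 (H b)

/-- Systems with the co-sorted embedding property which have the same finitely generated
subsystems are elementarily equivalent. -/
theorem models_iff (hM : Ax Jsub M) (hS : Ax Jsub S) (hcoM : CoSEP Jsub M)
    (hcoS : CoSEP Jsub S)
    (hMS : ∀ A, IsFGSubsystem Jsub M A → Nonempty (Emb (M.restrict A) S))
    (hSM : ∀ A, IsFGSubsystem Jsub S A → Nonempty (Emb (S.restrict A) M)) (φ : Sentence J) :
    Models M φ ↔ Models S φ := by
  -- The game starts from the subsystem generated by the empty set.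
  have hA := isFGSubsystem_generated.{u, v} hM Set.finite_empty
  obtain ⟨f⟩ := hMS _ hA
  exact Similar.sat_iff.{u, v} hM hS hcoM hcoS hMS hSM φ ⟨_, hA, f, fun s x => nomatch x⟩

end

/-! ### Models of the theory and the final assembly -/

/-- Both the axioms of sorted complete systems and the tuple form of co-SEP are first-order
properties of all co-SEP systems, so sentences stating them already belong to the theory. -/
theorem isModel_SCSSEP_iff {J : Type u} {Jsub : ℕ+ → Tup J → Tup J} [Nonempty (Tup J)]
    (M : Str.{u, max u v} J) :
    IsModel M (SCSSEP.{u, max u v} Jsub) ↔ IsSCS Jsub M ∧ CoSEP Jsub M := by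
  refine ⟨fun h => ?_, fun h φ hφ => hφ M h.1 h.2⟩
  have key : ∀ Q : Str.{u, max u v} J → Prop, FirstOrder Q →
      (∀ N, IsSCS Jsub N ∧ CoSEP Jsub N → Q N) → Q M := by
    intro Q hQ hN
    obtain ⟨φ, hφ⟩ := hQ.exists_sentence
    exact (hφ M).1 (h φ fun N hN₁ hN₂ => (hφ N).2 (hN N ⟨hN₁, hN₂⟩))
  have hM : Ax Jsub M := Ax.of_firstOrder (fun N hN => hN.1.ax) key
  exact ⟨Ax.isSCS.{u, v} hM, CoSEP.of_tupleExtension.{u, v} hM fun n σ I =>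
    key _ (firstOrder_tupleExtension σ I) fun N hN => hN.2.tupleExtension.{u, v} hN.1.ax σ I⟩

end SortedSystem

theorem mainTheorem5 {J : Type u} [Countable J]
    (Jsub : ℕ+ → SortedSystem.Tup J → SortedSystem.Tup J)
    (S : SortedSystem.Str.{u, max u v} J)
    (hS : SortedSystem.IsSCS Jsub S) (hco : SortedSystem.CoSEP Jsub S) :
    -- the models of the theory of co-SEP systems are exactly the co-SEP systems
    (∀ M : SortedSystem.Str.{u, max u v} J,
      SortedSystem.IsModel M (SortedSystem.SCSSEP.{u, max u v} Jsub) ↔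
        SortedSystem.IsSCS Jsub M ∧ SortedSystem.CoSEP Jsub M) ∧
    -- each of the further axioms can be written as a first-order sentence
    (∀ A : SortedSystem.Str.{u, max u v} J, SortedSystem.IsFGSystem Jsub A →
      (∃ φ : SortedSystem.Sentence J,
        SortedSystem.Expresses Jsub φ (SortedSystem.Occurs Jsub A)) ∧
      (∃ φ : SortedSystem.Sentence J,
        SortedSystem.Expresses Jsub φ (SortedSystem.Omitted Jsub A))) ∧
    -- these axioms axiomatize the complete theory of `S`
    SortedSystem.IsAxiomatizedBy.{u, max u v} (SortedSystem.Th S)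
      (SortedSystem.SCSSEP.{u, max u v} Jsub ∪ SortedSystem.OccurrenceAxioms Jsub S ∪
        SortedSystem.OmissionAxioms Jsub S) := by
  open SortedSystem in
  have := hS.nonempty_tup
  refine ⟨isModel_SCSSEP_iff.{u, v}, fun A hA => ?_, fun M => ⟨fun h => ?_, fun h => ?_⟩⟩
  · obtain ⟨φ, hφ⟩ := exists_expresses_occurs.{u, v} hA
    exact ⟨⟨φ, hφ⟩, _, hφ.omitted⟩
  · rintro φ ((hφ | ⟨A, hA, hAS, hφ⟩) | ⟨A, hA, hAS, hφ⟩)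
    · exact h φ (hφ S hS hco)
    · refine h φ ((hφ S hS).2 ((occurs_iff.{u, v} hA hS.ax).2 ?_))
      exact (inCoFSIm_iff.{u, v} hA hS.ax).1 hAS
    · refine h φ ((hφ S hS).2 fun Y hY hYp hiso => hAS ?_)
      exact (inCoFSIm_iff.{u, v} hA hS.ax).2 ((occurs_iff.{u, v} hA hS.ax).1 ⟨Y, hY, hYp, hiso⟩)
  · obtain ⟨hM, hcoM⟩ := (isModel_SCSSEP_iff.{u, v} M).1 fun φ hφ => h φ (Or.inl (Or.inl hφ))
    have hMS : ∀ A, IsFGSubsystem Jsub M A → Nonempty (Emb (M.restrict A) S) := fun A hA => by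
      have hA' := isFGSystem_restrict.{u, v} hM.ax hA
      by_contra hne
      obtain ⟨φ, hφ⟩ := exists_expresses_occurs.{u, v} hA'
      have h1 := (hφ.omitted M hM).1 (h _ (Or.inr ⟨_, hA',
        fun h' => hne ((inCoFSIm_iff.{u, v} hA' hS.ax).1 h'), hφ.omitted⟩))
      obtain ⟨Y, hY, hYp, hiso⟩ := (occurs_iff.{u, v} hA' hM.ax).2 ⟨inclusion M A⟩
      exact h1 Y hY hYp hiso
    -- Here the occurrence axioms provide the embeddings.
    have hSM : ∀ A, IsFGSubsystem Jsub S A → Nonempty (Emb (S.restrict A) M) := fun A hA => by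
      have hA' := isFGSystem_restrict.{u, v} hS.ax hA
      obtain ⟨φ, hφ⟩ := exists_expresses_occurs.{u, v} hA'
      exact (occurs_iff.{u, v} hA' hM.ax).1 ((hφ M hM).1 (h _ (Or.inl (Or.inr ⟨_, hA',
        (inCoFSIm_iff.{u, v} hA' hS.ax).2 ⟨inclusion S A⟩, hφ⟩))))
    exact fun φ hφ => (models_iff.{u, v} hM.ax hS.ax hcoM hco hMS hSM φ).2 hφ
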